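/- **Setting.** Let $T^n=\{(\lambda_0,\dots,\lambda_n)\in\mathbb R^{n+1}:\lambda_i\ge 0,\ \sum_i\lambda_i=1\}$. Let $\mathcal P_r\Lambda^k(\mathbb R^{n+1})$ be the space of $k$-forms on $\mathbb R^{n+1}$ with polynomial coefficients of degree at most $r$ (zero if $r<0$), and let $\mathcal P_r^-\Lambda^k(\mathbb R^{n+1})=i_X\,\mathcal P_{r-1}\Lambda^{k+1}(\mathbb R^{n+1})$, where $i_X$ is contraction with the position vector field $X$. Let $\mathcal P_r\Lambda^k(T^n)$ and $\mathcal P_r^-\Lambda^k(T^n)$ be the images of these spaces under restriction of forms to $T^n$. The symmetric group $S_{n+1}$ acts on forms on $T^n$: a permutation $\pi$ acts by pullback along $S_\pi(\lambda_0,\dots,\lambda_n)=(\lambda_{\pi(0)},\dots,\lambda_{\pi(n)})$. For a face $F$ of $T^n$, the trace $\operatorname{tr}_F$ is the pullback of forms to $F$. A basis $\xi_1,\dots,\xi_N$ of an $S_{n+1}$-invariant space $V$ of forms is *$S_{n+1}$-invariant up to sign* if for all $\pi\in S_{n+1}$ and all $i$ there is $i'$ with $\pi\xi_i=\pm\xi_{i'}$.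 For a finite-dimensional space $V$ of $k$-forms on $T^n$, let $V(F)=\operatorname{tr}_F V$, and let $\mathring V(F)$ be the set of those forms in $V(F)$ whose trace on $\partial F$ (i.e. on each codimension-one subface of $F$) vanishes. For $0\le d\le n+1$ let $V_d$ be the set of those forms in $V$ whose traces vanish on all $(d-1)$-dimensional faces of $T^n$, so that $V=V_0\supseteq V_1\supseteq\dots\supseteq V_{n+1}=0$. A *choice of complements* is a family of subspaces $W_0,\dots,W_n$ with $V_d=W_d\oplus V_{d+1}$ for $0\le d\le n$; then $V=W_0\oplus\dots\oplus W_n$. It is *invariant* if every $W_d$ is an $S_{n+1}$-invariant subspace. The associated *geometric decomposition map* $$\mathcal D\colon V\to\bigoplus_{d=0}^n\ \bigoplus_{\dim F=d}\mathring V(F)$$ is the linear map with $\mathcal D(\alpha)=\bigoplus_{\dim F=d}\operatorname{tr}_F\alpha$ for $\alpha\in W_d$. A basis of $V$ *can be geometrically decomposed* with respect to $(W_d)$ if for every basis element $\xi$, $\mathcal D(\xi)$ lies in one of the direct summands $\mathring V(F)$. **Statement.** Let $r\ge 1$. For each of the following spaces $V$ of forms on $T^3$, there exist a choice of complements $(W_d)$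 and a basis of $V$ that is $S_4$-invariant up to sign and can be geometrically decomposed with respect to $(W_d)$ if and only if the corresponding condition holds: - $\mathcal P_r\Lambda^1(T^3)$: if and only if $r\notin 3\mathbb N_0+3$; - $\mathcal P_r^-\Lambda^1(T^3)$: if and only if $r\notin 3\mathbb N_0+2$; - $\mathcal P_r\Lambda^2(T^3)$: if and only if $r\notin 3\mathbb N_0+3$; - $\mathcal P_r^-\Lambda^2(T^3)$: always. Moreover, the answer does not depend on the complements as long as they are invariant: for every invariant choice of complements $(W_d)$, $V$ has a basis that is $S_4$-invariant up to sign and can be geometrically decomposed with respect to $(W_d)$ if and only if the condition on $r$ above holds. -/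

import Mathlib

noncomputable section

namespace FEEC

/-! ### The simplex, its faces, differential forms and traces

A face of the standard simplex `T^n ⊆ ℝ^(n+1)` is given by the finite set `F` of its vertices, and
`T^n` itself is `F = Finset.univ`. -/

/-- The closed face with vertex set `F` of the standard simplex `T^n ⊆ ℝ^(n+1)`. -/
def facePoints (n : ℕ) (F : Finset (Fin (n + 1))) : Set (Fin (n + 1) → ℝ) :=
  {x | (∀ i, 0 ≤ x i) ∧ ∑ i, x i = 1 ∧ ∀ i, i ∉ F → x i = 0}

/-- The tangent space of the face with vertex set `F`. -/
def tangent (n : ℕ) (F : Finset (Fin (n + 1))) : Submodule ℝ (Fin (n + 1) → ℝ) where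
  carrier := {v | ∑ i, v i = 0 ∧ ∀ i, i ∉ F → v i = 0}
  add_mem' := by
    rintro v w ⟨hv, hv'⟩ ⟨hw, hw'⟩
    refine ⟨by simp [Finset.sum_add_distrib, hv, hw], fun i hi => by simp [hv' i hi, hw' i hi]⟩
  zero_mem' := by simp
  smul_mem' := by
    rintro c v ⟨hv, hv'⟩
    refine ⟨by simp [← Finset.mul_sum, hv], fun i hi => by simp [hv' i hi]⟩

/-- `k`-forms on the face with vertex set `F` (no regularity is imposed here; the spaces below
consist of forms with polynomial coefficients). -/
abbrev Form (n k : ℕ) (F : Finset (Fin (n + 1))) : Type :=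
  facePoints n F → (tangent n F) [⋀^Fin k]→ₗ[ℝ] ℝ

/-- `k`-forms on `ℝ^(n+1)`. -/
abbrev AmbientForm (n k : ℕ) : Type :=
  (Fin (n + 1) → ℝ) → (Fin (n + 1) → ℝ) [⋀^Fin k]→ₗ[ℝ] ℝ

theorem facePoints_mono {n : ℕ} {F G : Finset (Fin (n + 1))} (h : G ⊆ F) :
    facePoints n G ⊆ facePoints n F :=
  fun _ hx => ⟨hx.1, hx.2.1, fun i hi => hx.2.2 i fun hG => hi (h hG)⟩

theorem tangent_mono {n : ℕ} {F G : Finset (Fin (n + 1))} (h : G ⊆ F) :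
    tangent n G ≤ tangent n F :=
  fun _ hv => ⟨hv.1, fun i hi => hv.2 i fun hG => hi (h hG)⟩

/-- The trace of forms on `F` to a subface `G`: pullback along the inclusion. -/
def trace (k : ℕ) {n : ℕ} {F G : Finset (Fin (n + 1))} (h : G ⊆ F) :
    Form n k F →ₗ[ℝ] Form n k G where
  toFun ω x := (ω ⟨x.1, facePoints_mono h x.2⟩).compLinearMap
    (Submodule.inclusion (tangent_mono h))
  map_add' _ _ := rfl
  map_smul' _ _ := rfl

theorem trace_trace (k : ℕ) {n : ℕ} {F G H : Finset (Fin (n + 1))} (h : G ⊆ F) (h' : H ⊆ G)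
    (ω : Form n k F) : trace k h' (trace k h ω) = trace k (h'.trans h) ω := rfl

theorem trace_self (k : ℕ) {n : ℕ} {F : Finset (Fin (n + 1))} (ω : Form n k F) :
    trace k (Finset.Subset.refl F) ω = ω := rfl

/-- The restriction of forms on `ℝ^(n+1)` to forms on `T^n`. -/
def restrict (n k : ℕ) : AmbientForm n k →ₗ[ℝ] Form n k Finset.univ where
  toFun ω x := (ω x.1).compLinearMap (tangent n Finset.univ).subtype
  map_add' _ _ := rfl
  map_smul' _ _ := rfl

/-! ### The spaces `P_r Λ^k` and `P_r^- Λ^k` -/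

/-- `P_r Λ^k(ℝ^(n+1))`: the forms all of whose coefficients with respect to the standard
coordinates are polynomials of degree at most `r`. It is zero for `r < 0`. -/
def ambientPoly (n : ℕ) (r : ℤ) (k : ℕ) : Submodule ℝ (AmbientForm n k) where
  carrier := {ω | ∀ I : Fin k → Fin (n + 1), ∃ p : MvPolynomial (Fin (n + 1)) ℝ,
    (p ≠ 0 → (p.totalDegree : ℤ) ≤ r) ∧
      ∀ x, ω x (fun j => Pi.single (I j) 1) = MvPolynomial.eval x p}
  add_mem' := by
    intro ω η hω hη I
    obtain ⟨p, hp, hp'⟩ := hω I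
    obtain ⟨q, hq, hq'⟩ := hη I
    refine ⟨p + q, fun h => ?_, fun x => by simp [hp', hq']⟩
    by_cases p0 : p = 0
    · subst p0
      simpa using hq (by simpa using h)
    by_cases q0 : q = 0
    · subst q0
      simpa using hp (by simpa using h)
    have h1 := MvPolynomial.totalDegree_add p q
    have h2 := hp p0
    have h3 := hq q0
    rcases le_max_iff.1 h1 with h4 | h4 <;> omega
  zero_mem' := fun _ => ⟨0, by simp, by simp⟩
  smul_mem' := by
    intro c ω hω I
    obtain ⟨p, hp, hp'⟩ := hω I
    refine ⟨c • p, fun h => ?_, fun x => by simp [hp', MvPolynomial.smul_eval]⟩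
    have h1 := MvPolynomial.totalDegree_smul_le c p
    have h2 := hp (fun h0 => h (by simp [h0]))
    omega

/-- The contraction `i_X` with the position vector field `X` on `ℝ^(n+1)`:
`(i_X α)(Y₁, …, Y_k) = α(X, Y₁, …, Y_k)`. -/
def contractX (n k : ℕ) : AmbientForm n (k + 1) →ₗ[ℝ] AmbientForm n k where
  toFun α x := (α x).curryLeft x
  map_add' _ _ := rfl
  map_smul' _ _ := rfl

/-- `P_r Λ^k(T^n)`. -/
def polyForms (n : ℕ) (r : ℤ) (k : ℕ) : Submodule ℝ (Form n k Finset.univ) :=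
  (ambientPoly n r k).map (restrict n k)

/-- `P_r^- Λ^k(T^n)`: restrictions to `T^n` of the forms `i_X α` with
`α ∈ P_{r-1} Λ^{k+1}(ℝ^(n+1))`. -/
def polyMinusForms (n : ℕ) (r : ℤ) (k : ℕ) : Submodule ℝ (Form n k Finset.univ) :=
  ((ambientPoly n (r - 1) (k + 1)).map (contractX n k)).map (restrict n k)

/-! ### The action of the symmetric group -/

/-- `S_π (x₀, …, x_n) = (x_{π 0}, …, x_{π n})` on `T^n`. -/
def permPoints {n : ℕ} (π : Equiv.Perm (Fin (n + 1))) (x : facePoints n Finset.univ) :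
    facePoints n Finset.univ :=
  ⟨fun i => x.1 (π i), fun i => x.2.1 (π i), by rw [Equiv.sum_comp π x.1]; exact x.2.2.1,
    fun i hi => absurd (Finset.mem_univ i) hi⟩

/-- The differential of `S_π`. -/
def permTangent {n : ℕ} (π : Equiv.Perm (Fin (n + 1))) :
    tangent n Finset.univ →ₗ[ℝ] tangent n Finset.univ where
  toFun v := ⟨fun i => v.1 (π i), by rw [Equiv.sum_comp π v.1]; exact v.2.1,
    fun i hi => absurd (Finset.mem_univ i) hi⟩
  map_add' _ _ := rfl
  map_smul' _ _ := rfl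

/-- The representation of `S_{n+1}` on `k`-forms on `T^n`, in which `π` acts by the pullback
`S_π^*`. -/
def permRep (n k : ℕ) :
    Representation ℝ (Equiv.Perm (Fin (n + 1))) (Form n k Finset.univ) where
  toFun π :=
    { toFun := fun ω x => (ω (permPoints π x)).compLinearMap (permTangent π)
      map_add' := fun _ _ => rfl
      map_smul' := fun _ _ => rfl }
  map_one' := rfl
  map_mul' _ _ := rfl

/-! ### Geometric decomposition -/

/-- `V(F) = tr_{T^n,F} V`. -/
def traceSpace {n k : ℕ} (V : Submodule ℝ (Form n k Finset.univ)) (F : Finset (Fin (n + 1))) :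
    Submodule ℝ (Form n k F) :=
  V.map (trace k (Finset.subset_univ F))

/-- The forms in `V(F)` whose trace vanishes on `∂F`, that is, on all subfaces of codimension one
of `F`. (If `F` is a vertex, then `G` is the empty face, on which every form is zero, so that there
is no condition.) -/
def bubbleSpace {n k : ℕ} (V : Submodule ℝ (Form n k Finset.univ)) (F : Finset (Fin (n + 1))) :
    Submodule ℝ (Form n k F) :=
  traceSpace V F ⊓
    ⨅ (G : Finset (Fin (n + 1))) (h : G ⊆ F) (_ : G.card + 1 = F.card), LinearMap.ker (trace k h)

/-- `V_d`: the forms in `V` whose traces vanish on all `(d-1)`-dimensional faces of `T^n`, that is,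
the faces with `d` vertices, for `0 ≤ d ≤ n + 1`. -/
def filtration {n k : ℕ} (V : Submodule ℝ (Form n k Finset.univ)) (d : ℕ) :
    Submodule ℝ (Form n k Finset.univ) :=
  V ⊓ ⨅ (F : Finset (Fin (n + 1))) (_ : F.card = d), LinearMap.ker (trace k (Finset.subset_univ F))

theorem mem_bubbleSpace {n k : ℕ} {V : Submodule ℝ (Form n k Finset.univ)}
    {F : Finset (Fin (n + 1))} {ω : Form n k F} :
    ω ∈ bubbleSpace V F ↔ (∃ α ∈ V, trace k (Finset.subset_univ F) α = ω) ∧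
      ∀ (G : Finset (Fin (n + 1))) (h : G ⊆ F), G.card + 1 = F.card → trace k h ω = 0 := by
  simp [bubbleSpace, traceSpace, Submodule.mem_iInf]

theorem mem_filtration {n k : ℕ} {V : Submodule ℝ (Form n k Finset.univ)} {d : ℕ}
    {ω : Form n k Finset.univ} :
    ω ∈ filtration V d ↔ ω ∈ V ∧
      ∀ F : Finset (Fin (n + 1)), F.card = d → trace k (Finset.subset_univ F) ω = 0 := by
  simp [filtration, Submodule.mem_iInf]

theorem filtration_zero {n k : ℕ} (V : Submodule ℝ (Form n k Finset.univ)) :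
    filtration V 0 = V := by
  ext ω
  rw [mem_filtration, and_iff_left_iff_imp]
  intro _ F hF
  obtain rfl := Finset.card_eq_zero.1 hF
  funext x
  have h0 : (0 : ℝ) = 1 := by
    rw [← x.2.2.1]
    exact (Finset.sum_eq_zero fun i _ => x.2.2.2 i (Finset.notMem_empty i)).symm
  exact absurd h0 zero_ne_one

theorem filtration_top {n k : ℕ} (V : Submodule ℝ (Form n k Finset.univ)) :
    filtration V (n + 1) = ⊥ := by
  rw [eq_bot_iff]
  intro ω hω
  exact (mem_filtration.1 hω).2 Finset.univ (by simp)

theorem filtration_anti {n k : ℕ} (V : Submodule ℝ (Form n k Finset.univ)) {d e : ℕ}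
    (hde : d ≤ e) (he : e ≤ n + 1) : filtration V e ≤ filtration V d := by
  intro ω hω
  rw [mem_filtration] at hω ⊢
  refine ⟨hω.1, fun F hF => ?_⟩
  obtain ⟨G, hFG, hG⟩ := Finset.exists_superset_card_eq (s := F) (n := e) (by omega) (by simpa)
  rw [← trace_trace k (Finset.subset_univ G) hFG, hω.2 G hG, map_zero]

/-- A choice of complements `W_d` with `V_d = W_d ⊕ V_{d+1}`, for `0 ≤ d ≤ n`. -/
structure Complements {n k : ℕ} (V : Submodule ℝ (Form n k Finset.univ)) where
  W : Fin (n + 1) → Submodule ℝ (Form n k Finset.univ)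
  disjoint : ∀ d, Disjoint (W d) (filtration V (d + 1))
  sup_eq : ∀ d, W d ⊔ filtration V (d + 1) = filtration V d

/-- The complements `W_d` are `S_{n+1}`-invariant subspaces. -/
def Complements.IsInvariant {n k : ℕ} {V : Submodule ℝ (Form n k Finset.univ)}
    (C : Complements V) : Prop :=
  ∀ (d : Fin (n + 1)) (π : Equiv.Perm (Fin (n + 1))), ∀ ω ∈ C.W d, permRep n k π ω ∈ C.W d

theorem Complements.le_filtration {n k : ℕ} {V : Submodule ℝ (Form n k Finset.univ)}
    (C : Complements V) (d : Fin (n + 1)) : C.W d ≤ filtration V d :=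
  (C.sup_eq d) ▸ le_sup_left

theorem Complements.iSup_eq {n k : ℕ} {V : Submodule ℝ (Form n k Finset.univ)}
    (C : Complements V) : iSup C.W = V := by
  apply le_antisymm
  · exact iSup_le fun d => (C.le_filtration d).trans inf_le_left
  · have key : ∀ j d : ℕ, d + j = n + 1 → filtration V d ≤ iSup C.W := by
      intro j
      induction j with
      | zero =>
        intro d hd
        obtain rfl : d = n + 1 := by omega
        rw [filtration_top]
        exact bot_le
      | succ j ih =>
        intro d hd
        have h := C.sup_eq ⟨d, by omega⟩
        simp only at h
        rw [← h]
        exact sup_le (le_iSup C.W _) (ih (d + 1) (by omega))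
    simpa [filtration_zero] using key (n + 1) 0 (by omega)

theorem Complements.injective {n k : ℕ} {V : Submodule ℝ (Form n k Finset.univ)}
    (C : Complements V) :
    Function.Injective (DirectSum.coeLinearMap C.W) := by
  intro w w' hw
  have hcoe : ∀ u : DirectSum (Fin (n + 1)) fun d => C.W d,
      DirectSum.coeLinearMap C.W u = ∑ d, (u d : Form n k Finset.univ) := by
    intro u
    have h := DirectSum.sum_univ_of u
    conv_lhs => rw [← h]
    simp only [map_sum, DirectSum.coeLinearMap_of]
  have hsum : ∑ d, ((w d : Form n k Finset.univ) - w' d) = 0 := by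
    rw [Finset.sum_sub_distrib, ← hcoe, ← hcoe, hw, sub_self]
  have hdiff : ∀ d, (w d : Form n k Finset.univ) - w' d ∈ C.W d :=
    fun d => Submodule.sub_mem _ (w d).2 (w' d).2
  have key : ∀ (m : ℕ) (hm : m < n + 1),
      (w ⟨m, hm⟩ : Form n k Finset.univ) - w' ⟨m, hm⟩ = 0 := by
    intro m
    induction m using Nat.strong_induction_on with
    | _ m ih =>
      intro hm
      rw [← Finset.add_sum_erase _ _ (Finset.mem_univ (⟨m, hm⟩ : Fin (n + 1)))] at hsum
      have hmem : ∑ d ∈ Finset.univ.erase (⟨m, hm⟩ : Fin (n + 1)),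
          ((w d : Form n k Finset.univ) - w' d) ∈ filtration V (m + 1) := by
        refine Submodule.sum_mem _ fun d hd => ?_
        have hne : (d : ℕ) ≠ m := fun h => (Finset.ne_of_mem_erase hd) (Fin.ext h)
        rcases lt_or_gt_of_ne hne with h | h
        · rw [ih d h d.2]
          exact Submodule.zero_mem _
        · exact filtration_anti V h (by omega) (C.le_filtration d (hdiff d))
      have hmem' : (w ⟨m, hm⟩ : Form n k Finset.univ) - w' ⟨m, hm⟩ ∈ filtration V (m + 1) := by
        rw [eq_neg_of_add_eq_zero_left hsum]
        exact Submodule.neg_mem _ hmem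
      exact Submodule.disjoint_def.1 (C.disjoint ⟨m, hm⟩) _ (hdiff _) hmem'
  exact DFinsupp.ext fun d => Subtype.ext (sub_eq_zero.1 (key d d.2))

theorem Complements.range_eq {n k : ℕ} {V : Submodule ℝ (Form n k Finset.univ)}
    (C : Complements V) : LinearMap.range (DirectSum.coeLinearMap C.W) = V := by
  rw [DirectSum.range_coeLinearMap, C.iSup_eq]

/-- The decomposition `V = W_0 ⊕ ⋯ ⊕ W_n`, as an isomorphism given by summation. -/
def Complements.sumEquiv {n k : ℕ} {V : Submodule ℝ (Form n k Finset.univ)}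
    (C : Complements V) : (DirectSum (Fin (n + 1)) fun d => C.W d) ≃ₗ[ℝ] V :=
  (LinearEquiv.ofInjective _ C.injective).trans (LinearEquiv.ofEq _ _ C.range_eq)

/-- The (nonempty) faces of `T^n`. -/
abbrev Face (n : ℕ) : Type := {F : Finset (Fin (n + 1)) // F.Nonempty}

/-- The dimension of a face. -/
def Face.dim {n : ℕ} (F : Face n) : Fin (n + 1) :=
  ⟨F.1.card - 1, by
    have h := Finset.card_le_univ F.1
    have h' := F.2.card_pos
    simp only [Fintype.card_fin] at h
    omega⟩

theorem Complements.trace_mem {n k : ℕ} {V : Submodule ℝ (Form n k Finset.univ)}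
    (C : Complements V) (F : Face n) {ω : Form n k Finset.univ} (hω : ω ∈ C.W F.dim) :
    trace k (Finset.subset_univ F.1) ω ∈ bubbleSpace V F.1 := by
  have h := mem_filtration.1 (C.le_filtration _ hω)
  rw [mem_bubbleSpace]
  refine ⟨⟨ω, h.1, rfl⟩, fun G hG hcard => ?_⟩
  rw [trace_trace]
  exact h.2 G (by simp only [Face.dim]; omega)

/-- For a face `F` of dimension `d`, the map from `W_d` to the forms in `V(F)` with vanishing trace
on `∂F` given by the trace. -/
def Complements.traceW {n k : ℕ} {V : Submodule ℝ (Form n k Finset.univ)}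
    (C : Complements V) (F : Face n) : C.W F.dim →ₗ[ℝ] bubbleSpace V F.1 :=
  ((trace k (Finset.subset_univ F.1)).comp (C.W F.dim).subtype).codRestrict _
    fun ω => C.trace_mem F ω.2

/-- The geometric decomposition map `D`, from `V` to the (finite) direct sum over all faces `F` of
the spaces of forms in `V(F)` with vanishing trace on `∂F`: the `F`-component of `D α` is the trace
on `F` of the component of `α` in `W_{dim F}`. -/
def Complements.decompMap {n k : ℕ} {V : Submodule ℝ (Form n k Finset.univ)}
    (C : Complements V) : V →ₗ[ℝ] ((F : Face n) → bubbleSpace V F.1) :=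
  LinearMap.pi fun F =>
    (C.traceW F).comp ((DirectSum.component ℝ (Fin (n + 1)) (fun d => C.W d) F.dim).comp
      C.sumEquiv.symm.toLinearMap)

/-- The defining property of `D`: on `W_d` it is the trace to the `d`-dimensional faces. -/
theorem Complements.decompMap_apply {n k : ℕ} {V : Submodule ℝ (Form n k Finset.univ)}
    (C : Complements V) (d : Fin (n + 1)) (α : V) (hα : (α : Form n k Finset.univ) ∈ C.W d)
    (F : Face n) :
    (C.decompMap α F : Form n k F.1) =
      if F.dim = d then trace k (Finset.subset_univ F.1) α else 0 := by
  have h : C.sumEquiv.symm α = DirectSum.lof ℝ (Fin (n + 1)) (fun d => C.W d) d ⟨α, hα⟩ := by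
    rw [LinearEquiv.symm_apply_eq]
    apply Subtype.ext
    simp [Complements.sumEquiv]
  change trace k (Finset.subset_univ F.1) (C.sumEquiv.symm α F.dim) = _
  rw [h]
  split_ifs with hF
  · subst hF
    rw [DirectSum.lof_apply]
  · rw [DirectSum.lof_eq_of, DirectSum.of_eq_of_ne _ _ _ hF]
    simp

/-- A basis `ξ` of `V` is `S_{n+1}`-invariant up to sign: each permutation maps every basis element
to a basis element or to the negative of one. -/
def IsInvariantUpToSign {n k N : ℕ} {V : Submodule ℝ (Form n k Finset.univ)}
    (ξ : Module.Basis (Fin N) ℝ V) : Prop :=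
  ∀ (π : Equiv.Perm (Fin (n + 1))) (i : Fin N), ∃ i' : Fin N,
    permRep n k π (ξ i) = ξ i' ∨ permRep n k π (ξ i) = -(ξ i' : Form n k Finset.univ)

/-- A basis `ξ` of `V` can be geometrically decomposed (with respect to the given complements):
for every `i`, the element `D (ξ i)` lies in one of the direct summands. -/
def IsGeometricallyDecomposed {n k N : ℕ} {V : Submodule ℝ (Form n k Finset.univ)}
    (C : Complements V) (ξ : Module.Basis (Fin N) ℝ V) : Prop :=
  ∀ i : Fin N, ∃ F : Face n, ∀ F' : Face n, F' ≠ F → C.decompMap (ξ i) F' = 0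

/-- `V` has an `S_{n+1}`-invariant basis up to sign that can be geometrically decomposed with
respect to the given complements. -/
def HasDecomposableInvariantBasis {n k : ℕ} {V : Submodule ℝ (Form n k Finset.univ)}
    (C : Complements V) : Prop :=
  ∃ (N : ℕ) (ξ : Module.Basis (Fin N) ℝ V), IsInvariantUpToSign ξ ∧ IsGeometricallyDecomposed C ξ

end FEEC

end

noncomputable section

namespace FEEC

open Module MvPolynomial

/-! ### Bases that are permuted up to sign -/

section SignedBases

variable {V : Type*} [AddCommGroup V] [Module ℝ V]

/-- The endomorphism `f` maps each member of the family `v` to plus or minus a member of `v`. -/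
def PermutesUpToSign {ι : Type*} (f : End ℝ V) (v : ι → V) : Prop :=
  ∀ i, ∃ j, f (v i) = v j ∨ f (v i) = -v j

theorem PermutesUpToSign.one {ι : Type*} (v : ι → V) : PermutesUpToSign (1 : End ℝ V) v :=
  fun i => ⟨i, Or.inl rfl⟩

theorem PermutesUpToSign.mul {ι : Type*} {f g : End ℝ V} {v : ι → V}
    (hf : PermutesUpToSign f v) (hg : PermutesUpToSign g v) : PermutesUpToSign (f * g) v := by
  intro i
  obtain ⟨j, hj⟩ := hg i
  obtain ⟨k, hk⟩ := hf j
  refine ⟨k, ?_⟩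
  rw [Module.End.mul_apply]
  rcases hj with hj | hj <;> rcases hk with hk | hk <;> simp [hj, hk]

theorem PermutesUpToSign.reindex {ι κ : Type*} {f : End ℝ V} {v : ι → V} (e : ι ≃ κ)
    (hf : PermutesUpToSign f v) : PermutesUpToSign f (v ∘ e.symm) := by
  intro i
  obtain ⟨j, hj⟩ := hf (e.symm i)
  exact ⟨e j, by simpa using hj⟩

/-- A spanning family of the right cardinality gives a basis with the same members. -/
theorem exists_basis_of_span [FiniteDimensional ℝ V] {ι : Type*} [Fintype ι] (v : ι → V)
    (hv : ⊤ ≤ Submodule.span ℝ (Set.range v)) (hcard : Fintype.card ι = finrank ℝ V) :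
    ∃ (n : ℕ) (b : Basis (Fin n) ℝ V) (e : ι ≃ Fin n), ⇑b = v ∘ e.symm :=
  ⟨_, (basisOfTopLeSpanOfCardEqFinrank v hv hcard).reindex (Fintype.equivFin ι),
    Fintype.equivFin ι, by
      rw [Basis.coe_reindex, coe_basisOfTopLeSpanOfCardEqFinrank]⟩

theorem eq_neg_sub_of_add_add_eq_zero {V : Type*} [AddCommGroup V] {x y z : V} (h : x + y + z = 0) : z = -x - y := by
  rw [add_eq_zero_iff_eq_neg'] at h
  rw [h]
  abel

/-- The splitting `x = (x + tx)/2 + (x - tx)/2` decomposes the space into the eigenspaces of `1` and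
`-1`. -/
theorem exists_eigenbasis_of_involution [FiniteDimensional ℝ V] (t : End ℝ V)
    (ht : ∀ x, t (t x) = x) :
    ∃ (n : ℕ) (b : Basis (Fin n) ℝ V), ∀ i, t (b i) = b i ∨ t (b i) = -b i := by
  set P := LinearMap.ker (t - 1) with hP
  set Q := LinearMap.ker (t + 1) with hQ
  have mP : ∀ x, x ∈ P ↔ t x = x := fun x => by simp [hP, sub_eq_zero]
  have mQ : ∀ x, x ∈ Q ↔ t x = -x := fun x => by simp [hQ, add_eq_zero_iff_eq_neg]
  have h : IsCompl P Q := by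
    constructor
    · rw [Submodule.disjoint_def]
      intro x h1 h2
      rw [mP] at h1
      rw [mQ, h1] at h2
      have h3 : (2 : ℝ) • x = 0 := by rw [two_smul]; nth_rewrite 2 [h2]; simp
      simpa using h3
    · rw [codisjoint_iff, eq_top_iff]
      intro x _
      have hx : x = (1 / 2 : ℝ) • (x + t x) + (1 / 2 : ℝ) • (x - t x) := by module
      rw [hx]
      refine Submodule.add_mem_sup ?_ ?_
      · rw [mP]; simp [ht]; module
      · rw [mQ]; simp [ht]; module
  refine ⟨_, (((finBasis ℝ P).prod (finBasis ℝ Q)).map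
    (Submodule.prodEquivOfIsCompl P Q h)).reindex finSumFinEquiv, fun i => ?_⟩
  obtain ⟨j, rfl⟩ := finSumFinEquiv.surjective i
  rcases j with j | j
  · left
    have := (mP _).1 (finBasis ℝ P j).2
    simpa using this
  · right
    have := (mQ _).1 (finBasis ℝ Q j).2
    simpa using this

/-- A representation of the symmetric group on three letters, generated by an element `c` of order
three and an involution `t`, has a basis that is invariant up to sign if `c` has nonnegative
trace. -/
theorem exists_signed_basis_of_three [FiniteDimensional ℝ V] (c t : End ℝ V)
    (hc : c * c * c = 1) (ht : t * t = 1) (htc : t * c = c * c * t)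
    (htr : 0 ≤ LinearMap.trace ℝ V c) :
    ∃ (n : ℕ) (b : Basis (Fin n) ℝ V), PermutesUpToSign c b ∧ PermutesUpToSign t b := by
  have hc' : ∀ x, c (c (c x)) = x := fun x => by simpa using LinearMap.congr_fun hc x
  have ht' : ∀ x, t (t x) = x := fun x => by simpa using LinearMap.congr_fun ht x
  have htc' : ∀ x, t (c x) = c (c (t x)) := fun x => by simpa using LinearMap.congr_fun htc x
  -- `A` is the sum of the one-dimensional constituents (trivial or sign), and `B` meets each
  -- two-dimensional constituent in a line. Thus `m` and `k` are the numbers of constituents of the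
  -- two kinds.
  set A := LinearMap.ker (c - 1) with hA
  have mA : ∀ x, x ∈ A ↔ c x = x := fun x => by simp [hA, sub_eq_zero]
  set B := LinearMap.ker (1 + c + c * c) ⊓ LinearMap.ker (t - 1) with hB
  have mB : ∀ x, x ∈ B ↔ x + c x + c (c x) = 0 ∧ t x = x := fun x => by
    simp [hB, sub_eq_zero]
  set n := finrank ℝ V with hn
  set m := finrank ℝ A with hm
  set k := finrank ℝ B with hk
  set P : End ℝ V := (1 / 3 : ℝ) • (1 + c + c * c) with hPdef
  have pP : LinearMap.IsProj A P := by
    constructor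
    · intro x
      rw [mA]
      simp [hPdef, hc']
      module
    · intro x hx
      rw [mA] at hx
      simp [hPdef, hx]
      module
  set Q : End ℝ V := (1 / 2 : ℝ) • ((1 - P) * (1 + t)) with hQdef
  have pQ : LinearMap.IsProj B Q := by
    constructor
    · intro x
      rw [mB]
      simp [hQdef, hPdef, hc', ht', htc']
      constructor <;> module
    · intro x hx
      rw [mB] at hx
      have h3 : c (c x) = -x - c x := eq_neg_sub_of_add_add_eq_zero hx.1
      simp [hQdef, hPdef, hx.2, h3]
      module
  -- Conjugate elements have equal traces: `c` and `c²` on the one hand, `t`, `ct` and `c²t` on the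
  -- other. Hence the ranks of `P` and `Q` depend only on `n` and the trace of `c`.
  have trc2 : LinearMap.trace ℝ V (c * c) = LinearMap.trace ℝ V c := by
    have : c * c = t * c * t := by rw [htc, mul_assoc, ht, mul_one]
    rw [this, LinearMap.trace_mul_comm, ← mul_assoc, ht, one_mul]
  have trct : LinearMap.trace ℝ V (c * t) = LinearMap.trace ℝ V t := by
    have h2 : c * t = (c * c) * (t * c) := by
      rw [htc, ← mul_assoc, ← mul_assoc, hc, one_mul]
    rw [h2, LinearMap.trace_mul_comm, mul_assoc, ← mul_assoc c c c, hc, mul_one]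
  have trcct : LinearMap.trace ℝ V (c * c * t) = LinearMap.trace ℝ V t := by
    rw [← htc, LinearMap.trace_mul_comm, trct]
  have tP : (m : ℝ) = (1 / 3) * (n + 2 * LinearMap.trace ℝ V c) := by
    rw [hm, ← pP.trace, hPdef]
    simp only [map_smul, map_add, LinearMap.trace_one, trc2, smul_eq_mul]
    ring
  have tQ : (k : ℝ) = (1 / 2) * (n - m) := by
    have h1 : LinearMap.trace ℝ V P = m := pP.trace
    have h2 : LinearMap.trace ℝ V (P * t) = LinearMap.trace ℝ V t := by
      rw [hPdef, smul_mul_assoc, add_mul, add_mul, one_mul]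
      simp only [map_smul, map_add, trct, trcct, smul_eq_mul]
      ring
    rw [hk, ← pQ.trace, hQdef]
    have h3 : (1 - P) * (1 + t) = 1 + t - P - P * t := by noncomm_ring
    rw [h3]
    simp only [map_smul, map_add, map_sub, LinearMap.trace_one, h1, h2, smul_eq_mul]
    ring
  -- The two rank formulas give `m - k = tr c`.
  have hkm : k ≤ m := by
    have : (k : ℝ) ≤ m := by linarith
    exact_mod_cast this
  have hcard : m + 2 * k = n := by
    have : (m : ℝ) + 2 * k = n := by linarith
    exact_mod_cast this
  have tA : ∀ x ∈ A, t x ∈ A := by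
    intro x hx
    rw [mA] at hx ⊢
    have h5 := htc' x
    rw [hx] at h5
    calc c (t x) = c (c (c (t x))) := congrArg c h5
      _ = t x := hc' _
  obtain ⟨m', α, hα⟩ := exists_eigenbasis_of_involution (t.restrict tA)
    (fun x => Subtype.ext (by simp [ht']))
  have hm' : m' = m := by rw [hm, finrank_eq_card_basis α, Fintype.card_fin]
  subst hm'
  have hα' : ∀ i, t (α i : V) = α i ∨ t (α i : V) = -(α i : V) := fun i => by
    rcases hα i with h | h
    · left; simpa using congrArg Subtype.val h
    · right; simpa using congrArg Subtype.val h
  have cα : ∀ i, c (α i : V) = α i := fun i => (mA _).1 (α i).2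
  set β := finBasis ℝ B
  -- A vector `a` of `A` and a vector `b` of `B` are merged into one `x` whose orbit `x, cx, c²x`
  -- spans both constituents. For the orbit to be permuted by `t` up to sign, `x` must be an
  -- eigenvector of `t`: take `a + b` if `ta = a`, and `a + (c - c²)b` if `ta = -a`, as `t` negates
  -- `(c - c²)b`.
  have key : ∀ j : Fin k, ∃ x : V, (t x = x ∨ t x = -x) ∧ ∀ S : Submodule ℝ V, x ∈ S → c x ∈ S →
      c (c x) ∈ S → (α (j.castLE hkm) : V) ∈ S ∧ (β j : V) ∈ S ∧ c (β j) ∈ S := by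
    intro j
    set a : V := ((α (j.castLE hkm) : A) : V) with ha
    set b : V := ((β j : B) : V) with hb
    have ca : c a = a := cα _
    obtain ⟨hb1, hb2⟩ := (mB _).1 (β j).2
    rw [← hb] at hb1 hb2
    have hcc : c (c b) = -b - c b := eq_neg_sub_of_add_add_eq_zero hb1
    rcases hα' (j.castLE hkm) with h | h
    · refine ⟨a + b, Or.inl (by rw [map_add, h, hb2]), fun S h1 h2 h3 => ?_⟩
      have e1 : a = (1 / 3 : ℝ) • ((a + b) + c (a + b) + c (c (a + b))) := by
        simp only [map_add, ca, hcc]; module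
      have ma : a ∈ S := by
        rw [e1]; exact S.smul_mem _ (S.add_mem (S.add_mem h1 h2) h3)
      refine ⟨ma, (S.add_mem_iff_right ma).1 h1, ?_⟩
      rw [map_add, ca] at h2
      exact (S.add_mem_iff_right ma).1 h2
    · refine ⟨a + (c b - c (c b)), Or.inr ?_, fun S h1 h2 h3 => ?_⟩
      · rw [map_add, map_sub, h, htc', htc', htc', hb2, hc']; module
      · have e1 : a = (1 / 3 : ℝ) • ((a + (c b - c (c b))) + c (a + (c b - c (c b)))
            + c (c (a + (c b - c (c b))))) := by
          simp only [map_add, map_sub, ca, hc']; module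
        have ma : a ∈ S := by
          rw [e1]; exact S.smul_mem _ (S.add_mem (S.add_mem h1 h2) h3)
        have m1 := (S.add_mem_iff_right ma).1 h1
        rw [map_add, ca] at h2 h3
        rw [map_add, ca] at h3
        have m2 := (S.add_mem_iff_right ma).1 h2
        have m3 := (S.add_mem_iff_right ma).1 h3
        refine ⟨ma, ?_, ?_⟩
        -- On the kernel of `1 + c + c²` one has `(c - c²)² = -3`.
        · have e2 : b = (-1 / 3 : ℝ) • (c (c b - c (c b)) - c (c (c b - c (c b)))) := by
            simp only [map_sub, map_neg, hcc]; module
          rw [e2]; exact S.smul_mem _ (S.sub_mem m2 m3)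
        · have e2 : c b = (-1 / 3 : ℝ) • (c (c (c b - c (c b))) - (c b - c (c b))) := by
            simp only [map_sub, map_neg, hcc]; module
          rw [e2]; exact S.smul_mem _ (S.sub_mem m3 m1)
  choose x hx hxS using key
  let v : Fin m ⊕ (Fin k × Fin 2) → V := Sum.elim
    (fun i => if h : (i : ℕ) < k then x ⟨i, h⟩ else α i)
    (fun p => if p.2 = 0 then c (x p.1) else c (c (x p.1)))
  have v1 : ∀ j : Fin k, v (Sum.inl (j.castLE hkm)) = x j := fun j => by simp [v]
  have v1' : ∀ i : Fin m, ¬ (i : ℕ) < k → v (Sum.inl i) = α i := fun i hi => by simp [v, hi]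
  have v2 : ∀ j : Fin k, v (Sum.inr (j, 0)) = c (x j) := fun j => by simp [v]
  have v3 : ∀ j : Fin k, v (Sum.inr (j, 1)) = c (c (x j)) := fun j => by simp [v]
  have cases_i : ∀ i : Fin m, (∃ j : Fin k, i = j.castLE hkm) ∨ ¬ (i : ℕ) < k := fun i => by
    by_cases h : (i : ℕ) < k
    · exact Or.inl ⟨⟨i, h⟩, rfl⟩
    · exact Or.inr h
  have hspan : ⊤ ≤ Submodule.span ℝ (Set.range v) := by
    set S := Submodule.span ℝ (Set.range v)
    have hv : ∀ i, v i ∈ S := fun i => Submodule.subset_span ⟨i, rfl⟩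
    have hS := fun j => hxS j S (v1 j ▸ hv _) (v2 j ▸ hv _) (v3 j ▸ hv _)
    have hαS : ∀ i, (α i : V) ∈ S := by
      intro i
      rcases cases_i i with ⟨j, rfl⟩ | h
      · exact (hS j).1
      · exact v1' i h ▸ hv _
    have hAS : ∀ y ∈ A, y ∈ S := by
      intro y hy
      have := α.sum_repr ⟨y, hy⟩
      have h2 := congrArg Subtype.val this
      rw [← show _ = y from h2]
      simp only [Submodule.coe_sum, Submodule.coe_smul]
      exact S.sum_mem fun i _ => S.smul_mem _ (hαS i)
    have hBS : ∀ y ∈ B, y ∈ S ∧ c y ∈ S := by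
      intro y hy
      have h2 := congrArg Subtype.val (β.sum_repr ⟨y, hy⟩)
      rw [← show _ = y from h2]
      simp only [Submodule.coe_sum, Submodule.coe_smul, map_sum, map_smul]
      exact ⟨S.sum_mem fun i _ => S.smul_mem _ (hS i).2.1,
        S.sum_mem fun i _ => S.smul_mem _ (hS i).2.2⟩
    intro y _
    obtain ⟨z, hz⟩ : ∃ z, z = y - P y := ⟨_, rfl⟩
    have hz0 : z + c z + c (c z) = 0 := by
      simp [hz, hPdef, hc']; module
    have hcz : c (c z) = -z - c z := eq_neg_sub_of_add_add_eq_zero hz0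
    have h6 : c (c (t z)) = - t z - c (t z) := by
      have h7 := congrArg t hcz
      rw [htc', htc', hc', map_sub, map_neg, htc'] at h7
      rw [eq_sub_iff_add_eq] at h7 ⊢
      rwa [add_comm]
    have hp : (1 / 2 : ℝ) • (z + t z) ∈ B := by
      rw [mB]
      simp only [map_smul, map_add, ht', hcz, h6]
      constructor <;> module
    -- The operator `c - c²` anticommutes with `t`, so it takes the `-1`-eigenvector `z - tz` into
    -- `B`. Applying it once more and dividing by `-3` recovers `z - tz`, whence the factor `-1/6`
    -- below.
    have hq : c (z - t z) - c (c (z - t z)) ∈ B := by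
      rw [mB]
      simp only [map_sub, hc', htc', ht']
      constructor
      · abel
      · abel
    obtain ⟨q1, q2⟩ := hBS _ hq
    have q3 : c (c (c (z - t z) - c (c (z - t z)))) ∈ S := by
      have := ((mB _).1 hq).1
      rw [add_eq_zero_iff_eq_neg'] at this
      rw [this]
      exact S.neg_mem (S.add_mem q1 q2)
    have hy' : y = P y + (1 / 2 : ℝ) • (z + t z)
        + (-1 / 6 : ℝ) • (c (c (z - t z) - c (c (z - t z)))
          - c (c (c (z - t z) - c (c (z - t z))))) := by
      have : y = P y + z := by rw [hz]; abel
      conv_lhs => rw [this]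
      simp only [map_sub, map_neg, hcz, h6]
      module
    rw [hy']
    exact S.add_mem (S.add_mem (hAS _ (pP.map_mem y)) (hBS _ hp).1)
      (S.smul_mem _ (S.sub_mem q2 q3))
  obtain ⟨N, b, e, hb⟩ := exists_basis_of_span v hspan (by simp; omega)
  refine ⟨N, b, ?_, ?_⟩
  · rw [hb]
    refine PermutesUpToSign.reindex e ?_
    rintro (i | ⟨j, l⟩)
    · rcases cases_i i with ⟨j, rfl⟩ | h
      · exact ⟨Sum.inr (j, 0), Or.inl (by rw [v1, v2])⟩
      · exact ⟨Sum.inl i, Or.inl (by rw [v1' i h, cα])⟩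
    · fin_cases l
      · exact ⟨Sum.inr (j, 1), Or.inl (by simp only [Fin.zero_eta, Fin.isValue]; rw [v2, v3])⟩
      · exact ⟨Sum.inl (j.castLE hkm), Or.inl (by simp only [Fin.mk_one, Fin.isValue]; rw [v1, v3, hc'])⟩
  · rw [hb]
    refine PermutesUpToSign.reindex e ?_
    rintro (i | ⟨j, l⟩)
    · rcases cases_i i with ⟨j, rfl⟩ | h
      · exact ⟨Sum.inl (j.castLE hkm), by rw [v1]; exact hx j⟩
      · exact ⟨Sum.inl i, by rw [v1' i h]; exact hα' i⟩
    · fin_cases l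
      · refine ⟨Sum.inr (j, 1), ?_⟩
        simp only [Fin.zero_eta, Fin.isValue]
        rw [v2, v3, htc']
        rcases hx j with h | h <;> simp [h]
      · refine ⟨Sum.inr (j, 0), ?_⟩
        simp only [Fin.mk_one, Fin.isValue]
        rw [v2, v3, htc', htc', hc']
        rcases hx j with h | h <;> simp [h]

end SignedBases

/-! ### Signed bases for representations of the symmetric group on four letters. -/

section SymmetricFour

variable {V : Type*} [AddCommGroup V] [Module ℝ V]

/-- A representation of the symmetric group on four letters, generated by the elements `a`, `b` of
the Klein four-group, an element `c` of order three and an involution `t`, has a basis that is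
invariant up to sign if `c` has nonnegative trace. -/
theorem exists_signed_basis_of_four [FiniteDimensional ℝ V] (a b c t : End ℝ V)
    (ha : a * a = 1) (hb : b * b = 1) (hab : a * b = b * a)
    (hc : c * c * c = 1) (ht : t * t = 1) (htc : t * c = c * c * t)
    (hca : c * a = b * c) (hcb : c * b = a * b * c) (hta : t * a = a * t)
    (htb : t * b = a * b * t)
    (htr : 0 ≤ LinearMap.trace ℝ V c) :
    ∃ (n : ℕ) (B : Basis (Fin n) ℝ V), PermutesUpToSign a B ∧ PermutesUpToSign b B ∧
      PermutesUpToSign c B ∧ PermutesUpToSign t B := by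
  have hcab : c * (a * b) = a * c := by
    rw [← mul_assoc, hca, mul_assoc, hcb, ← mul_assoc, ← mul_assoc, ← hab, mul_assoc a b b, hb,
      mul_one]
  have ha' : ∀ x, a (a x) = x := fun x => by simpa using LinearMap.congr_fun ha x
  have hb' : ∀ x, b (b x) = x := fun x => by simpa using LinearMap.congr_fun hb x
  have hab' : ∀ x, a (b x) = b (a x) := fun x => by simpa using LinearMap.congr_fun hab x
  have hc' : ∀ x, c (c (c x)) = x := fun x => by simpa using LinearMap.congr_fun hc x
  have ht' : ∀ x, t (t x) = x := fun x => by simpa using LinearMap.congr_fun ht x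
  have htc' : ∀ x, t (c x) = c (c (t x)) := fun x => by simpa using LinearMap.congr_fun htc x
  have hca' : ∀ x, b (c x) = c (a x) := fun x => by simpa using (LinearMap.congr_fun hca x).symm
  have hcab' : ∀ x, a (c x) = c (a (b x)) := fun x => by
    simpa using (LinearMap.congr_fun hcab x).symm
  have hta' : ∀ x, a (t x) = t (a x) := fun x => by simpa using (LinearMap.congr_fun hta x).symm
  have htab : t * (a * b) = b * t := by
    rw [← mul_assoc, hta, mul_assoc, htb, ← mul_assoc, ← mul_assoc, ha, one_mul]
  have htb' : ∀ x, b (t x) = t (a (b x)) := fun x => by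
    simpa using (LinearMap.congr_fun htab x).symm
  -- `V₀` and `V₁` belong to the trivial and to one nontrivial character of the Klein four-group.
  -- Conjugation by `c` permutes the three nontrivial characters cyclically, so the whole space is
  -- `V₀ ⊕ V₁ ⊕ cV₁ ⊕ c²V₁`.
  set V₀ := LinearMap.ker (a - 1) ⊓ LinearMap.ker (b - 1) with hV₀
  have m₀ : ∀ x, x ∈ V₀ ↔ a x = x ∧ b x = x := fun x => by simp [hV₀, sub_eq_zero]
  set V₁ := LinearMap.ker (a - 1) ⊓ LinearMap.ker (b + 1) with hV₁
  have m₁ : ∀ x, x ∈ V₁ ↔ a x = x ∧ b x = -x := fun x => by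
    simp [hV₁, sub_eq_zero, add_eq_zero_iff_eq_neg]
  set P : End ℝ V := (1 / 4 : ℝ) • (1 + a + b + a * b) with hP
  set Q : End ℝ V := (1 / 4 : ℝ) • (1 + a - b - a * b) with hQ
  have pP : LinearMap.IsProj V₀ P := by
    constructor
    · intro x
      rw [m₀]
      simp only [hP, LinearMap.smul_apply, LinearMap.add_apply, Module.End.one_apply,
        Module.End.mul_apply, map_smul, map_add, ha', hb', ← hab']
      constructor <;> module
    · intro x hx
      rw [m₀] at hx
      simp [hP, hx.1, hx.2]
      module
  have pQ : LinearMap.IsProj V₁ Q := by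
    constructor
    · intro x
      rw [m₁]
      simp only [hQ, LinearMap.smul_apply, LinearMap.add_apply, LinearMap.sub_apply,
        Module.End.one_apply, Module.End.mul_apply, map_smul, map_add, map_sub, ha', hb', ← hab']
      constructor <;> module
    · intro x hx
      rw [m₁] at hx
      simp [hQ, hx.1, hx.2]
      module
  have hcc : c * (c * c) = 1 := by rw [← mul_assoc, hc]
  have tb : LinearMap.trace ℝ V b = LinearMap.trace ℝ V a := by
    have : b = c * a * (c * c) := by rw [hca, mul_assoc, hcc, mul_one]
    rw [this, LinearMap.trace_mul_comm, ← mul_assoc, hc, one_mul]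
  have tab : LinearMap.trace ℝ V (a * b) = LinearMap.trace ℝ V b := by
    have : a * b = c * b * (c * c) := by rw [hcb, mul_assoc, hcc, mul_one]
    rw [this, LinearMap.trace_mul_comm, ← mul_assoc, hc, one_mul]
  have d₀ : (finrank ℝ V₀ : ℝ) = (1 / 4) * (finrank ℝ V + 3 * LinearMap.trace ℝ V a) := by
    rw [← pP.trace, hP]
    simp only [map_smul, map_add, LinearMap.trace_one, tab, tb, smul_eq_mul]
    ring
  have d₁ : (finrank ℝ V₁ : ℝ) = (1 / 4) * (finrank ℝ V - LinearMap.trace ℝ V a) := by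
    rw [← pQ.trace, hQ]
    simp only [map_smul, map_add, map_sub, LinearMap.trace_one, tab, tb, smul_eq_mul]
    ring
  have hdim : finrank ℝ V₀ + finrank ℝ V₁ * 3 = finrank ℝ V := by
    have : (finrank ℝ V₀ : ℝ) + finrank ℝ V₁ * 3 = finrank ℝ V := by rw [d₀, d₁]; ring
    exact_mod_cast this
  -- The products of `c` with elements of the Klein four-group are conjugate to `c`, so averaging
  -- over the group does not change the trace of `c`.
  have trcb : LinearMap.trace ℝ V (c * b) = LinearMap.trace ℝ V c := by
    have : c * b = a * (c * a) := by
      rw [hca, ← mul_assoc, hcb]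
    rw [this, LinearMap.trace_mul_comm, mul_assoc, ha, mul_one]
  have trcab : LinearMap.trace ℝ V (c * (a * b)) = LinearMap.trace ℝ V c := by
    have : c * (a * b) = b * (c * b) := by rw [← mul_assoc, hca, mul_assoc]
    rw [this, LinearMap.trace_mul_comm, mul_assoc, hb, mul_one]
  have trca : LinearMap.trace ℝ V (c * a) = LinearMap.trace ℝ V c := by
    have e : a * b * (a * b) = 1 := by
      rw [mul_assoc, ← mul_assoc b, ← hab, mul_assoc a b b, hb, mul_one, ha]
    have : c * a = (a * b) * (c * (a * b)) := by
      rw [← mul_assoc, ← hcb, mul_assoc, hab, ← mul_assoc b, hb, one_mul]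
    rw [this, LinearMap.trace_mul_comm, mul_assoc, e, mul_one]
  have c₀ : ∀ x ∈ V₀, c x ∈ V₀ := by
    intro x hx
    rw [m₀] at hx ⊢
    rw [hca', hcab', hx.2, hx.1]
    exact ⟨rfl, rfl⟩
  have t₀ : ∀ x ∈ V₀, t x ∈ V₀ := by
    intro x hx
    rw [m₀] at hx ⊢
    rw [hta', htb', hx.2, hx.1]
    exact ⟨rfl, rfl⟩
  have t₁ : ∀ x ∈ V₁, t x ∈ V₁ := by
    intro x hx
    rw [m₁] at hx ⊢
    rw [hta', htb', hx.2, map_neg, hx.1, map_neg]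
    exact ⟨rfl, rfl⟩
  -- The map `c * P` takes values in `V₀` and equals `c` there, so its trace is that of `c` on `V₀`.
  have tr₀ : LinearMap.trace ℝ V₀ (c.restrict c₀) = LinearMap.trace ℝ V c := by
    have h1 : ∀ x, (c * P) x ∈ V₀ := fun x => c₀ _ (pP.map_mem x)
    have h2 : (c * P).restrict (fun x _ => h1 x) = c.restrict c₀ := by
      ext x
      simp [pP.map_id x.1 x.2]
    have h3 := LinearMap.trace_restrict_eq_of_forall_mem V₀ (c * P) h1
    rw [h2] at h3
    rw [h3, hP, mul_smul_comm, mul_add, mul_add, mul_add, mul_one]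
    simp only [map_smul, map_add, trca, trcb, trcab, smul_eq_mul]
    ring
  obtain ⟨n₀, B₀, hB₀c, hB₀t⟩ := exists_signed_basis_of_three (c.restrict c₀) (t.restrict t₀)
    (by ext x; simp [hc']) (by ext x; simp [ht']) (by ext x; simp [htc']) (tr₀ ▸ htr)
  obtain ⟨n₁, u, hu⟩ := exists_eigenbasis_of_involution (t.restrict t₁)
    (fun x => Subtype.ext (by simp [ht']))
  have hn₀ : n₀ = finrank ℝ V₀ := by rw [finrank_eq_card_basis B₀, Fintype.card_fin]
  have hn₁ : n₁ = finrank ℝ V₁ := by rw [finrank_eq_card_basis u, Fintype.card_fin]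
  have hu' : ∀ i, t (u i : V) = u i ∨ t (u i : V) = -(u i : V) := fun i => by
    rcases hu i with h | h
    · left; simpa using congrArg Subtype.val h
    · right; simpa using congrArg Subtype.val h
  have au : ∀ i, a (u i : V) = u i := fun i => ((m₁ _).1 (u i).2).1
  have bu : ∀ i, b (u i : V) = -(u i : V) := fun i => ((m₁ _).1 (u i).2).2
  have aB : ∀ i, a (B₀ i : V) = B₀ i := fun i => ((m₀ _).1 (B₀ i).2).1
  have bB : ∀ i, b (B₀ i : V) = B₀ i := fun i => ((m₀ _).1 (B₀ i).2).2
  let v : Fin n₀ ⊕ (Fin n₁ × Fin 3) → V :=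
    Sum.elim (fun i => B₀ i) (fun p => ![(u p.1 : V), c (u p.1), c (c (u p.1))] p.2)
  have hspan : ⊤ ≤ Submodule.span ℝ (Set.range v) := by
    set S := Submodule.span ℝ (Set.range v)
    have hv : ∀ i, v i ∈ S := fun i => Submodule.subset_span ⟨i, rfl⟩
    have hS₀ : ∀ y ∈ V₀, y ∈ S := by
      intro y hy
      have h2 := congrArg Subtype.val (B₀.sum_repr ⟨y, hy⟩)
      rw [← show _ = y from h2]
      simp only [Submodule.coe_sum, Submodule.coe_smul]
      exact S.sum_mem fun i _ => S.smul_mem _ (hv (Sum.inl i))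
    have hS₁ : ∀ y ∈ V₁, y ∈ S ∧ c y ∈ S ∧ c (c y) ∈ S := by
      intro y hy
      have h2 := congrArg Subtype.val (u.sum_repr ⟨y, hy⟩)
      rw [← show _ = y from h2]
      simp only [Submodule.coe_sum, Submodule.coe_smul, map_sum, map_smul]
      exact ⟨S.sum_mem fun i _ => S.smul_mem _ (hv (Sum.inr (i, 0))),
        S.sum_mem fun i _ => S.smul_mem _ (hv (Sum.inr (i, 1))),
        S.sum_mem fun i _ => S.smul_mem _ (hv (Sum.inr (i, 2)))⟩
    intro y _
    -- The conjugates `c Q c²` and `c² Q c` of `Q` are the projections to `cV₁` and `c²V₁`.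
    have hy : y = P y + Q y + c (Q (c (c y))) + c (c (Q (c y))) := by
      simp only [hP, hQ, LinearMap.smul_apply, LinearMap.add_apply, LinearMap.sub_apply,
        Module.End.one_apply, Module.End.mul_apply, map_smul, map_add, map_sub, hcab', hca', hc',
        ha', hb', ← hab']
      module
    rw [hy]
    exact S.add_mem (S.add_mem (S.add_mem (hS₀ _ (pP.map_mem _)) (hS₁ _ (pQ.map_mem _)).1)
      (hS₁ _ (pQ.map_mem _)).2.1) (hS₁ _ (pQ.map_mem _)).2.2
  obtain ⟨N, B, e, hB⟩ := exists_basis_of_span v hspan (by simp [hn₀, hn₁, hdim])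
  refine ⟨N, B, ?_⟩
  rw [hB]
  refine ⟨PermutesUpToSign.reindex e ?_, PermutesUpToSign.reindex e ?_,
    PermutesUpToSign.reindex e ?_, PermutesUpToSign.reindex e ?_⟩
  · rintro (i | ⟨i, l⟩)
    · exact ⟨Sum.inl i, Or.inl (aB i)⟩
    · refine ⟨Sum.inr (i, l), ?_⟩
      fin_cases l <;> simp [v, hcab', hca', au, bu]
  · rintro (i | ⟨i, l⟩)
    · exact ⟨Sum.inl i, Or.inl (bB i)⟩
    · refine ⟨Sum.inr (i, l), ?_⟩
      fin_cases l <;> simp [v, hcab', hca', au, bu]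
  · rintro (i | ⟨i, l⟩)
    · obtain ⟨j, hj⟩ := hB₀c i
      refine ⟨Sum.inl j, hj.imp (fun h => ?_) (fun h => ?_)⟩ <;>
        simpa [v] using congrArg Subtype.val h
    · refine ⟨Sum.inr (i, l + 1), ?_⟩
      fin_cases l <;> simp [v, hc']
  · rintro (i | ⟨i, l⟩)
    · obtain ⟨j, hj⟩ := hB₀t i
      refine ⟨Sum.inl j, hj.imp (fun h => ?_) (fun h => ?_)⟩ <;>
        simpa [v] using congrArg Subtype.val h
    -- Conjugation by `t` inverts `c`, so `t` fixes the index of `u` and exchanges those of `cu` and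
    -- `c²u`.
    · refine ⟨Sum.inr (i, -l), ?_⟩
      rcases hu' i with h | h <;> fin_cases l <;> simp [v, hc', htc', h]

end SymmetricFour

/-! ### Traces -/

section Trace

variable {V X : Type*} [AddCommGroup V] [Module ℝ V] [AddCommGroup X] [Module ℝ X]

/-- The trace is additive in short exact sequences. -/
theorem trace_eq_add_trace_ker [FiniteDimensional ℝ V] [FiniteDimensional ℝ X] (f : X →ₗ[ℝ] V)
    (hf : Function.Surjective f) (u : End ℝ X) (w : End ℝ V) (h : ∀ x, f (u x) = w (f x))
    (hu : ∀ x ∈ LinearMap.ker f, u x ∈ LinearMap.ker f) :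
    LinearMap.trace ℝ X u = LinearMap.trace ℝ V w
      + LinearMap.trace ℝ (LinearMap.ker f) (u.restrict hu) := by
  -- With a section `s`, `u = u(1 - sf) + usf`. The first summand takes values in the kernel and
  -- agrees with `u` there; the second has the trace of `fus = w`.
  obtain ⟨s, hs⟩ := f.exists_rightInverse_of_surjective (LinearMap.range_eq_top.2 hf)
  have hs' : ∀ y, f (s y) = y := fun y => LinearMap.congr_fun hs y
  have h1 : ∀ x, (u * (1 - s ∘ₗ f)) x ∈ LinearMap.ker f := fun x => hu _ (by simp [hs'])
  have h2 : (u * (1 - s ∘ₗ f)).restrict (fun x _ => h1 x) = u.restrict hu := by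
    ext x
    have := x.2
    rw [LinearMap.mem_ker] at this
    simp [this]
  have h3 := LinearMap.trace_restrict_eq_of_forall_mem (LinearMap.ker f) _ h1
  rw [h2] at h3
  have h4 : (f ∘ₗ u) ∘ₗ s = w := by
    ext y
    simp [h, hs']
  have h5 : LinearMap.trace ℝ X (u * (s ∘ₗ f)) = LinearMap.trace ℝ V w := by
    rw [← h4, LinearMap.comp_assoc]
    exact LinearMap.trace_comp_comm' f (u ∘ₗ s)
  rw [h3, ← h5, ← map_add, mul_sub, mul_one, add_sub_cancel]

/-- The trace of a map that permutes a basis is the number of fixed basis elements. -/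
theorem trace_of_permutes_basis {ι : Type*} [Fintype ι] [DecidableEq ι] (b : Basis ι ℝ V)
    (u : End ℝ V) (σ : ι → ι) (h : ∀ i, u (b i) = b (σ i)) :
    LinearMap.trace ℝ V u = (Finset.univ.filter fun i => σ i = i).card := by
  rw [LinearMap.trace_eq_matrix_trace ℝ b, Matrix.trace]
  simp only [Matrix.diag_apply, LinearMap.toMatrix_apply, h, Basis.repr_self,
    Finsupp.single_apply]
  simp

end Trace

/-! ### Adapted bases -/

section Adapted

variable {G X V : Type*} [Group G] [MulAction G X] [AddCommGroup V] [Module ℝ V]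

/-- The subspace `U` has a basis that is invariant up to sign under the stabilizer of `x`. -/
def HasSignedBasis (ρ : Representation ℝ G V) (x : X) (U : Submodule ℝ V) : Prop :=
  ∃ (n : ℕ) (b : Basis (Fin n) ℝ U), ∀ g : G, g • x = x →
    PermutesUpToSign (ρ g) (fun i => (b i : V))

theorem rep_inv_apply (ρ : Representation ℝ G V) (g : G) (v : V) : ρ g⁻¹ (ρ g v) = v := by
  rw [← Module.End.mul_apply, ← map_mul, inv_mul_cancel, map_one, Module.End.one_apply]

theorem rep_apply_inv (ρ : Representation ℝ G V) (g : G) (v : V) : ρ g (ρ g⁻¹ v) = v := by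
  rw [← Module.End.mul_apply, ← map_mul, mul_inv_cancel, map_one, Module.End.one_apply]

variable (ρ : Representation ℝ G V) (N : X → Submodule ℝ V)

/-- The action of `g` as an isomorphism between subspaces. -/
def repEquiv (hmap : ∀ (g : G) (x : X), ∀ v ∈ N x, ρ g v ∈ N (g • x)) (g : G) {x y : X}
    (hxy : g • x = y) : N x ≃ₗ[ℝ] N y where
  toFun v := ⟨ρ g v, hxy ▸ hmap g x v v.2⟩
  map_add' _ _ := Subtype.ext (map_add _ _ _)
  map_smul' _ _ := Subtype.ext (map_smul _ _ _)
  invFun w := ⟨ρ g⁻¹ w, by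
    have e : g⁻¹ • y = x := by rw [← hxy, inv_smul_smul]
    exact e ▸ hmap g⁻¹ y w w.2⟩
  left_inv v := Subtype.ext (rep_inv_apply ρ g v)
  right_inv v := Subtype.ext (rep_apply_inv ρ g v)

variable {ρ N}

/-- The stabilizer of `g • x` is the conjugate by `g` of that of `x`, so the basis can be
transported by `g`. -/
theorem HasSignedBasis.smul (hmap : ∀ (g : G) (x : X), ∀ v ∈ N x, ρ g v ∈ N (g • x)) {x : X}
    (h : HasSignedBasis ρ x (N x)) (g : G) : HasSignedBasis ρ (g • x) (N (g • x)) := by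
  obtain ⟨n, b, hb⟩ := h
  refine ⟨n, b.map (repEquiv ρ N hmap g rfl), fun s hs i => ?_⟩
  obtain ⟨j, hj⟩ := hb (g⁻¹ * s * g) (by rw [mul_smul, mul_smul, hs, inv_smul_smul]) i
  refine ⟨j, ?_⟩
  have e : ρ s (ρ g (b i)) = ρ g (ρ (g⁻¹ * s * g) (b i)) := by
    simp only [← Module.End.mul_apply, ← map_mul]
    congr 2
    group
  change ρ s (ρ g (b i)) = ρ g (b j) ∨ ρ s (ρ g (b i)) = -ρ g (b j)
  rw [e]
  exact hj.imp (fun h => by rw [h]) (fun h => by rw [h, map_neg])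

/-- This is the construction of an induced basis: a signed basis is chosen at one representative `o
x` of each orbit and transported to `x` by a fixed `k x`. Then `g * k x` equals `k (g • x)` times an
element of the stabilizer of `o x`, which permutes the chosen basis up to sign. -/
theorem exists_adapted_basis [Finite X] [DecidableEq X]
    (hN : DirectSum.IsInternal N)
    (hmap : ∀ (g : G) (x : X), ∀ v ∈ N x, ρ g v ∈ N (g • x))
    (h : ∀ x, HasSignedBasis ρ x (N x)) :
    ∃ (n : ℕ) (b : Basis (Fin n) ℝ V), (∀ g, PermutesUpToSign (ρ g) b) ∧
      ∀ i, ∃ x, b i ∈ N x := by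
  have := Fintype.ofFinite X
  let o : X → X := fun x => (Quotient.mk (MulAction.orbitRel G X) x).out
  have ho : ∀ (g : G) x, o (g • x) = o x := fun g x => by
    simp only [o]
    congr 1
    exact Quotient.sound ⟨g, rfl⟩
  have hg : ∀ x, ∃ g : G, g • o x = x := fun x => by
    have h1 : MulAction.orbitRel G X (o x) x := Quotient.exact (Quotient.out_eq _)
    have h2 := (MulAction.orbitRel G X).symm h1
    exact h2
  choose k hk using hg
  choose n b hb using h
  let B := hN.collectedBasis fun x => (b (o x)).map (repEquiv ρ N hmap (k x) (hk x))
  have hB : ∀ x i, B ⟨x, i⟩ = ρ (k x) (b (o x) i) := fun x i => by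
    simp only [B, DirectSum.IsInternal.collectedBasis_coe]
    rfl
  refine ⟨_, B.reindex (Fintype.equivFin _), fun g => ?_, fun i => ?_⟩
  · rw [Basis.coe_reindex]
    refine PermutesUpToSign.reindex _ ?_
    rintro ⟨x, i⟩
    -- The variable `z` stands for `o (g • x)`, which equals `o x` but is not syntactically the
    -- same, while the index type depends on it.
    have key : ∀ z, z = o x → ∃ j : Fin (n z),
        ρ ((k (g • x))⁻¹ * g * k x) (b (o x) i) = b z j ∨
        ρ ((k (g • x))⁻¹ * g * k x) (b (o x) i) = -(b z j : V) := by
      rintro _ rfl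
      refine hb (o x) _ ?_ i
      rw [mul_smul, mul_smul, hk x, inv_smul_eq_iff, ← ho g x, hk]
    obtain ⟨j, hj⟩ := key (o (g • x)) (ho g x)
    refine ⟨⟨g • x, j⟩, ?_⟩
    have e : ρ g (ρ (k x) (b (o x) i))
        = ρ (k (g • x)) (ρ ((k (g • x))⁻¹ * g * k x) (b (o x) i)) := by
      simp only [← Module.End.mul_apply, ← map_mul]
      congr 2
      group
    rw [hB, hB, e]
    exact hj.imp (fun h => by rw [h]) (fun h => by rw [h, map_neg])
  · obtain ⟨⟨x, j⟩, hx⟩ := (Fintype.equivFin (Σ x, Fin (n (o x)))).symm.surjective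
      ((Fintype.equivFin (Σ x, Fin (n (o x)))).symm i)
    refine ⟨((Fintype.equivFin (Σ x, Fin (n (o x)))).symm i).1, ?_⟩
    rw [Basis.reindex_apply]
    exact hN.collectedBasis_mem _ _

/-- If the members of a spanning family lie in the members `N x` of an independent family of
subspaces, then each `N x` is spanned by those that it contains. -/
theorem span_inter_eq_of_iSupIndep {X V : Type*} [AddCommGroup V] [Module ℝ V]
    {N : X → Submodule ℝ V} (hN : iSupIndep N) {s : Set V}
    (hs : ∀ v ∈ s, ∃ x, v ∈ N x) (hspan : ∀ x, N x ≤ Submodule.span ℝ s) (x : X) :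
    Submodule.span ℝ (s ∩ N x) = N x := by
  apply le_antisymm (Submodule.span_le.2 Set.inter_subset_right)
  intro v hv
  have h1 : Submodule.span ℝ s ≤ Submodule.span ℝ (s ∩ N x) ⊔ ⨆ (y) (_ : y ≠ x), N y := by
    rw [Submodule.span_le]
    intro w hw
    obtain ⟨y, hy⟩ := hs w hw
    by_cases hxy : y = x
    · exact Submodule.mem_sup_left (Submodule.subset_span ⟨hw, hxy ▸ hy⟩)
    · exact Submodule.mem_sup_right
        (Submodule.mem_iSup_of_mem y (Submodule.mem_iSup_of_mem hxy hy))
  obtain ⟨p, hp, q, hq, hpq⟩ := Submodule.mem_sup.1 (h1 (hspan x hv))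
  have hp' : p ∈ N x := (Submodule.span_le.2 Set.inter_subset_right) hp
  have hq' : q = 0 := by
    have : q = v - p := by rw [← hpq]; abel
    exact Submodule.disjoint_def.1 (hN x) q (this ▸ Submodule.sub_mem _ hv hp') hq
  rw [← hpq, hq', add_zero]
  exact hp

/-- The basis members lying in `N x` form a basis of `N x`, and `f` permutes them up to sign. The
diagonal entries are thus 0, 1 or -1, and the last is excluded by `f³ = 1`. -/
theorem trace_nonneg_of_adapted_basis {n : ℕ} (hN : iSupIndep N) (b : Basis (Fin n) ℝ V)
    (hb : ∀ i, ∃ x, b i ∈ N x) (x : X) (f : End ℝ V) (hf : PermutesUpToSign f b)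
    (hf3 : f * f * f = 1) (hx : ∀ v ∈ N x, f v ∈ N x) :
    0 ≤ LinearMap.trace ℝ (N x) (f.restrict hx) := by
  classical
  have hspan := span_inter_eq_of_iSupIndep hN (s := Set.range b) (by rintro _ ⟨i, rfl⟩; exact hb i)
    (fun x => by rw [b.span_eq]; exact le_top) x
  let I := {i : Fin n // b i ∈ N x}
  let w : I → N x := fun i => ⟨b i, i.2⟩
  have hw : LinearIndependent ℝ w := by
    apply LinearIndependent.of_comp (N x).subtype
    exact b.linearIndependent.comp (fun i : I => (i : Fin n)) Subtype.val_injective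
  have hw' : ⊤ ≤ Submodule.span ℝ (Set.range w) := by
    rintro ⟨v, hv⟩ _
    have h1 : Set.range b ∩ N x = (N x).subtype '' Set.range w := by
      ext u
      constructor
      · rintro ⟨⟨i, rfl⟩, hi⟩
        exact ⟨w ⟨i, hi⟩, ⟨_, rfl⟩, rfl⟩
      · rintro ⟨_, ⟨i, rfl⟩, rfl⟩
        exact ⟨⟨i, rfl⟩, i.2⟩
    have h2 : v ∈ Submodule.span ℝ (Set.range b ∩ N x) := hspan.symm ▸ hv
    rw [h1, ← Submodule.map_span] at h2
    obtain ⟨y, hy, hyv⟩ := h2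
    rwa [show (⟨v, hv⟩ : N x) = y from Subtype.ext hyv.symm]
  let B := Basis.mk hw hw'
  have hB : ∀ i, (B i : V) = b i := fun i => by simp [B, w]
  rw [LinearMap.trace_eq_matrix_trace ℝ B, Matrix.trace]
  refine Finset.sum_nonneg fun i _ => ?_
  rw [Matrix.diag_apply, LinearMap.toMatrix_apply]
  obtain ⟨j, hj⟩ := hf i
  have hj' : b j ∈ N x := by
    have := hx _ i.2
    rcases hj with h | h
    · rwa [h] at this
    · rwa [h, neg_mem_iff] at this
  have e : f.restrict hx (B i) = B ⟨j, hj'⟩ ∨ f.restrict hx (B i) = -B ⟨j, hj'⟩ := by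
    refine hj.imp (fun h => ?_) (fun h => ?_) <;> apply Subtype.ext <;> simp [hB, h]
  rcases e with e | e
  · rw [e, Basis.repr_self, Finsupp.single_apply]
    split_ifs <;> norm_num
  -- If `f` negated a basis vector, so would `f³ = 1`.
  · have hne : (⟨j, hj'⟩ : I) ≠ i := by
      rintro rfl
      have h3 := LinearMap.congr_fun hf3 (b j)
      have h4 : f (b j) = -b j := by simpa [hB] using congrArg Subtype.val e
      simp only [Module.End.mul_apply, h4, map_neg, neg_neg, Module.End.one_apply] at h3
      have h5 : (2 : ℝ) • b j = 0 := by rw [two_smul]; nth_rewrite 1 [← h3]; simp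
      exact b.ne_zero j (by simpa using h5)
    rw [e, map_neg, Basis.repr_self, Finsupp.neg_apply, Finsupp.single_apply, if_neg hne]
    simp

end Adapted

/-! ### Vanishing traces and permutations -/

theorem trace_eq_zero_iff {n k : ℕ} {F : Finset (Fin (n + 1))} {ω : Form n k Finset.univ} :
    trace k (Finset.subset_univ F) ω = 0 ↔
      ∀ (x : Fin (n + 1) → ℝ) (hx : x ∈ facePoints n F) (v : Fin k → Fin (n + 1) → ℝ)
        (hv : ∀ j, v j ∈ tangent n F),
        ω ⟨x, facePoints_mono (Finset.subset_univ F) hx⟩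
          (fun j => ⟨v j, tangent_mono (Finset.subset_univ F) (hv j)⟩) = 0 := by
  constructor
  · intro h x hx v hv
    have h1 := congrFun h ⟨x, hx⟩
    exact DFunLike.congr_fun h1 (fun j => (⟨v j, hv j⟩ : tangent n F))
  · intro h
    funext x
    ext v
    exact h x.1 x.2 (fun j => (v j).1) (fun j => (v j).2)

theorem trace_eq_zero_mono {n k : ℕ} {F G : Finset (Fin (n + 1))} (h : G ⊆ F)
    {ω : Form n k Finset.univ} (hω : trace k (Finset.subset_univ F) ω = 0) :
    trace k (Finset.subset_univ G) ω = 0 := by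
  rw [← trace_trace k (Finset.subset_univ F) h, hω, map_zero]

theorem comp_perm_mem_facePoints {n : ℕ} {F : Finset (Fin (n + 1))}
    (π : Equiv.Perm (Fin (n + 1))) {x : Fin (n + 1) → ℝ}
    (hx : x ∈ facePoints n (F.map π.toEmbedding)) : x ∘ π ∈ facePoints n F := by
  refine ⟨fun i => hx.1 _, ?_, fun i hi => hx.2.2 _ fun h => hi ?_⟩
  · rw [← hx.2.1]
    exact Equiv.sum_comp π x
  · obtain ⟨j, hj, hji⟩ := Finset.mem_map.1 h
    rwa [← π.injective hji]

theorem comp_perm_mem_tangent {n : ℕ} {F : Finset (Fin (n + 1))}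
    (π : Equiv.Perm (Fin (n + 1))) {x : Fin (n + 1) → ℝ}
    (hx : x ∈ tangent n (F.map π.toEmbedding)) : x ∘ π ∈ tangent n F := by
  refine ⟨?_, fun i hi => hx.2 _ fun h => hi ?_⟩
  · rw [← hx.1]
    exact Equiv.sum_comp π x
  · obtain ⟨j, hj, hji⟩ := Finset.mem_map.1 h
    rwa [← π.injective hji]

theorem trace_permRep_eq_zero {n k : ℕ} {F : Finset (Fin (n + 1))}
    (π : Equiv.Perm (Fin (n + 1))) {ω : Form n k Finset.univ}
    (h : trace k (Finset.subset_univ F) ω = 0) :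
    trace k (Finset.subset_univ (F.map π.toEmbedding)) (permRep n k π ω) = 0 := by
  rw [trace_eq_zero_iff] at h ⊢
  intro x hx v hv
  exact h (x ∘ π) (comp_perm_mem_facePoints π hx) (fun j => v j ∘ π)
    (fun j => comp_perm_mem_tangent π (hv j))

/-- A permutation that fixes the vertices of a face does not change traces to the face. -/
theorem trace_permRep_of_fixes {n k : ℕ} {F : Finset (Fin (n + 1))}
    (π : Equiv.Perm (Fin (n + 1))) (hπ : ∀ i ∈ F, π i = i) (ω : Form n k Finset.univ) :
    trace k (Finset.subset_univ F) (permRep n k π ω - ω) = 0 := by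
  have key : ∀ (x : Fin (n + 1) → ℝ), (∀ i, i ∉ F → x i = 0) → x ∘ π = x := by
    intro x hx
    funext i
    by_cases hi : i ∈ F
    · simp [hπ i hi]
    · have : π i ∉ F := fun h => hi (by
        have h1 := π.injective (hπ _ h)
        rwa [h1] at h)
      simp [hx i hi, hx _ this]
  rw [map_sub, sub_eq_zero]
  funext x
  ext v
  have e1 : permPoints π ⟨x.1, facePoints_mono (Finset.subset_univ F) x.2⟩
      = ⟨x.1, facePoints_mono (Finset.subset_univ F) x.2⟩ := Subtype.ext (key x.1 x.2.2.2)
  have e2 : ∀ j, permTangent π (Submodule.inclusion (tangent_mono (Finset.subset_univ F)) (v j))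
      = Submodule.inclusion (tangent_mono (Finset.subset_univ F)) (v j) :=
    fun j => Subtype.ext (key (v j).1 (v j).2.2)
  change ω (permPoints π ⟨x.1, _⟩) (fun j => permTangent π (Submodule.inclusion _ (v j)))
    = ω ⟨x.1, _⟩ (fun j => Submodule.inclusion _ (v j))
  rw [e1]
  simp only [e2]

/-- The action of permutations on faces. -/
instance faceAction (n : ℕ) : MulAction (Equiv.Perm (Fin (n + 1))) (Face n) where
  smul π F := ⟨F.1.map π.toEmbedding, F.2.map⟩
  one_smul F := Subtype.ext (by
    change F.1.map _ = F.1
    ext i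
    simp only [Finset.mem_map_equiv]
    rfl)
  mul_smul π σ F := Subtype.ext (by
    change F.1.map _ = (F.1.map _).map _
    ext i
    simp only [Finset.mem_map_equiv]
    rfl)

theorem face_smul_val {n : ℕ} (π : Equiv.Perm (Fin (n + 1))) (F : Face n) :
    (π • F).1 = F.1.map π.toEmbedding := rfl

theorem face_smul_card {n : ℕ} (π : Equiv.Perm (Fin (n + 1))) (F : Face n) :
    (π • F).1.card = F.1.card := Finset.card_map _

theorem Face.dim_add_one {n : ℕ} (F : Face n) : (F.dim : ℕ) + 1 = F.1.card := by
  have := F.2.card_pos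
  simp only [Face.dim]
  omega

theorem Face.dim_eq_iff {n : ℕ} {F G : Face n} : F.dim = G.dim ↔ F.1.card = G.1.card := by
  rw [← F.dim_add_one, ← G.dim_add_one, Fin.ext_iff]
  omega

theorem Face.dim_smul {n : ℕ} (π : Equiv.Perm (Fin (n + 1))) (F : Face n) :
    (π • F).dim = F.dim := Face.dim_eq_iff.2 (face_smul_card π F)

/-- The subspace `V` is invariant under permutations. -/
def PermInvariant {n k : ℕ} (V : Submodule ℝ (Form n k Finset.univ)) : Prop :=
  ∀ π, ∀ ω ∈ V, permRep n k π ω ∈ V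

/-- The representation on an invariant subspace. -/
def subRep {n k : ℕ} {V : Submodule ℝ (Form n k Finset.univ)} (hV : PermInvariant V) :
    Representation ℝ (Equiv.Perm (Fin (n + 1))) V where
  toFun π := (permRep n k π).restrict (hV π)
  map_one' := by
    ext ω
    simp
  map_mul' π σ := by
    ext ω
    simp

theorem subRep_coe {n k : ℕ} {V : Submodule ℝ (Form n k Finset.univ)} (hV : PermInvariant V)
    (π : Equiv.Perm (Fin (n + 1))) (ω : V) : (subRep hV π ω : Form n k Finset.univ)
      = permRep n k π ω := rfl

theorem filtration_permInvariant {n k : ℕ} {V : Submodule ℝ (Form n k Finset.univ)}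
    (hV : PermInvariant V) (d : ℕ) : PermInvariant (filtration V d) := by
  intro π ω hω
  rw [mem_filtration] at hω ⊢
  refine ⟨hV π ω hω.1, fun F hF => ?_⟩
  have h := trace_permRep_eq_zero π (hω.2 (F.map π⁻¹.toEmbedding) (by simpa using hF))
  have e : (F.map π⁻¹.toEmbedding).map π.toEmbedding = F := by
    ext i
    simp only [Finset.mem_map_equiv]
    change π (π.symm i) ∈ F ↔ _
    simp
  rw [e] at h
  exact h

/-! ### Invariant complements -/

/-- Maschke's theorem provides an invariant complement of `A` in the whole space. By the modular
law, its intersection with `B` is a complement of `A` in `B`. -/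
theorem exists_invariant_complement {G M : Type*} [Group G] [Finite G] [AddCommGroup M]
    [Module ℝ M] (ρ : Representation ℝ G M) {A B : Submodule ℝ M} (hAB : A ≤ B)
    (hA : ∀ g, ∀ v ∈ A, ρ g v ∈ A) (hB : ∀ g, ∀ v ∈ B, ρ g v ∈ B) :
    ∃ W : Submodule ℝ M, Disjoint W A ∧ W ⊔ A = B ∧ ∀ g, ∀ v ∈ W, ρ g v ∈ W := by
  have hA' : A ∈ ρ.invtSubmodule := ρ.mem_invtSubmodule.2 hA
  have : NeZero (Nat.card G : ℝ) := ⟨by exact_mod_cast Nat.card_pos.ne'⟩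
  obtain ⟨Q, hQ⟩ := MonoidAlgebra.Submodule.exists_isCompl (ρ.mapSubmodule ⟨A, hA'⟩)
  have h1 : IsCompl (⟨A, hA'⟩ : ρ.invtSubmodule) (ρ.mapSubmodule.symm Q) := by
    have := (ρ.mapSubmodule.symm.isCompl_iff).1 hQ
    rwa [OrderIso.symm_apply_apply] at this
  set q : Submodule ℝ M := (ρ.mapSubmodule.symm Q).1 with hq
  have hqi := ρ.mem_invtSubmodule.1 (ρ.mapSubmodule.symm Q).2
  have hd : A ⊓ q = ⊥ := by
    have := congrArg Subtype.val h1.inf_eq_bot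
    simpa using this
  have hc : A ⊔ q = ⊤ := by
    have := congrArg Subtype.val h1.sup_eq_top
    simpa using this
  refine ⟨q ⊓ B, ?_, ?_, fun g v hv => ⟨hqi g hv.1, hB g v hv.2⟩⟩
  · rw [disjoint_iff, eq_bot_iff, ← hd]
    exact le_inf inf_le_right (inf_le_left.trans inf_le_left)
  · rw [sup_comm, ← sup_inf_assoc_of_le q hAB, hc, top_inf_eq]

theorem exists_invariant_complements {n k : ℕ} {V : Submodule ℝ (Form n k Finset.univ)}
    (hV : PermInvariant V) : ∃ C : Complements V, C.IsInvariant := by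
  have h : ∀ d : Fin (n + 1), _ := fun d => exists_invariant_complement (permRep n k)
    (filtration_anti V (Nat.le_succ (d : ℕ)) (by omega)) (filtration_permInvariant hV _)
    (filtration_permInvariant hV _)
  choose W h1 h2 h3 using h
  exact ⟨⟨W, h1, h2⟩, h3⟩

/-! ### The pieces of a geometric decomposition -/

section Pieces

variable {n k : ℕ} {V : Submodule ℝ (Form n k Finset.univ)}

/-- Elements of `W_d` are determined by their traces on the `d`-dimensional faces, because the
kernel of these traces is `V_{d+1}`. -/
theorem Complements.eq_zero_of_trace (C : Complements V) {d : Fin (n + 1)}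
    {ω : Form n k Finset.univ} (hω : ω ∈ C.W d)
    (h : ∀ F : Face n, F.dim = d → trace k (Finset.subset_univ F.1) ω = 0) : ω = 0 := by
  refine Submodule.disjoint_def.1 (C.disjoint d) ω hω ?_
  rw [mem_filtration]
  refine ⟨(mem_filtration.1 (C.le_filtration d hω)).1, fun F hF => ?_⟩
  have hne : F.Nonempty := Finset.card_pos.1 (by omega)
  refine h ⟨F, hne⟩ (Fin.ext ?_)
  have := Face.dim_add_one (⟨F, hne⟩ : Face n)
  simp only at this
  omega

/-- The forms in `W_d`, `d = dim F`, whose traces vanish on all `d`-dimensional faces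
except `F`. -/
def Complements.piece (C : Complements V) (F : Face n) : Submodule ℝ V where
  carrier := {ω | (ω : Form n k Finset.univ) ∈ C.W F.dim ∧ ∀ G : Face n, G.1.card = F.1.card →
    G ≠ F → trace k (Finset.subset_univ G.1) (ω : Form n k Finset.univ) = 0}
  add_mem' := fun ha hb => ⟨Submodule.add_mem _ ha.1 hb.1, fun G h1 h2 => by
    rw [Submodule.coe_add, map_add, ha.2 G h1 h2, hb.2 G h1 h2, add_zero]⟩
  zero_mem' := ⟨Submodule.zero_mem _, fun _ _ _ => map_zero _⟩
  smul_mem' := fun c a ha => ⟨Submodule.smul_mem _ _ ha.1, fun G h1 h2 => by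
    rw [Submodule.coe_smul, map_smul, ha.2 G h1 h2, smul_zero]⟩

theorem Complements.subRep_mem_piece {C : Complements V} (hC : C.IsInvariant)
    (hV : PermInvariant V) (π : Equiv.Perm (Fin (n + 1))) (F : Face n) :
    ∀ ω ∈ C.piece F, subRep hV π ω ∈ C.piece (π • F) := by
  intro ω hω
  refine ⟨?_, fun G hG hGF => ?_⟩
  · rw [Face.dim_smul]
    exact hC _ _ _ hω.1
  · rw [face_smul_card] at hG
    have h := trace_permRep_eq_zero π (hω.2 (π⁻¹ • G) (by rw [face_smul_card, hG])
      (fun h => hGF (by rw [← h, smul_inv_smul])))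
    have e : (π⁻¹ • G).1.map π.toEmbedding = G.1 := by
      rw [← face_smul_val, smul_inv_smul]
    rw [e] at h
    exact h

/-- Forms in `V` with vanishing trace on the boundary of a face `F` can be changed, without
changing the trace on `F`, to have vanishing trace on the other faces of the same dimension. -/
def TracesExtend (V : Submodule ℝ (Form n k Finset.univ)) : Prop :=
  ∀ F : Face n, ∀ ω ∈ V,
    (∀ G ⊆ F.1, G.card + 1 = F.1.card → trace k (Finset.subset_univ G) ω = 0) →
    ∃ η ∈ V, trace k (Finset.subset_univ F.1) η = trace k (Finset.subset_univ F.1) ω ∧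
      ∀ G : Face n, G.1.card = F.1.card → G ≠ F → trace k (Finset.subset_univ G.1) η = 0

/-- In a vanishing sum, consider the trace on a face `G`, by induction on the number of vertices.
The members for smaller faces are zero by induction, those for other faces of the same size have
zero trace on `G` by definition, and those for larger faces lie deeper in the filtration. So the
member for `G` has zero trace on `G`. -/
theorem Complements.iSupIndep_piece (C : Complements V) : iSupIndep C.piece := by
  refine (iSupIndep_iff_finsetSum_eq_zero_imp_eq_zero (R := ℝ) (N := V) C.piece).2 ?_
  intro s v hv hsum
  have key : ∀ (m : ℕ), ∀ F ∈ s, F.1.card = m → v F = 0 := by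
    intro m
    induction m using Nat.strong_induction_on with
    | _ m ih =>
      intro F hF hm
      refine Subtype.ext (C.eq_zero_of_trace (hv F hF).1 fun G hG => ?_)
      rw [Face.dim_eq_iff] at hG
      by_cases hGF : G = F
      · subst hGF
        have h1 := congrArg (fun w : V => trace k (Finset.subset_univ G.1) w.1) hsum
        simp only [Submodule.coe_sum, map_sum, Submodule.coe_zero, map_zero] at h1
        rw [Finset.sum_eq_single_of_mem G hF] at h1
        · exact h1
        · intro H hH hne
          rcases lt_trichotomy H.1.card m with h | h | h
          · rw [ih _ h H hH rfl]
            simp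
          · exact (hv H hH).2 G (by omega) (Ne.symm hne)
          · have h2 := C.le_filtration _ (hv H hH).1
            have h3 := H.dim_add_one
            have h4 := filtration_anti V (d := m) (e := H.dim) (by omega) (by omega) h2
            exact (mem_filtration.1 h4).2 G.1 (by omega)
      · exact (hv F hF).2 G hG hGF
  exact fun F hF => key _ F hF rfl

/-- Removing the component in `V_{d+1}` brings `η` into `W_d` and does not affect traces on
`d`-dimensional faces. -/
theorem Complements.exists_mem_piece (C : Complements V) {F : Face n}
    {η : Form n k Finset.univ} (hη : η ∈ filtration V F.dim)
    (h : ∀ G : Face n, G.1.card = F.1.card → G ≠ F → trace k (Finset.subset_univ G.1) η = 0) :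
    ∃ w : V, w ∈ C.piece F ∧ trace k (Finset.subset_univ F.1) (w : Form n k Finset.univ)
      = trace k (Finset.subset_univ F.1) η := by
  have hcard := F.dim_add_one
  rw [← C.sup_eq] at hη
  obtain ⟨w, hw, u, hu, hwu⟩ := Submodule.mem_sup.1 hη
  have hwV := (mem_filtration.1 (C.le_filtration _ hw)).1
  have hu' := (mem_filtration.1 hu).2
  have hwη : ∀ G : Face n, G.1.card = F.1.card →
      trace k (Finset.subset_univ G.1) w = trace k (Finset.subset_univ G.1) η := by
    intro G hG
    rw [← hwu, map_add, hu' G.1 (by omega), add_zero]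
  exact ⟨⟨w, hwV⟩, ⟨hw, fun G hG hGF => by rw [hwη G hG, h G hG hGF]⟩, hwη F rfl⟩

/-- For `ω` in `W_d`, the trace of `ω` on each `d`-dimensional face is realized by an element of the
corresponding piece. The difference between `ω` and the sum of these lies in `W_d` and has no traces
left, so it is zero. -/
theorem Complements.iSup_piece (C : Complements V) (hE : TracesExtend V) :
    iSup C.piece = ⊤ := by
  have hW : ∀ d, ∀ ω (hω : ω ∈ C.W d),
      (⟨ω, (mem_filtration.1 (C.le_filtration d hω)).1⟩ : V) ∈ iSup C.piece := by
    intro d ω hω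
    have hω' := mem_filtration.1 (C.le_filtration d hω)
    have hext : ∀ F : Face n, F.dim = d → ∃ w : V, w ∈ C.piece F ∧
        trace k (Finset.subset_univ F.1) (w : Form n k Finset.univ)
          = trace k (Finset.subset_univ F.1) ω := by
      intro F hF
      have hcard := F.dim_add_one
      rw [hF] at hcard
      obtain ⟨η, hη, h1, h2⟩ := hE F ω hω'.1 (fun G hG hc => hω'.2 G (by omega))
      have h3 : η ∈ filtration V d := by
        rw [mem_filtration]
        refine ⟨hη, fun G hG => ?_⟩
        -- A face of dimension `d - 1` that is not contained in `F` lies in a `d`-dimensional face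
        -- other than `F`, on which `η` vanishes.
        by_cases hGF : G ⊆ F.1
        · rw [← trace_trace k (Finset.subset_univ F.1) hGF, h1, trace_trace]
          exact hω'.2 G hG
        · have hlt : G.card < (Finset.univ : Finset (Fin (n + 1))).card := by
            rw [Finset.card_fin]
            omega
          obtain ⟨H, hGH, -, hH⟩ := Finset.exists_subsuperset_card_eq (Finset.subset_univ G)
            (Nat.le_succ _) hlt
          have hHne : H.Nonempty := Finset.card_pos.1 (by omega)
          exact trace_eq_zero_mono hGH (h2 ⟨H, hHne⟩ (by simp only; omega)
            (fun e => hGF (by rw [← e]; exact hGH)))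
      subst hF
      rw [← h1]
      exact C.exists_mem_piece h3 h2
    choose! w hw1 hw2 using hext
    have hsum : (⟨ω, hω'.1⟩ : V) = ∑ F ∈ Finset.univ.filter (fun F : Face n => F.dim = d), w F := by
      rw [← sub_eq_zero]
      refine Subtype.ext (C.eq_zero_of_trace (d := d) ?_ fun G hG => ?_)
      · simp only [Submodule.coe_sub, Submodule.coe_sum]
        refine Submodule.sub_mem _ hω (Submodule.sum_mem _ fun F hF => ?_)
        have hFd := (Finset.mem_filter.1 hF).2
        exact hFd ▸ (hw1 F hFd).1
      · simp only [Submodule.coe_sub, Submodule.coe_sum, map_sub, map_sum]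
        rw [Finset.sum_eq_single_of_mem G (by simpa using hG), hw2 G hG, sub_self]
        intro F hF hne
        have hFd := (Finset.mem_filter.1 hF).2
        exact (hw1 F hFd).2 G (Face.dim_eq_iff.1 (hG.trans hFd.symm)) (Ne.symm hne)
    rw [hsum]
    exact Submodule.sum_mem _ fun F hF =>
      Submodule.mem_iSup_of_mem F (hw1 F (Finset.mem_filter.1 hF).2)
  rw [eq_top_iff]
  rintro ⟨ω, hω⟩ _
  have h1 : (iSup C.piece).map V.subtype = V := by
    apply le_antisymm
    · rintro _ ⟨u, -, rfl⟩
      exact u.2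
    · conv_lhs => rw [← C.iSup_eq]
      refine iSup_le fun d u hu => ?_
      exact ⟨_, hW d u hu, rfl⟩
  have h2 : ω ∈ (iSup C.piece).map V.subtype := h1.symm ▸ hω
  obtain ⟨u, hu, rfl⟩ := h2
  exact hu

theorem Complements.isInternal_piece (C : Complements V) (hE : TracesExtend V) :
    DirectSum.IsInternal C.piece :=
  DirectSum.isInternal_submodule_of_iSupIndep_of_iSup_eq_top (R := ℝ) (M := V)
    C.iSupIndep_piece (C.iSup_piece hE)

/-- A component in another `W_d` has zero traces on all `d`-dimensional faces, so it vanishes. -/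
theorem Complements.mem_W_of_decompMap (C : Complements V) (F : Face n) (ω : V)
    (h : ∀ G : Face n, G ≠ F → C.decompMap ω G = 0) :
    (ω : Form n k Finset.univ) ∈ C.W F.dim := by
  obtain ⟨w, rfl⟩ := C.sumEquiv.surjective ω
  have h0 : ∀ d, d ≠ F.dim → w d = 0 := by
    intro d hd
    refine Subtype.ext (C.eq_zero_of_trace (w d).2 fun G hG => ?_)
    subst hG
    have h1 := congrArg Subtype.val (h G (fun e => hd (by rw [e])))
    have h2 : (C.decompMap (C.sumEquiv w) G : Form n k G.1)
        = trace k (Finset.subset_univ G.1) (C.sumEquiv.symm (C.sumEquiv w) G.dim) := rfl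
    rw [h2, LinearEquiv.symm_apply_apply] at h1
    exact h1
  have h1 : w = DirectSum.of (fun d => C.W d) F.dim (w F.dim) := by
    refine DFinsupp.ext fun d => ?_
    by_cases hd : d = F.dim
    · subst hd
      rw [DirectSum.of_eq_same]
    · rw [h0 d hd, DirectSum.of_eq_of_ne _ _ _ hd]
  have h2 : (C.sumEquiv w : Form n k Finset.univ) = DirectSum.coeLinearMap C.W w := rfl
  rw [h2, h1, DirectSum.coeLinearMap_of]
  exact (w F.dim).2

/-- The members of a geometrically decomposed basis are those that lie in one of the pieces. -/
theorem Complements.mem_piece_iff (C : Complements V) (F : Face n) (ω : V) :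
    ω ∈ C.piece F ↔ ∀ G : Face n, G ≠ F → C.decompMap ω G = 0 := by
  constructor
  · rintro ⟨h1, h2⟩ G hG
    apply Subtype.ext
    rw [C.decompMap_apply _ ω h1 G]
    split_ifs with h
    · exact h2 G (Face.dim_eq_iff.1 h) hG
    · rfl
  · intro h
    have hW := C.mem_W_of_decompMap F ω h
    refine ⟨hW, fun G hG hGF => ?_⟩
    have := congrArg Subtype.val (h G hGF)
    rw [C.decompMap_apply _ ω hW G, if_pos (Face.dim_eq_iff.2 hG)] at this
    exact this

/-- Complements that admit an invariant decomposable basis are invariant. -/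
theorem HasDecomposableInvariantBasis.isInvariant {C : Complements V}
    (h : HasDecomposableInvariantBasis C) : C.IsInvariant := by
  obtain ⟨N, ξ, h1, h2⟩ := h
  have hp : ∀ i, ∃ F, ξ i ∈ C.piece F := fun i => by
    obtain ⟨F, hF⟩ := h2 i
    exact ⟨F, (C.mem_piece_iff F _).2 hF⟩
  have hWi : ∀ i, ∃ d, (ξ i : Form n k Finset.univ) ∈ C.W d := fun i => by
    obtain ⟨F, hF⟩ := hp i
    exact ⟨_, hF.1⟩
  have hind : iSupIndep C.W :=
    iSupIndep_of_dfinsupp_lsum_injective _ C.injective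
  set s : Set (Form n k Finset.univ) := Set.range fun i => (ξ i : Form n k Finset.univ) with hs
  have hsV : Submodule.span ℝ s = V := by
    have : s = V.subtype '' Set.range ξ := by
      rw [hs, ← Set.range_comp]
      rfl
    rw [this, ← Submodule.map_span, ξ.span_eq, Submodule.map_top, Submodule.range_subtype]
  have hspan := span_inter_eq_of_iSupIndep hind (s := s)
    (by rintro _ ⟨i, rfl⟩; exact hWi i)
    (fun d => by rw [hsV]; exact (C.le_filtration d).trans inf_le_left)
  have hVinv : PermInvariant V := by
    intro π ω hω
    have h3 : V ≤ V.comap (permRep n k π) := by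
      conv_lhs => rw [← hsV]
      rw [Submodule.span_le]
      rintro _ ⟨i, rfl⟩
      obtain ⟨j, hj⟩ := h1 π i
      rw [SetLike.mem_coe, Submodule.mem_comap]
      rcases hj with hj | hj
      · rw [hj]; exact (ξ j).2
      · rw [hj]; exact V.neg_mem (ξ j).2
    exact h3 hω
  -- The index `d` of a nonzero vector of `W_d` is the last step of the filtration that contains it.
  -- Since the filtration is invariant, a permutation cannot change this index.
  have hfil : ∀ (d e : Fin (n + 1)) (v : Form n k Finset.univ), v ∈ C.W d → v ≠ 0 →
      v ∈ filtration V e → e ≤ d := by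
    intro d e v hv hv0 hve
    by_contra hlt
    have h4 := filtration_anti V (d := d + 1) (e := e) (by
      have := not_le.1 hlt; exact this) (by omega) hve
    exact hv0 (Submodule.disjoint_def.1 (C.disjoint d) v hv h4)
  intro d π
  have h3 : C.W d ≤ (C.W d).comap (permRep n k π) := by
    conv_lhs => rw [← hspan d]
    rw [Submodule.span_le]
    rintro _ ⟨⟨i, rfl⟩, hi⟩
    obtain ⟨j, hj⟩ := h1 π i
    obtain ⟨e, he⟩ := hWi j
    have hj0 : (ξ j : Form n k Finset.univ) ≠ 0 := by
      simpa using ξ.ne_zero j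
    have hi0 : (ξ i : Form n k Finset.univ) ≠ 0 := by
      simpa using ξ.ne_zero i
    -- One inequality comes from invariance of the filtration under `π`, the other from invariance
    -- under its inverse.
    have hde : d = e := by
      apply le_antisymm
      · apply hfil e d _ he hj0
        have h5 := filtration_permInvariant hVinv d π _ (C.le_filtration d hi)
        rcases hj with hj | hj
        · simpa only [hj] using h5
        · rw [hj] at h5
          simpa using h5
      · apply hfil d e _ hi hi0
        have h5 := filtration_permInvariant hVinv e π⁻¹ _ (C.le_filtration e he)
        rcases hj with hj | hj
        · rw [← hj, rep_inv_apply] at h5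
          exact h5
        · rw [← neg_eq_iff_eq_neg] at hj
          rw [← hj, map_neg, rep_inv_apply] at h5
          simpa using h5
    subst hde
    rw [SetLike.mem_coe, Submodule.mem_comap]
    rcases hj with hj | hj
    · simpa only [hj] using he
    · simp only [hj]; exact Submodule.neg_mem _ he
  exact fun ω hω => h3 hω

end Pieces

/-! ### Traces of block permutations -/

/-- The trace of a map that permutes the summands of a direct sum is the sum of the traces on the
summands that are fixed. -/
theorem trace_eq_sum_fixed {ι V : Type*} [AddCommGroup V] [Module ℝ V] [FiniteDimensional ℝ V]
    [Fintype ι] [DecidableEq ι] {N : ι → Submodule ℝ V} (h : DirectSum.IsInternal N)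
    (f : End ℝ V) (σ : ι → ι) (hf : ∀ i, ∀ v ∈ N i, f v ∈ N (σ i))
    (τ : ι → ℝ) (hτ : ∀ i (hi : ∀ v ∈ N i, f v ∈ N i), σ i = i →
      τ i = LinearMap.trace ℝ (N i) (f.restrict hi)) (hτ' : ∀ i, σ i ≠ i → τ i = 0) :
    LinearMap.trace ℝ V f = ∑ i, τ i := by
  set b : ∀ i, Basis (Fin (finrank ℝ (N i))) ℝ (N i) := fun i => finBasis ℝ (N i)
  rw [LinearMap.trace_eq_matrix_trace ℝ (h.collectedBasis b), Matrix.trace, Fintype.sum_sigma]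
  refine Finset.sum_congr rfl fun i _ => ?_
  by_cases hi : σ i = i
  · have hi' : ∀ v ∈ N i, f v ∈ N i := fun v hv => by simpa only [hi] using hf i v hv
    rw [hτ i hi' hi, LinearMap.trace_eq_matrix_trace ℝ (b i), Matrix.trace]
    refine Finset.sum_congr rfl fun j _ => ?_
    rw [Matrix.diag_apply, Matrix.diag_apply, LinearMap.toMatrix_apply, LinearMap.toMatrix_apply,
      DirectSum.IsInternal.collectedBasis_coe,
      h.collectedBasis_repr_of_mem b (hi' _ (b i j).2)]
    rfl
  · rw [hτ' i hi]
    refine Finset.sum_eq_zero fun j _ => ?_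
    rw [Matrix.diag_apply, LinearMap.toMatrix_apply, DirectSum.IsInternal.collectedBasis_coe]
    exact h.collectedBasis_repr_of_mem_ne b hi (hf _ _ (b i j).2)

/-- The trace of a map on a quotient `U` of `X` that is presented by linear maps `Φ` and `T` to a
common space, from an equivariant parametrization `j` of the kernel of `Φ`. -/
theorem trace_eq_trace_restrict_add {M X Y L : Type*} [AddCommGroup M] [Module ℝ M]
    [FiniteDimensional ℝ M] [AddCommGroup X] [Module ℝ X] [FiniteDimensional ℝ X] [AddCommGroup Y]
    [Module ℝ Y] [AddCommGroup L] [Module ℝ L] (U : Submodule ℝ M) (T : M →ₗ[ℝ] Y)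
    (Φ : X →ₗ[ℝ] Y) (g : End ℝ M) (hg : ∀ w ∈ U, g w ∈ U) (u : End ℝ X)
    (hT : ∀ w ∈ U, T w = 0 → w = 0) (h₁ : ∀ x, ∃ w ∈ U, T w = Φ x)
    (h₂ : ∀ w ∈ U, ∃ x, Φ x = T w) (hgu : ∀ x, ∀ w ∈ U, T w = Φ x → T (g w) = Φ (u x))
    (j : L →ₗ[ℝ] X) (hj : Function.Injective j) (w : End ℝ L) (hw : ∀ x, j (w x) = u (j x))
    (hj' : ∀ x, Φ x = 0 ↔ x ∈ LinearMap.range j) :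
    LinearMap.trace ℝ X u = LinearMap.trace ℝ U (g.restrict hg) + LinearMap.trace ℝ L w := by
  have hext : ∀ a b : U, T a = T b → a = b := by
    intro a b h
    rw [← sub_eq_zero, ← map_sub] at h
    have h2 := hT _ (U.sub_mem a.2 b.2) h
    exact Subtype.ext (sub_eq_zero.1 h2)
  have hex : ∀ x, ∃ w : U, T w = Φ x := fun x => by
    obtain ⟨w, hw, h⟩ := h₁ x
    exact ⟨⟨w, hw⟩, h⟩
  choose f hf using hex
  -- Since `T` is injective on `U`, the solution `w` of `T w = Φ x` is unique and so depends
  -- linearly on `x`. This exhibits `U` as the quotient of `X` by the image of `j`.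
  let f' : X →ₗ[ℝ] U :=
    { toFun := f
      map_add' := fun x y => hext _ _ (by
        simp only [Submodule.coe_add, map_add, hf])
      map_smul' := fun c x => hext _ _ (by
        simp only [Submodule.coe_smul, map_smul, hf, RingHom.id_apply]) }
  have hf' : ∀ x, T (f' x) = Φ x := hf
  have hsurj : Function.Surjective f' := by
    intro a
    obtain ⟨x, hx⟩ := h₂ a a.2
    exact ⟨x, hext _ _ (by rw [hf', hx])⟩
  have hequi : ∀ x, f' (u x) = g.restrict hg (f' x) := by
    intro x
    apply hext
    rw [hf', LinearMap.coe_restrict_apply, hgu x _ (f' x).2 (hf' x)]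
  have hker : LinearMap.ker f' = LinearMap.range j := by
    ext x
    rw [← hj', ← hf', LinearMap.mem_ker]
    constructor
    · intro h
      rw [h, Submodule.coe_zero, map_zero]
    · intro h
      apply hext
      rw [h, Submodule.coe_zero, map_zero]
  have hK : ∀ x ∈ LinearMap.ker f', u x ∈ LinearMap.ker f' := by
    intro x hx
    rw [LinearMap.mem_ker] at hx ⊢
    rw [hequi, hx, map_zero]
  rw [trace_eq_add_trace_ker f' hsurj u _ hequi hK]
  congr 1
  let e : L ≃ₗ[ℝ] LinearMap.ker f' :=
    (LinearEquiv.ofInjective j hj).trans (LinearEquiv.ofEq _ _ hker.symm)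
  have he : ∀ x, (e x : X) = j x := fun x => rfl
  rw [← LinearMap.trace_conj' w e]
  congr 1
  refine LinearMap.ext fun y => ?_
  obtain ⟨x, rfl⟩ := e.surjective y
  apply Subtype.ext
  rw [LinearEquiv.conj_apply_apply, LinearEquiv.symm_apply_apply, he, hw]
  rfl

theorem hasSignedBasis_of_eq_bot {G X V : Type*} [Group G] [MulAction G X] [AddCommGroup V]
    [Module ℝ V] (ρ : Representation ℝ G V) (x : X) {U : Submodule ℝ V} (hU : U = ⊥) :
    HasSignedBasis ρ x U := by
  subst hU
  exact ⟨0, Basis.empty _, fun _ _ i => i.elim0⟩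

/-! ### Families of subspaces indexed by the faces -/

section Blocks

variable {n : ℕ} {M : Type*} [AddCommGroup M] [Module ℝ M]

/-- A family of subspaces indexed by the faces that is permuted by a representation in such a way
that permutations act trivially on the subspaces of those faces whose vertices they fix, and such
that the subspaces of the vertices are zero. -/
structure IsFaceSystem (ρ : Representation ℝ (Equiv.Perm (Fin (n + 1))) M)
    (N : Face n → Submodule ℝ M) : Prop where
  map_mem : ∀ g F, ∀ v ∈ N F, ρ g v ∈ N (g • F)
  fixes : ∀ (g : Equiv.Perm (Fin (n + 1))) (F : Face n), (∀ i ∈ F.1, g i = i) →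
    ∀ v ∈ N F, ρ g v = v
  vertex : ∀ F : Face n, F.1.card = 1 → N F = ⊥

variable {ρ : Representation ℝ (Equiv.Perm (Fin (n + 1))) M} {N : Face n → Submodule ℝ M}

/-- The action on the subspace of a face of a permutation that fixes the face. -/
def blockMap (h : IsFaceSystem ρ N) {g : Equiv.Perm (Fin (n + 1))} {F : Face n}
    (hF : g • F = F) : End ℝ (N F) :=
  (ρ g).restrict fun v hv => hF ▸ h.map_mem g F v hv

theorem blockMap_coe (h : IsFaceSystem ρ N) {g : Equiv.Perm (Fin (n + 1))} {F : Face n}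
    (hF : g • F = F) (v : N F) : (blockMap h hF v : M) = ρ g v := rfl

theorem blockMap_mul (h : IsFaceSystem ρ N) {g g' g'' : Equiv.Perm (Fin (n + 1))} {F : Face n}
    (hg : g • F = F) (hg' : g' • F = F) (hg'' : g'' • F = F) (e : g * g' = g'') :
    blockMap h hg * blockMap h hg' = blockMap h hg'' := by
  subst e
  ext v
  simp only [Module.End.mul_apply, blockMap_coe, map_mul]

theorem blockMap_one (h : IsFaceSystem ρ N) {g : Equiv.Perm (Fin (n + 1))} {F : Face n}
    (hg : g • F = F) (e : g = 1) : blockMap h hg = 1 := by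
  subst e
  ext v
  simp only [Module.End.one_apply, blockMap_coe, map_one]

theorem PermutesUpToSign.of_blockMap {h : IsFaceSystem ρ N} {g : Equiv.Perm (Fin (n + 1))}
    {F : Face n} {hF : g • F = F} {ι : Type*} {b : ι → N F}
    (hb : PermutesUpToSign (blockMap h hF) b) :
    PermutesUpToSign (ρ g) (fun i => (b i : M)) := by
  intro i
  obtain ⟨j, hj⟩ := hb i
  exact ⟨j, hj.imp (fun h => congrArg Subtype.val h) (fun h => congrArg Subtype.val h)⟩

/-- Permutations fixing both vertices of the edge act trivially, so the stabilizer acts through the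
swap of the vertices, an involution. Eigenvectors of the swap form the basis. -/
theorem hasSignedBasis_edge [FiniteDimensional ℝ M] (h : IsFaceSystem ρ N) {F : Face n}
    (hF : F.1.card = 2) : HasSignedBasis ρ F (N F) := by
  obtain ⟨a, b, hab, hFab⟩ := Finset.card_eq_two.1 hF
  have hs : Equiv.swap a b • F = F := by
    apply Subtype.ext
    rw [face_smul_val, hFab]
    ext i
    simp [or_comm]
  obtain ⟨m, B, hB⟩ := exists_eigenbasis_of_involution (blockMap h hs) (fun x => by
    rw [← Module.End.mul_apply, blockMap_mul h hs hs (one_smul _ _) (Equiv.swap_mul_self _ _),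
      blockMap_one h _ rfl, Module.End.one_apply])
  have hfix : ∀ (g : Equiv.Perm (Fin (n + 1))), g a = a → g b = b → ∀ v : N F,
      ρ g v = v := by
    intro g h1 h2 v
    refine h.fixes g F (fun i hi => ?_) v v.2
    rw [hFab] at hi
    rcases Finset.mem_insert.1 hi with rfl | hi
    · exact h1
    · rw [Finset.mem_singleton.1 hi]; exact h2
  refine ⟨m, B, fun g hg i => ⟨i, ?_⟩⟩
  have hgF : F.1.map g.toEmbedding = F.1 := congrArg Subtype.val hg
  have hmem : ∀ i ∈ F.1, g i ∈ F.1 := fun i hi => by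
    rw [← hgF]
    exact Finset.mem_map_of_mem _ hi
  have hga := hmem a (by simp [hFab])
  have hgb := hmem b (by simp [hFab])
  rw [hFab] at hga hgb
  simp only [Finset.mem_insert, Finset.mem_singleton] at hga hgb
  have hne : g a ≠ g b := fun h => hab (g.injective h)
  by_cases hga' : g a = a
  · have hgb' : g b = b := by
      rcases hgb with h | h
      · exact absurd (hga'.trans h.symm) hne
      · exact h
    exact Or.inl (hfix g hga' hgb' (B i))
  · have hgab : g a = b := hga.resolve_left hga'
    have hgba : g b = a := by
      rcases hgb with h | h
      · exact h
      · exact absurd (hgab.trans h.symm) hne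
    have h2 : ρ g (B i) = ρ (Equiv.swap a b) (B i) := by
      conv_rhs => rw [← hfix (Equiv.swap a b * g) (by simp [hgab]) (by simp [hgba]) (B i)]
      rw [← Module.End.mul_apply, ← map_mul, ← mul_assoc, Equiv.swap_mul_self, one_mul]
    rw [h2]
    exact (hB i).imp (fun h => congrArg Subtype.val h) (fun h => congrArg Subtype.val h)

end Blocks

/-! ### The criterion in dimension three -/

section Three

variable {M : Type*} [AddCommGroup M] [Module ℝ M]
  {ρ : Representation ℝ (Equiv.Perm (Fin 4)) M} {N : Face 3 → Submodule ℝ M}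

/-- The cyclic permutation of the last three vertices. -/
def cyc : Equiv.Perm (Fin 4) := Equiv.swap 1 2 * Equiv.swap 2 3

/-- The triangle opposite to the vertex `0`. -/
def baseFace : Face 3 := ⟨{1, 2, 3}, by simp⟩

/-- The tetrahedron. -/
def topFace : Face 3 := ⟨Finset.univ, by simp⟩

theorem cyc_smul_baseFace : cyc • baseFace = baseFace := Subtype.ext (by decide)

theorem smul_topFace (π : Equiv.Perm (Fin 4)) : π • topFace = topFace :=
  Subtype.ext (by simp [face_smul_val, topFace])

theorem cyc_pow_three : cyc * cyc * cyc = 1 := by decide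

/-- The stabilizer of the triangle consists of six permutations, generated by `cyc` and the swap of
2 and 3, so the criterion for `S_3` applies. -/
theorem hasSignedBasis_baseFace [FiniteDimensional ℝ M] (hN : IsFaceSystem ρ N)
    (h : 0 ≤ LinearMap.trace ℝ (N baseFace) (blockMap hN cyc_smul_baseFace)) :
    HasSignedBasis ρ baseFace (N baseFace) := by
  have ht : Equiv.swap (2 : Fin 4) 3 • baseFace = baseFace := Subtype.ext (by decide)
  have hcc : (cyc * cyc) • baseFace = baseFace := Subtype.ext (by decide)
  have hct : (cyc * cyc * Equiv.swap (2 : Fin 4) 3) • baseFace = baseFace :=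
    Subtype.ext (by decide)
  obtain ⟨m, B, hc, ht⟩ := exists_signed_basis_of_three (blockMap hN cyc_smul_baseFace)
    (blockMap hN ht)
    (by rw [blockMap_mul hN _ _ hcc rfl,
          blockMap_mul hN _ _ (one_smul _ _) cyc_pow_three, blockMap_one hN _ rfl])
    (by rw [blockMap_mul hN _ _ (one_smul _ _) (Equiv.swap_mul_self _ _),
          blockMap_one hN _ rfl])
    (by rw [blockMap_mul hN _ _ hct (by decide), blockMap_mul hN _ _ hcc rfl,
          blockMap_mul hN _ _ hct rfl]) h
  have hc' := hc.of_blockMap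
  have ht' := ht.of_blockMap
  refine ⟨m, B, fun g hg => ?_⟩
  have hg' : ({1, 2, 3} : Finset (Fin 4)).map g.toEmbedding = {1, 2, 3} :=
    congrArg Subtype.val hg
  have key : ∀ g : Equiv.Perm (Fin 4), ({1, 2, 3} : Finset (Fin 4)).map g.toEmbedding = {1, 2, 3} →
      g = 1 ∨ g = cyc ∨ g = cyc * cyc ∨ g = Equiv.swap 2 3 ∨ g = cyc * Equiv.swap 2 3 ∨
        g = cyc * cyc * Equiv.swap 2 3 := by decide
  rcases key g hg' with rfl | rfl | rfl | rfl | rfl | rfl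
  · rw [map_one]
    exact PermutesUpToSign.one _
  · exact hc'
  · rw [map_mul]
    exact hc'.mul hc'
  · exact ht'
  · rw [map_mul]
    exact hc'.mul ht'
  · rw [map_mul, map_mul]
    exact (hc'.mul hc').mul ht'

theorem hasSignedBasis_topFace [FiniteDimensional ℝ M] (hN : IsFaceSystem ρ N)
    (h : 0 ≤ LinearMap.trace ℝ (N topFace) (blockMap hN (smul_topFace cyc))) :
    HasSignedBasis ρ topFace (N topFace) := by
  set f : Equiv.Perm (Fin 4) → End ℝ (N topFace) :=
    fun π => blockMap hN (smul_topFace π)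
  have fm : ∀ π σ, f π * f σ = f (π * σ) := fun π σ =>
    blockMap_mul hN _ _ (smul_topFace _) rfl
  have f1 : f 1 = 1 := blockMap_one hN _ rfl
  let a : Equiv.Perm (Fin 4) := Equiv.swap 0 1 * Equiv.swap 2 3
  let b : Equiv.Perm (Fin 4) := Equiv.swap 0 2 * Equiv.swap 1 3
  let t : Equiv.Perm (Fin 4) := Equiv.swap 2 3
  obtain ⟨m, B, ha, hb, hc, ht⟩ := exists_signed_basis_of_four (f a) (f b) (f cyc) (f t)
    (by rw [fm, ← f1]; congr 1; decide) (by rw [fm, ← f1]; congr 1; decide)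
    (by rw [fm, fm]; congr 1; decide) (by rw [fm, fm, ← f1]; congr 1; decide)
    (by rw [fm, ← f1]; congr 1; decide) (by rw [fm, fm, fm]; congr 1; decide)
    (by rw [fm, fm]; congr 1; decide) (by rw [fm, fm, fm]; congr 1; decide)
    (by rw [fm, fm]; congr 1; decide) (by rw [fm, fm, fm]; congr 1; decide) h
  have ha' := ha.of_blockMap
  have hc' := hc.of_blockMap
  have ht' := ht.of_blockMap
  refine ⟨m, B, fun g _ => ?_⟩
  let S : Submonoid (Equiv.Perm (Fin 4)) :=
    { carrier := {g | PermutesUpToSign (ρ g) (fun i => (B i : M))}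
      mul_mem' := fun hg hh => by
        rw [Set.mem_ofPred_eq, map_mul]
        exact PermutesUpToSign.mul hg hh
      one_mem' := by
        rw [Set.mem_ofPred_eq, map_one]
        exact PermutesUpToSign.one _ }
  -- The three adjacent transpositions, which generate `S_4`, are products of the elements `a`,
  -- `cyc` and `t` already treated.
  have hS : S = ⊤ := by
    rw [eq_top_iff, ← Equiv.Perm.mclosure_swap_castSucc_succ 3, Submonoid.closure_le]
    rintro _ ⟨i, rfl⟩
    have hat : Equiv.swap (0 : Fin 4) 1 ∈ S := by
      rw [show Equiv.swap (0 : Fin 4) 1 = a * t by decide]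
      exact S.mul_mem ha' ht'
    have hct : Equiv.swap (1 : Fin 4) 2 ∈ S := by
      rw [show Equiv.swap (1 : Fin 4) 2 = cyc * t by decide]
      exact S.mul_mem hc' ht'
    fin_cases i
    · exact hat
    · exact hct
    · exact ht'
  have : g ∈ S := hS ▸ Submonoid.mem_top g
  exact this

/-- Vertices and edges impose no condition, and all triangles lie in one orbit, so only the triangle
`baseFace` and the tetrahedron matter. -/
theorem exists_adapted_basis_iff [FiniteDimensional ℝ M] (hN : IsFaceSystem ρ N)
    (hint : DirectSum.IsInternal N) :
    (∃ (m : ℕ) (b : Basis (Fin m) ℝ M), (∀ g, PermutesUpToSign (ρ g) b) ∧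
      ∀ i, ∃ F, b i ∈ N F) ↔
      0 ≤ LinearMap.trace ℝ (N baseFace) (blockMap hN cyc_smul_baseFace) ∧
      0 ≤ LinearMap.trace ℝ (N topFace) (blockMap hN (smul_topFace cyc)) := by
  constructor
  · rintro ⟨m, b, h1, h2⟩
    have h3 : ρ cyc * ρ cyc * ρ cyc = 1 := by
      rw [← map_mul, ← map_mul, cyc_pow_three, map_one]
    have hind := hint.submodule_iSupIndep
    exact ⟨trace_nonneg_of_adapted_basis hind b h2 _ _ (h1 cyc) h3 _,
      trace_nonneg_of_adapted_basis hind b h2 _ _ (h1 cyc) h3 _⟩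
  · rintro ⟨h2, h3⟩
    refine exists_adapted_basis hint hN.map_mem fun F => ?_
    have hpos := F.2.card_pos
    have hle := Finset.card_le_univ F.1
    rw [Fintype.card_fin] at hle
    have hcases : F.1.card = 1 ∨ F.1.card = 2 ∨ F.1.card = 3 ∨ F.1.card = 4 := by omega
    rcases hcases with h | h | h | h
    · exact hasSignedBasis_of_eq_bot _ _ (hN.vertex F h)
    · exact hasSignedBasis_edge hN h
    · have key : ∀ F : Finset (Fin 4), F.card = 3 → ∃ i : Fin 4,
          ({1, 2, 3} : Finset (Fin 4)).map (Equiv.swap 0 i).toEmbedding = F := by decide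
      obtain ⟨i, hi⟩ := key F.1 h
      have e : F = Equiv.swap 0 i • baseFace := Subtype.ext hi.symm
      rw [e]
      exact (hasSignedBasis_baseFace hN h2).smul hN.map_mem _
    · have e : F = topFace := Subtype.ext ((Finset.card_eq_iff_eq_univ _).1 (by simpa using h))
      rw [e]
      exact hasSignedBasis_topFace hN h3

/-- The faces fixed by `cyc` are the vertex 0, the opposite triangle and the tetrahedron, and the
piece of a vertex is zero. -/
theorem trace_cyc_eq_add [FiniteDimensional ℝ M] (hN : IsFaceSystem ρ N)
    (hint : DirectSum.IsInternal N) :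
    LinearMap.trace ℝ M (ρ cyc) =
      LinearMap.trace ℝ (N baseFace) (blockMap hN cyc_smul_baseFace) +
      LinearMap.trace ℝ (N topFace) (blockMap hN (smul_topFace cyc)) := by
  let τ : Face 3 → ℝ := fun F => if h : cyc • F = F then
    LinearMap.trace ℝ (N F) (blockMap hN h) else 0
  have h1 := trace_eq_sum_fixed hint (ρ cyc) (fun F => cyc • F) (hN.map_mem cyc) τ
    (fun F _ hF => by simp only [τ, dif_pos hF]; rfl) (fun F hF => by simp only [τ, dif_neg hF])
  rw [h1, Finset.sum_eq_add baseFace topFace (by decide)]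
  · simp only [τ, dif_pos cyc_smul_baseFace, dif_pos (smul_topFace cyc)]
  · rintro F - ⟨hF1, hF2⟩
    by_cases hF : cyc • F = F
    · have key : ∀ F : Finset (Fin 4), F.map cyc.toEmbedding = F →
          F = ∅ ∨ F.card = 1 ∨ F = {1, 2, 3} ∨ F = Finset.univ := by decide
      rcases key F.1 (congrArg Subtype.val hF) with h | h | h | h
      · exact absurd h F.2.ne_empty
      · simp only [τ, dif_pos hF]
        have h2 := hN.vertex F h
        have : Subsingleton (N F) := by rw [h2]; infer_instance
        have h3 : blockMap hN hF = 0 := LinearMap.ext fun _ => Subsingleton.elim _ _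
        rw [h3, map_zero]
      · exact absurd (Subtype.ext h) hF1
      · exact absurd (Subtype.ext h) hF2
    · simp only [τ, dif_neg hF]
  · simp
  · simp

end Three

/-! ### The pieces of a geometric decomposition as a family of representations. -/

section Application

variable {n k : ℕ} {V : Submodule ℝ (Form n k Finset.univ)}

theorem Complements.eq_zero_of_mem_piece (C : Complements V) {F : Face n} {ω : V}
    (hω : ω ∈ C.piece F)
    (h : trace k (Finset.subset_univ F.1) (ω : Form n k Finset.univ) = 0) : ω = 0 := by
  refine Subtype.ext (C.eq_zero_of_trace hω.1 fun G hG => ?_)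
  by_cases hGF : G = F
  · subst hGF
    exact h
  · exact hω.2 G (Face.dim_eq_iff.1 hG) hGF

theorem trace_eq_zero_of_card_eq_one (hk : 1 ≤ k) {F : Finset (Fin (n + 1))} (hF : F.card = 1)
    (ω : Form n k Finset.univ) : trace k (Finset.subset_univ F) ω = 0 := by
  rw [trace_eq_zero_iff]
  intro x hx v hv
  obtain ⟨i, rfl⟩ := Finset.card_eq_one.1 hF
  have h0 : ∀ j, v j = 0 := by
    intro j
    obtain ⟨h1, h2⟩ := hv j
    funext l
    by_cases hl : l = i
    · subst hl
      rw [Finset.sum_eq_single l (fun b _ hb => h2 b (by simpa using hb)) (by simp)] at h1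
      exact h1
    · exact h2 l (by simpa using hl)
  exact AlternatingMap.map_coord_zero _ (⟨0, hk⟩ : Fin k) (Subtype.ext (h0 _))

/-- The trace to `F` is injective on the piece of `F`. Therefore a permutation fixing the vertices
of `F`, which does not alter traces on `F`, acts trivially, and at a vertex, where positive-degree
forms have zero trace, the piece is zero. -/
theorem Complements.isFaceSystem {C : Complements V} (hk : 1 ≤ k) (hC : C.IsInvariant)
    (hV : PermInvariant V) : IsFaceSystem (M := V) (subRep hV) C.piece where
  map_mem := C.subRep_mem_piece hC hV
  fixes g F hg v hv := by
    have hgF : g • F = F := by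
      apply Subtype.ext
      rw [face_smul_val]
      have h1 : F.1.map g.toEmbedding ⊆ F.1 := by
        intro i hi
        obtain ⟨j, hj, rfl⟩ := Finset.mem_map.1 hi
        change g j ∈ F.1
        rw [hg j hj]
        exact hj
      exact Finset.eq_of_subset_of_card_le h1 (Finset.card_map _).ge
    have h1 : subRep hV g v ∈ C.piece F := hgF ▸ C.subRep_mem_piece hC hV g F v hv
    have h2 : subRep hV g v - v ∈ C.piece F := Submodule.sub_mem (M := V) _ h1 hv
    have h3 := C.eq_zero_of_mem_piece h2
      (trace_permRep_of_fixes g hg (v : Form n k Finset.univ))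
    exact sub_eq_zero.1 h3
  vertex F hF := by
    rw [eq_bot_iff]
    intro ω hω
    exact C.eq_zero_of_mem_piece hω (trace_eq_zero_of_card_eq_one hk hF _)

/-- The trace of a permutation on the piece of a face that it fixes, from an equivariant
parametrization `E` of the forms on this face with vanishing trace on the boundary, and an
equivariant parametrization `j` of its kernel. -/
theorem Complements.trace_eq_trace_block_add [FiniteDimensional ℝ V] {X L : Type*}
    [AddCommGroup X] [Module ℝ X] [FiniteDimensional ℝ X] [AddCommGroup L] [Module ℝ L]
    {C : Complements V} (hk : 1 ≤ k) (hC : C.IsInvariant) (hV : PermInvariant V)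
    {π : Equiv.Perm (Fin (n + 1))} {F : Face n} (hF : π • F = F)
    (E : X →ₗ[ℝ] Form n k Finset.univ) (u : End ℝ X) (hu : ∀ x, E (u x) = permRep n k π (E x))
    (hE₀ : ∀ x, E x ∈ filtration V F.dim)
    (hE₁ : ∀ x, ∀ G : Face n, G.1.card = F.1.card → G ≠ F →
      trace k (Finset.subset_univ G.1) (E x) = 0)
    (hE₂ : ∀ ω ∈ V, (∀ G ⊆ F.1, G.card + 1 = F.1.card → trace k (Finset.subset_univ G) ω = 0) →
      ∃ x, trace k (Finset.subset_univ F.1) (E x) = trace k (Finset.subset_univ F.1) ω)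
    (j : L →ₗ[ℝ] X) (hj : Function.Injective j) (w : End ℝ L) (hw : ∀ x, j (w x) = u (j x))
    (hj' : ∀ x, trace k (Finset.subset_univ F.1) (E x) = 0 ↔ x ∈ LinearMap.range j) :
    LinearMap.trace ℝ X u
      = LinearMap.trace ℝ (C.piece F) (blockMap (M := V) (C.isFaceSystem hk hC hV) hF)
        + LinearMap.trace ℝ L w := by
  refine trace_eq_trace_restrict_add (M := V) (C.piece F)
    ((trace k (Finset.subset_univ F.1)).comp V.subtype)
    ((trace k (Finset.subset_univ F.1)).comp E) (subRep hV π) _ u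
    (fun ω hω h => C.eq_zero_of_mem_piece hω h)
    (fun x => C.exists_mem_piece (hE₀ x) (hE₁ x)) ?_ ?_ j hj w hw hj'
  · intro ω hω
    have h1 := mem_filtration.1 (C.le_filtration _ hω.1)
    have h2 := F.dim_add_one
    exact hE₂ ω ω.2 (fun G _ hG => h1.2 G (by omega))
  · intro x ω _ h
    simp only [LinearMap.comp_apply, Submodule.subtype_apply] at h ⊢
    rw [subRep_coe, hu, ← sub_eq_zero, ← map_sub, ← map_sub]
    rw [← sub_eq_zero, ← map_sub] at h
    have h2 := trace_permRep_eq_zero π h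
    have h3 : F.1.map π.toEmbedding = F.1 := congrArg Subtype.val hF
    rw [h3] at h2
    exact h2

end Application

/-! ### The three-cycle on triangles and on the tetrahedron. -/

section Three

variable {k : ℕ} {V : Submodule ℝ (Form 3 k Finset.univ)}

/-- The trace of the three-cycle on the forms associated with the triangle that it fixes. -/
def Complements.baseTrace {C : Complements V} (hk : 1 ≤ k) (hC : C.IsInvariant)
    (hV : PermInvariant V) : ℝ :=
  LinearMap.trace ℝ (C.piece baseFace)
    (blockMap (M := V) (C.isFaceSystem hk hC hV) cyc_smul_baseFace)

/-- The trace of the three-cycle on the forms associated with the tetrahedron. -/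
def Complements.topTrace {C : Complements V} (hk : 1 ≤ k) (hC : C.IsInvariant)
    (hV : PermInvariant V) : ℝ :=
  LinearMap.trace ℝ (C.piece topFace)
    (blockMap (M := V) (C.isFaceSystem hk hC hV) (smul_topFace cyc))

/-- A decomposable invariant basis exists if and only if the three-cycle has nonnegative trace on
the forms associated with a triangle and on those associated with the tetrahedron. -/
theorem hasDecomposableInvariantBasis_iff [FiniteDimensional ℝ V] (hk : 1 ≤ k)
    {C : Complements V} (hC : C.IsInvariant) (hV : PermInvariant V) (hE : TracesExtend V) :
    HasDecomposableInvariantBasis C ↔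
      0 ≤ C.baseTrace hk hC hV ∧ 0 ≤ C.topTrace hk hC hV := by
  have key := exists_adapted_basis_iff (M := V) (C.isFaceSystem hk hC hV) (C.isInternal_piece hE)
  refine Iff.trans ⟨?_, ?_⟩ key
  · rintro ⟨N, ξ, h1, h2⟩
    refine ⟨N, ξ, fun π i => ?_, fun i => ?_⟩
    · obtain ⟨j, hj⟩ := h1 π i
      exact ⟨j, hj.imp (fun h => Subtype.ext h) (fun h => Subtype.ext h)⟩
    · obtain ⟨F, hF⟩ := h2 i
      exact ⟨F, (C.mem_piece_iff F _).2 hF⟩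
  · rintro ⟨N, ξ, h1, h2⟩
    refine ⟨N, ξ, fun π i => ?_, fun i => ?_⟩
    · obtain ⟨j, hj⟩ := h1 π i
      exact ⟨j, hj.imp (fun h => congrArg Subtype.val h) (fun h => congrArg Subtype.val h)⟩
    · obtain ⟨F, hF⟩ := h2 i
      exact ⟨F, (C.mem_piece_iff F _).1 hF⟩

theorem trace_subRep_cyc [FiniteDimensional ℝ V] (hk : 1 ≤ k)
    {C : Complements V} (hC : C.IsInvariant) (hV : PermInvariant V) (hE : TracesExtend V) :
    LinearMap.trace ℝ V (subRep hV cyc) = C.baseTrace hk hC hV + C.topTrace hk hC hV :=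
  trace_cyc_eq_add (M := V) (C.isFaceSystem hk hC hV) (C.isInternal_piece hE)

/-- If the traces have the signs prescribed by a condition for invariant complements, then this
condition characterizes the existence of decomposable invariant bases. -/
theorem exists_iff_and_forall_iff [FiniteDimensional ℝ V] (hk : 1 ≤ k)
    (hV : PermInvariant V) (hE : TracesExtend V) (P : Prop)
    (h : ∀ (C : Complements V) (hC : C.IsInvariant),
      0 ≤ C.baseTrace hk hC hV ∧ 0 ≤ C.topTrace hk hC hV ↔ P) :
    ((∃ C : Complements V, HasDecomposableInvariantBasis C) ↔ P) ∧
      ∀ C : Complements V, C.IsInvariant → (HasDecomposableInvariantBasis C ↔ P) := by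
  have key : ∀ C : Complements V, C.IsInvariant → (HasDecomposableInvariantBasis C ↔ P) :=
    fun C hC => (hasDecomposableInvariantBasis_iff hk hC hV hE).trans (h C hC)
  refine ⟨⟨?_, fun hP => ?_⟩, key⟩
  -- A decomposable invariant basis forces its complements to be invariant, so the case of invariant
  -- complements applies.
  · rintro ⟨C, hC⟩
    exact (key C hC.isInvariant).1 hC
  · obtain ⟨C, hC⟩ := exists_invariant_complements hV
    exact ⟨C, (key C hC).2 hP⟩

theorem card_three_cases (F : Finset (Fin 4)) (hF : F.card = 3) :
    F = {1, 2, 3} ∨ ∃ i : Fin 3, F = Finset.univ.erase i.succ := by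
  revert F
  decide

/-- Traces extend if they do so from the edges and from one triangle. -/
theorem tracesExtend_of_edges_of_base (hk : 1 ≤ k) (hV : PermInvariant V)
    (h₁ : ∀ F : Face 3, F.1.card = 2 → ∀ ω ∈ V, ∃ η ∈ V,
      trace k (Finset.subset_univ F.1) η = trace k (Finset.subset_univ F.1) ω ∧
        ∀ G : Face 3, G.1.card = 2 → G ≠ F → trace k (Finset.subset_univ G.1) η = 0)
    (h₂ : ∀ ω ∈ V, (∀ G ⊆ baseFace.1, G.card + 1 = baseFace.1.card →
        trace k (Finset.subset_univ G) ω = 0) →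
      ∃ η ∈ V, trace k (Finset.subset_univ baseFace.1) η
          = trace k (Finset.subset_univ baseFace.1) ω ∧
        ∀ i : Fin 3, trace k (Finset.subset_univ (Finset.univ.erase i.succ)) η = 0) :
    TracesExtend V := by
  intro F ω hω hb
  have hpos := F.2.card_pos
  have hle := Finset.card_le_univ F.1
  rw [Fintype.card_fin] at hle
  have hcases : F.1.card = 1 ∨ F.1.card = 2 ∨ F.1.card = 3 ∨ F.1.card = 4 := by omega
  rcases hcases with h | h | h | h
  · refine ⟨0, V.zero_mem, ?_, fun G _ _ => map_zero _⟩
    rw [map_zero, trace_eq_zero_of_card_eq_one hk h]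
  · rw [h]
    exact h₁ F h ω hω
  -- The involution exchanging 0 and `i` carries an arbitrary triangle to the base triangle and the
  -- extension found there back again.
  · have key : ∀ F : Finset (Fin 4), F.card = 3 → ∃ i : Fin 4,
        ({1, 2, 3} : Finset (Fin 4)).map (Equiv.swap 0 i).toEmbedding = F := by decide
    obtain ⟨i, hi⟩ := key F.1 h
    set π := Equiv.swap (0 : Fin 4) i with hπ
    have e : F = π • baseFace := Subtype.ext hi.symm
    have e' : π • F = baseFace := by rw [e, ← mul_smul, Equiv.swap_mul_self, one_smul]
    have hππ : ∀ α, permRep 3 k π (permRep 3 k π α) = α := fun α => by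
      rw [← Module.End.mul_apply, ← map_mul, Equiv.swap_mul_self, map_one, Module.End.one_apply]
    have hmm : ∀ G : Finset (Fin 4), (G.map π.toEmbedding).map π.toEmbedding = G := fun G => by
      ext j
      simp [Finset.mem_map_equiv, hπ]
    obtain ⟨η, hη, hη1, hη2⟩ := h₂ (permRep 3 k π ω) (hV π ω hω) (fun G hG hcard => by
      have h3 := trace_permRep_eq_zero (F := G.map π.toEmbedding) π (hb _ ?_ ?_)
      · rw [hmm] at h3
        exact h3
      · rw [e, face_smul_val]
        exact Finset.map_subset_map.2 hG
      · rw [Finset.card_map, hcard, e, face_smul_card])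
    refine ⟨permRep 3 k π η, hV π η hη, ?_, fun G hG hGF => ?_⟩
    · rw [← sub_eq_zero, ← map_sub] at hη1 ⊢
      have h3 := trace_permRep_eq_zero π hη1
      rw [map_sub, hππ] at h3
      rw [show baseFace.1.map π.toEmbedding = F.1 from hi] at h3
      exact h3
    · have h4 : (G.1.map π.toEmbedding).card = 3 := by rw [Finset.card_map, hG, h]
      have h5 : trace k (Finset.subset_univ (G.1.map π.toEmbedding)) η = 0 := by
        rcases card_three_cases _ h4 with h5 | ⟨i, h5⟩
        · exfalso
          apply hGF
          apply Subtype.ext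
          rw [← hmm G.1, h5, hi]
        · rw [h5]
          exact hη2 i
      have h6 := trace_permRep_eq_zero π h5
      rw [hmm] at h6
      exact h6
  · refine ⟨ω, hω, rfl, fun G hG hGF => absurd (Subtype.ext ?_) hGF⟩
    rw [(Finset.card_eq_iff_eq_univ G.1).1 (by rw [hG, h, Fintype.card_fin]),
      (Finset.card_eq_iff_eq_univ F.1).1 (by rw [h, Fintype.card_fin])]

theorem mem_filtration_two_of_erase {ω : Form 3 k Finset.univ} (hω : ω ∈ V)
    (h : ∀ i : Fin 3, trace k (Finset.subset_univ (Finset.univ.erase i.succ)) ω = 0) :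
    ω ∈ filtration V 2 := by
  rw [mem_filtration]
  refine ⟨hω, fun F hF => ?_⟩
  have key : ∀ F : Finset (Fin 4), F.card = 2 → ∃ i : Fin 3, F ⊆ Finset.univ.erase i.succ := by
    decide
  obtain ⟨i, hi⟩ := key F hF
  exact trace_eq_zero_mono hi (h i)

theorem mem_filtration_three {ω : Form 3 k Finset.univ} :
    ω ∈ filtration V 3 ↔ ω ∈ V ∧ trace k (Finset.subset_univ baseFace.1) ω = 0 ∧
      ∀ i : Fin 3, trace k (Finset.subset_univ (Finset.univ.erase i.succ)) ω = 0 := by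
  rw [mem_filtration]
  constructor
  · rintro ⟨h1, h2⟩
    exact ⟨h1, h2 _ (by decide), fun i => h2 _ (by simp)⟩
  · rintro ⟨h1, h2, h3⟩
    refine ⟨h1, fun F hF => ?_⟩
    rcases card_three_cases F hF with rfl | ⟨i, rfl⟩
    · exact h2
    · exact h3 i

/-- The trace on the forms associated with the triangle. -/
theorem Complements.trace_eq_baseTrace_add [FiniteDimensional ℝ V] {X L : Type*}
    [AddCommGroup X] [Module ℝ X] [FiniteDimensional ℝ X] [AddCommGroup L] [Module ℝ L]
    {C : Complements V} (hk : 1 ≤ k) (hC : C.IsInvariant) (hV : PermInvariant V)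
    (E : X →ₗ[ℝ] Form 3 k Finset.univ) (u : End ℝ X)
    (hu : ∀ x, E (u x) = permRep 3 k cyc (E x)) (hE₀ : ∀ x, E x ∈ V)
    (hE₁ : ∀ x, ∀ i : Fin 3, trace k (Finset.subset_univ (Finset.univ.erase i.succ)) (E x) = 0)
    (hE₂ : ∀ ω ∈ V, (∀ G ⊆ baseFace.1, G.card + 1 = baseFace.1.card →
        trace k (Finset.subset_univ G) ω = 0) →
      ∃ x, trace k (Finset.subset_univ baseFace.1) (E x)
        = trace k (Finset.subset_univ baseFace.1) ω)
    (j : L →ₗ[ℝ] X) (hj : Function.Injective j) (w : End ℝ L) (hw : ∀ x, j (w x) = u (j x))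
    (hj' : ∀ x, trace k (Finset.subset_univ baseFace.1) (E x) = 0 ↔ x ∈ LinearMap.range j) :
    LinearMap.trace ℝ X u = C.baseTrace hk hC hV + LinearMap.trace ℝ L w := by
  refine C.trace_eq_trace_block_add hk hC hV cyc_smul_baseFace E u hu
    (fun x => mem_filtration_two_of_erase (hE₀ x) (hE₁ x)) (fun x G hG hGF => ?_) hE₂ j hj w hw hj'
  rcases card_three_cases G.1 hG with h | ⟨i, h⟩
  · exact absurd (Subtype.ext h) hGF
  · rw [h]
    exact hE₁ x i

/-- The trace on the forms associated with the tetrahedron. -/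
theorem Complements.trace_eq_topTrace [FiniteDimensional ℝ V] {X : Type*}
    [AddCommGroup X] [Module ℝ X] [FiniteDimensional ℝ X]
    {C : Complements V} (hk : 1 ≤ k) (hC : C.IsInvariant) (hV : PermInvariant V)
    (E : X →ₗ[ℝ] Form 3 k Finset.univ) (u : End ℝ X)
    (hu : ∀ x, E (u x) = permRep 3 k cyc (E x)) (hE₀ : ∀ x, E x ∈ filtration V 3)
    (hE₂ : ∀ ω ∈ filtration V 3, ∃ x, E x = ω) (hE₃ : ∀ x, E x = 0 → x = 0) :
    LinearMap.trace ℝ X u = C.topTrace hk hC hV := by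
  have h := C.trace_eq_trace_block_add (L := PUnit.{1}) hk hC hV (smul_topFace cyc) E u hu
    hE₀ (fun x G hG hGF => ?_) (fun ω hω h => ?_) 0 (fun _ _ _ => rfl) 0 (fun _ => by simp)
    (fun x => ?_)
  · rw [h, map_zero, add_zero]
    rfl
  · exact absurd (Subtype.ext ((Finset.card_eq_iff_eq_univ _).1 (by rw [hG]; rfl))) hGF
  · obtain ⟨x, hx⟩ := hE₂ ω (mem_filtration.2 ⟨hω, fun F hF =>
      h F (Finset.subset_univ F) (by rw [hF]; rfl)⟩)
    exact ⟨x, by rw [hx]⟩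
  · constructor
    · intro h
      rw [hE₃ x h]
      exact Submodule.zero_mem _
    · rintro ⟨y, rfl⟩
      simp

end Three

/-! ### Cyclic shifts -/

section Shift

variable {Q M : Type*} [AddCommGroup Q] [Module ℝ Q] [AddCommGroup M] [Module ℝ M]

/-- The cyclic shift of triples, combined with an endomorphism. -/
def shift (R : End ℝ Q) : End ℝ (Fin 3 → Q) :=
  LinearMap.pi fun i => R.comp (LinearMap.proj (i - 1))

theorem shift_apply (R : End ℝ Q) (A : Fin 3 → Q) (i : Fin 3) :
    shift R A i = R (A (i - 1)) := rfl

/-- No index is fixed by the shift, so all diagonal blocks vanish, whatever `R` is. This is what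
makes the trace of the three-cycle vanish on spaces with three cyclically permuted coefficients. -/
theorem trace_shift [FiniteDimensional ℝ Q] (R : End ℝ Q) :
    LinearMap.trace ℝ (Fin 3 → Q) (shift R) = 0 := by
  classical
  set b := finBasis ℝ Q
  rw [LinearMap.trace_eq_matrix_trace ℝ (Pi.basis fun _ : Fin 3 => b), Matrix.trace]
  refine Finset.sum_eq_zero fun p _ => ?_
  obtain ⟨i, l⟩ := p
  rw [Matrix.diag_apply, LinearMap.toMatrix_apply, Pi.basis_repr, shift_apply, Pi.basis_apply,
    Pi.single_eq_of_ne ((by decide : ∀ i : Fin 3, i - 1 ≠ i) i), map_zero, map_zero]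
  rfl

/-- The sum of three linear maps on triples. -/
def tripleSum (G : Fin 3 → Q →ₗ[ℝ] M) : (Fin 3 → Q) →ₗ[ℝ] M :=
  ∑ i, (G i).comp (LinearMap.proj i)

theorem tripleSum_apply (G : Fin 3 → Q →ₗ[ℝ] M) (A : Fin 3 → Q) :
    tripleSum G A = ∑ i, G i (A i) := by
  simp [tripleSum]

theorem tripleSum_shift (G : Fin 3 → Q →ₗ[ℝ] M) (R : End ℝ Q) (f : End ℝ M)
    (h : ∀ i q, f (G i q) = G (i + 1) (R q)) (A : Fin 3 → Q) :
    tripleSum G (shift R A) = f (tripleSum G A) := by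
  rw [tripleSum_apply, tripleSum_apply, map_sum]
  simp only [h, shift_apply]
  rw [← Equiv.sum_comp (Equiv.addRight (1 : Fin 3))]
  simp

end Shift

/-! ### Homogeneous polynomials and their values on the simplex. -/

section Polynomials

variable {σ τ : Type*}

/-- The polynomials all of whose monomials have degree `r - j`; only zero if `r < j`. -/
def hom (σ : Type*) (r j : ℕ) : Submodule ℝ (MvPolynomial σ ℝ) :=
  restrictSupport ℝ {d | d.degree + j = r}

theorem mem_hom {r j : ℕ} {p : MvPolynomial σ ℝ} :
    p ∈ hom σ r j ↔ ∀ d, coeff d p ≠ 0 → d.degree + j = r := by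
  rw [hom, mem_restrictSupport_iff]
  exact ⟨fun h d hd => h (mem_support_iff.2 hd), fun h d hd => h d (mem_support_iff.1 hd)⟩

theorem finite_degree_eq [Finite σ] (r j : ℕ) : {d : σ →₀ ℕ | d.degree + j = r}.Finite := by
  classical
  have := Fintype.ofFinite σ
  refine (Finset.finite_toSet (Finset.finsuppAntidiag Finset.univ (r - j))).subset fun d hd => ?_
  have hd' : d.degree + j = r := hd
  rw [Finset.mem_coe, Finset.mem_finsuppAntidiag]
  refine ⟨?_, fun _ _ => Finset.mem_univ _⟩
  rw [← Finsupp.degree_eq_sum]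
  omega

instance [Finite σ] (r j : ℕ) : FiniteDimensional ℝ (hom σ r j) := by
  have := (finite_degree_eq (σ := σ) r j).to_subtype
  exact Module.Finite.of_basis (basisRestrictSupport ℝ _)

/-- Recording the degree as `r - j` through the equation `degree + j = r` avoids truncated
subtraction: the equivalence also holds when `r ≤ j`, with only zero on the right. -/
theorem X_mul_mem_hom_iff {r j : ℕ} {i : σ} {p : MvPolynomial σ ℝ} :
    X i * p ∈ hom σ r j ↔ p ∈ hom σ r (j + 1) := by
  classical
  rw [mem_hom, mem_hom]
  constructor
  · intro h d hd
    have h1 := h (Finsupp.single i 1 + d) (by rwa [coeff_X_mul])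
    rw [map_add, Finsupp.degree_single] at h1
    omega
  · intro h d hd
    rw [coeff_X_mul'] at hd
    split_ifs at hd with hi
    · have h1 := h _ hd
      have h2 : Finsupp.single i 1 + (d - Finsupp.single i 1) = d := by
        refine add_tsub_cancel_of_le (Finsupp.single_le_iff.2 ?_)
        exact Nat.one_le_iff_ne_zero.2 (Finsupp.mem_support_iff.1 hi)
      have h3 := congrArg Finsupp.degree h2
      rw [map_add, Finsupp.degree_single] at h3
      omega
    · exact absurd rfl hd

theorem X_mul_mem_hom {r j : ℕ} {p : MvPolynomial σ ℝ} (i : σ) (hp : p ∈ hom σ r (j + 1)) :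
    X i * p ∈ hom σ r j := X_mul_mem_hom_iff.2 hp

theorem rename_mem_hom {r j : ℕ} (f : σ → τ) {p : MvPolynomial σ ℝ} (hp : p ∈ hom σ r j) :
    rename f p ∈ hom τ r j := by
  rw [mem_hom] at hp ⊢
  intro d hd
  obtain ⟨u, rfl, hu⟩ := coeff_rename_ne_zero f p d hd
  rw [Finsupp.degree_mapDomain]
  exact hp u hu

theorem killCompl_mem_hom {r j : ℕ} {f : σ → τ} (hf : Function.Injective f)
    {p : MvPolynomial τ ℝ} (hp : p ∈ hom τ r j) : killCompl hf p ∈ hom σ r j := by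
  classical
  rw [mem_hom] at hp ⊢
  intro d hd
  have h1 : coeff (d.mapDomain f) (rename f (killCompl hf p)) ≠ 0 := by
    rwa [coeff_rename_mapDomain f hf]
  have h2 := support_rename_killCompl_subset hf (mem_support_iff.2 h1)
  have h3 := hp _ (mem_support_iff.1 h2)
  rwa [Finsupp.degree_mapDomain] at h3

/-- Renaming of variables on `hom σ r j`. -/
def homRename (r j : ℕ) (f : σ → τ) : hom σ r j →ₗ[ℝ] hom τ r j :=
  (rename f).toLinearMap.restrict fun _ hp => rename_mem_hom f hp

theorem homRename_coe {r j : ℕ} (f : σ → τ) (p : hom σ r j) :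
    (homRename r j f p : MvPolynomial τ ℝ) = rename f p := rfl

theorem eval_smul_of_mem_hom {r j : ℕ} [Fintype σ] {p : MvPolynomial σ ℝ} (hp : p ∈ hom σ r j)
    (t : ℝ) (x : σ → ℝ) : eval (t • x) p = t ^ (r - j) * eval x p := by
  rw [eval_eq', eval_eq', Finset.mul_sum]
  refine Finset.sum_congr rfl fun d hd => ?_
  have h1 := mem_hom.1 hp d (mem_support_iff.1 hd)
  have h2 : r - j = ∑ i, d i := by
    rw [← Finsupp.degree_eq_sum]
    omega
  simp only [Pi.smul_apply, smul_eq_mul, mul_pow, Finset.prod_mul_distrib]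
  rw [h2, Finset.prod_pow_eq_pow_sum]
  ring

theorem eq_zero_of_eval_pos [Fintype σ] {p : MvPolynomial σ ℝ}
    (h : ∀ x : σ → ℝ, (∀ i, 0 < x i) → eval x p = 0) : p = 0 := by
  refine funext_set (fun _ => Set.Ioi (0 : ℝ)) (fun _ => Set.Ioi_infinite 0) fun x hx => ?_
  rw [map_zero]
  exact h x fun i => hx i (Set.mem_univ i)

/-- A homogeneous polynomial that vanishes in the interior of the simplex is zero. -/
theorem eq_zero_of_eval [Fintype σ] [Nonempty σ] {r j : ℕ} {p : MvPolynomial σ ℝ}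
    (hp : p ∈ hom σ r j)
    (h : ∀ x : σ → ℝ, (∀ i, 0 < x i) → ∑ i, x i = 1 → eval x p = 0) : p = 0 := by
  refine eq_zero_of_eval_pos fun x hx => ?_
  have hs : 0 < ∑ i, x i := Finset.sum_pos (fun i _ => hx i) Finset.univ_nonempty
  have h1 := h ((∑ i, x i)⁻¹ • x) (fun i => by
    rw [Pi.smul_apply, smul_eq_mul]
    exact mul_pos (inv_pos.2 hs) (hx i)) (by
    simp only [Pi.smul_apply, smul_eq_mul]
    rw [← Finset.mul_sum, inv_mul_cancel₀ hs.ne'])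
  rw [eval_smul_of_mem_hom hp] at h1
  exact (mul_eq_zero.1 h1).resolve_left (pow_pos (inv_pos.2 hs) _).ne'

/-- Division by a variable with remainder. -/
theorem exists_eq_X_mul_add [DecidableEq σ] {r j : ℕ} (i : σ) {p : MvPolynomial σ ℝ}
    (hp : p ∈ hom σ r j) :
    ∃ q ∈ hom σ r (j + 1), ∃ s ∈ hom σ r j, p = X i * q + s ∧
      ∀ (x : σ → ℝ) (t : ℝ), eval (Function.update x i t) s = eval x s := by
  refine ⟨p.divMonomial (Finsupp.single i 1), ?_, p.modMonomial (Finsupp.single i 1), ?_,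
    (divMonomial_add_modMonomial_single p i).symm, fun x t => ?_⟩
  · rw [mem_hom] at hp ⊢
    intro d hd
    rw [coeff_divMonomial] at hd
    have h1 := hp _ hd
    rw [map_add, Finsupp.degree_single] at h1
    omega
  · rw [mem_hom] at hp ⊢
    intro d hd
    by_cases h : Finsupp.single i 1 ≤ d
    · exact absurd (coeff_modMonomial_of_le _ h) hd
    · rw [coeff_modMonomial_of_not_le _ h] at hd
      exact hp _ hd
  · rw [eval_eq, eval_eq]
    refine Finset.sum_congr rfl fun d hd => ?_
    congr 1
    refine Finset.prod_congr rfl fun l hl => ?_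
    rw [Function.update_of_ne]
    rintro rfl
    refine mem_support_iff.1 hd (coeff_modMonomial_of_le _ (Finsupp.single_le_iff.2 ?_))
    exact Nat.one_le_iff_ne_zero.2 (Finsupp.mem_support_iff.1 hl)

/-- A homogeneous polynomial that vanishes in the interior of a facet of the simplex is a multiple
of the corresponding variable. -/
theorem exists_eq_X_mul [Fintype σ] [Nontrivial σ] {r j : ℕ} (i : σ) {p : MvPolynomial σ ℝ}
    (hp : p ∈ hom σ r j)
    (h : ∀ x : σ → ℝ, x i = 0 → (∀ l, l ≠ i → 0 < x l) → ∑ i, x i = 1 → eval x p = 0) :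
    ∃ q ∈ hom σ r (j + 1), p = X i * q := by
  classical
  obtain ⟨q, hq, s, hs, hpqs, hsi⟩ := exists_eq_X_mul_add i hp
  refine ⟨q, hq, ?_⟩
  suffices s = 0 by rw [hpqs, this, add_zero]
  refine eq_zero_of_eval_pos fun x hx => ?_
  obtain ⟨l, hl⟩ := exists_ne i
  set y := Function.update x i 0 with hy
  have hy0 : y i = 0 := Function.update_self _ _ _
  have hypos : ∀ l, l ≠ i → 0 < y l := fun l hl => by
    rw [hy, Function.update_of_ne hl]
    exact hx l
  have hynn : ∀ l, 0 ≤ y l := fun l => by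
    by_cases hl : l = i
    · rw [hl, hy0]
    · exact (hypos l hl).le
  have hsum : 0 < ∑ i, y i :=
    Finset.sum_pos' (fun i _ => hynn i) ⟨l, Finset.mem_univ l, hypos l hl⟩
  have h1 := h ((∑ i, y i)⁻¹ • y) (by rw [Pi.smul_apply, hy0, smul_zero]) (fun l hl => by
    rw [Pi.smul_apply, smul_eq_mul]
    exact mul_pos (inv_pos.2 hsum) (hypos l hl)) (by
    simp only [Pi.smul_apply, smul_eq_mul]
    rw [← Finset.mul_sum, inv_mul_cancel₀ hsum.ne'])
  rw [eval_smul_of_mem_hom hp] at h1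
  have h2 := (mul_eq_zero.1 h1).resolve_left (pow_pos (inv_pos.2 hsum) _).ne'
  rw [hpqs, map_add, map_mul, eval_X, hy0, zero_mul, zero_add, hy, hsi] at h2
  exact h2

/-- A homogeneous polynomial that vanishes in the interiors of some facets of the simplex is a
multiple of the product of the corresponding variables. -/
theorem exists_eq_prod_X_mul [Fintype σ] [Nontrivial σ] [DecidableEq σ] {r : ℕ} (s : Finset σ) :
    ∀ {j : ℕ} {p : MvPolynomial σ ℝ}, p ∈ hom σ r j →
      (∀ i ∈ s, ∀ x : σ → ℝ, x i = 0 → (∀ l, l ≠ i → 0 < x l) → ∑ i, x i = 1 → eval x p = 0) →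
      ∃ q ∈ hom σ r (j + s.card), p = (∏ i ∈ s, X i) * q := by
  induction s using Finset.induction_on with
  | empty =>
    intro j p hp _
    exact ⟨p, hp, by simp⟩
  | insert i s hi ih =>
    intro j p hp h
    obtain ⟨q, hq, rfl⟩ := exists_eq_X_mul i hp (h i (Finset.mem_insert_self i s))
    obtain ⟨q', hq', rfl⟩ := ih hq fun l hl x h0 hx hs => by
      have h1 := h l (Finset.mem_insert_of_mem hl) x h0 hx hs
      rw [map_mul, eval_X] at h1
      exact (mul_eq_zero.1 h1).resolve_left (hx i (by rintro rfl; exact hi hl)).ne'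
    refine ⟨q', ?_, by rw [Finset.prod_insert hi, mul_assoc]⟩
    rwa [Finset.card_insert_of_notMem hi, add_comm s.card, ← add_assoc]

/-- On the simplex, polynomials can be made homogeneous. -/
theorem exists_mem_hom_eval_eq [Fintype σ] {r j : ℕ} {p : MvPolynomial σ ℝ}
    (hp : p ≠ 0 → p.totalDegree + j ≤ r) :
    ∃ q ∈ hom σ r j, ∀ x : σ → ℝ, ∑ i, x i = 1 → eval x q = eval x p := by
  by_cases h0 : p = 0
  · exact ⟨0, Submodule.zero_mem _, fun x _ => by rw [h0]⟩
  have hd := hp h0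
  -- The component of degree `d` is multiplied by a power of the sum of the variables, which equals
  -- one on the simplex.
  refine ⟨∑ d ∈ Finset.range (p.totalDegree + 1),
    homogeneousComponent d p * (∑ i, X i) ^ (r - j - d), Submodule.sum_mem _ fun d hd' => ?_,
    fun x hx => ?_⟩
  · have h1 : (homogeneousComponent d p * (∑ i, X i) ^ (r - j - d)).IsHomogeneous
        (d + 1 * (r - j - d)) := by
      refine (homogeneousComponent_isHomogeneous d p).mul (IsHomogeneous.pow ?_ _)
      exact IsHomogeneous.sum _ _ _ fun i _ => isHomogeneous_X _ i
    rw [mem_hom]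
    intro e he
    have h2 := h1 he
    have h3 := Finset.mem_range.1 hd'
    have h4 : e.degree = Finsupp.weight 1 e := by rw [Finsupp.degree_eq_weight_one]; rfl
    omega
  · conv_rhs => rw [← sum_homogeneousComponent p]
    simp only [map_sum, map_mul, map_pow, eval_X, hx, one_pow, mul_one]

/-- The basis of monomials. -/
def homBasis (σ : Type*) (r j : ℕ) : Basis {d : σ →₀ ℕ // d.degree + j = r} ℝ (hom σ r j) :=
  basisRestrictSupport ℝ _

theorem homBasis_coe {r j : ℕ} (d : {d : σ →₀ ℕ // d.degree + j = r}) :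
    (homBasis σ r j d : MvPolynomial σ ℝ) = monomial d.1 1 := by
  classical
  have h1 : monomial d.1 (1 : ℝ) ∈ hom σ r j :=
    (monomial_mem_restrictSupport ℝ).2 (Or.inl d.2)
  suffices homBasis σ r j d = ⟨monomial d.1 1, h1⟩ from congrArg Subtype.val this
  apply (homBasis σ r j).repr.injective
  rw [Basis.repr_self]
  ext e
  have h2 : (homBasis σ r j).repr ⟨monomial d.1 1, h1⟩ e = coeff e.1 (monomial d.1 (1 : ℝ)) := rfl
  rw [h2, coeff_monomial, Finsupp.single_apply]
  simp only [Subtype.ext_iff]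

open scoped Classical in
/-- The trace of the cyclic permutation of three variables. -/
theorem trace_homRename (r j : ℕ) :
    LinearMap.trace ℝ (hom (Fin 3) r j) (homRename r j (fun i : Fin 3 => i + 1))
      = if ∃ m : ℕ, r = 3 * m + j then 1 else 0 := by
  have hinj : Function.Injective (fun i : Fin 3 => i + 1) := add_left_injective 1
  have : Finite {d : Fin 3 →₀ ℕ // d.degree + j = r} :=
    (finite_degree_eq (σ := Fin 3) r j).to_subtype
  have := Fintype.ofFinite {d : Fin 3 →₀ ℕ // d.degree + j = r}
  let f : {d : Fin 3 →₀ ℕ // d.degree + j = r} → {d : Fin 3 →₀ ℕ // d.degree + j = r} :=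
    fun d => ⟨d.1.mapDomain (fun i => i + 1), by rw [Finsupp.degree_mapDomain, d.2]⟩
  have hf : ∀ d, f d = d ↔ ∀ i, d.1 (i + 1) = d.1 i := by
    intro d
    rw [Subtype.ext_iff]
    have h1 : ∀ i, (f d).1 (i + 1) = d.1 i := Finsupp.mapDomain_apply hinj d.1
    constructor
    · intro h i
      rw [← h1 i, h]
    · intro h
      ext i
      obtain ⟨l, rfl⟩ := (Finite.surjective_of_injective hinj) i
      rw [h1, h]
  -- A fixed exponent vector is constant, so its monomial is a power of the product of the
  -- variables.
  have hdeg : ∀ d, f d = d → d.1 1 = d.1 0 ∧ d.1 2 = d.1 0 ∧ 3 * d.1 0 + j = r := by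
    intro d hd
    have h1 : d.1 1 = d.1 0 := (hf d).1 hd 0
    have h2 : d.1 2 = d.1 1 := (hf d).1 hd 1
    have h3 := d.2
    rw [Finsupp.degree_eq_sum, Fin.sum_univ_three] at h3
    exact ⟨h1, h2.trans h1, by omega⟩
  rw [trace_of_permutes_basis (homBasis (Fin 3) r j) _ f (fun d => Subtype.ext (by
    rw [homRename_coe, homBasis_coe, homBasis_coe, rename_monomial]))]
  split_ifs with h
  · obtain ⟨m, hm⟩ := h
    have h1 : (Finsupp.equivFunOnFinite.symm fun _ : Fin 3 => m).degree + j = r := by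
      rw [Finsupp.degree_eq_sum, Fin.sum_univ_three]
      simp
      omega
    have h2 : (Finset.univ.filter fun d => f d = d)
        = {⟨Finsupp.equivFunOnFinite.symm fun _ : Fin 3 => m, h1⟩} := by
      ext d
      rw [Finset.mem_filter, Finset.mem_singleton]
      refine ⟨fun hd => ?_, fun hd => ⟨Finset.mem_univ _, ?_⟩⟩
      · obtain ⟨h1, h2, h3⟩ := hdeg _ hd.2
        apply Subtype.ext
        ext i
        fin_cases i <;> simp <;> omega
      · rw [hf, hd]
        intro i
        rfl
    rw [h2]
    simp
  · rw [Nat.cast_eq_zero, Finset.card_eq_zero, Finset.filter_eq_empty_iff]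
    intro d _ hd
    obtain ⟨-, -, h3⟩ := hdeg _ hd
    exact h ⟨d.1 0, h3.symm⟩

/-! ### Divisibility in three variables -/

variable {r j : ℕ}

theorem X_mul_left_cancel {i : σ} {p q : MvPolynomial σ ℝ} (h : X i * p = X i * q) : p = q :=
  mul_left_cancel₀ (X_ne_zero i) h

/-- Triples proportional to the triple of variables are multiples of it. -/
theorem exists_eq_X_mul_of_proportional {A : Fin 3 → MvPolynomial (Fin 3) ℝ}
    (hA : ∀ i, A i ∈ hom (Fin 3) r j) (h : ∀ i, X (i + 1) * A i = X i * A (i + 1)) :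
    ∃ s ∈ hom (Fin 3) r (j + 1), ∀ i, A i = X i * s := by
  obtain ⟨s, hs, h0⟩ := exists_eq_X_mul 0 (hA 0) (fun x h0 hx _ => by
    have h1 := congrArg (eval x) (h 0)
    simp only [map_mul, eval_X, h0, zero_mul] at h1
    exact (mul_eq_zero.1 h1).resolve_left (hx 1 (by decide)).ne')
  have h1 : A 1 = X 1 * s := by
    have h2 : X 1 * A 0 = X 0 * A 1 := h 0
    rw [h0] at h2
    apply X_mul_left_cancel (i := 0)
    rw [← h2]
    ring
  have h2 : A 2 = X 2 * s := by
    have h2 : X 2 * A 1 = X 1 * A 2 := h 1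
    rw [h1] at h2
    apply X_mul_left_cancel (i := 1)
    rw [← h2]
    ring
  refine ⟨s, hs, fun i => ?_⟩
  fin_cases i
  · exact h0
  · exact h1
  · exact h2

/-- Exactness of the Koszul complex in three variables. -/
theorem exists_eq_sub_of_sum_X_mul_eq_zero {D : Fin 3 → MvPolynomial (Fin 3) ℝ}
    (hD : ∀ i, D i ∈ hom (Fin 3) r j) (h : ∑ i, X i * D i = 0) :
    ∃ A : Fin 3 → MvPolynomial (Fin 3) ℝ, (∀ i, A i ∈ hom (Fin 3) r (j + 1)) ∧
      ∀ i, D (i + 2) = X (i + 1) * A i - X i * A (i + 1) := by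
  obtain ⟨a, ha, D₀, hD₀, e₀, h₀⟩ := exists_eq_X_mul_add 2 (hD 0)
  obtain ⟨b, hb, D₁, hD₁, e₁, h₁⟩ := exists_eq_X_mul_add 2 (hD 1)
  rw [Fin.sum_univ_three, e₀, e₁] at h
  -- The remainders do not involve the variable 2, so setting it to zero leaves the relation `X 0 *
  -- D₀ + X 1 * D₁ = 0`, which forces `D₀ = X 1 * c` and `D₁ = -X 0 * c`.
  have h2 : ∀ x : Fin 3 → ℝ, x 0 * eval x D₀ + x 1 * eval x D₁ = 0 := by
    intro x
    have h3 := congrArg (eval (Function.update x 2 0)) h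
    simpa [h₀, h₁] using h3
  obtain ⟨c, hc, e⟩ := exists_eq_X_mul 1 hD₀ (fun x h1 hx _ => by
    have h3 := h2 x
    rw [h1, zero_mul, add_zero] at h3
    exact (mul_eq_zero.1 h3).resolve_left (hx 0 (by decide)).ne')
  have e' : D₁ = -(X 0 * c) := by
    apply X_mul_left_cancel (i := 1)
    rw [← sub_eq_zero]
    refine eq_zero_of_eval_pos fun x _ => ?_
    have h3 := h2 x
    rw [e] at h3
    simp only [map_sub, map_mul, map_neg, eval_X] at h3 ⊢
    linarith
  have e₂ : D 2 = -(X 0 * a) - X 1 * b := by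
    apply X_mul_left_cancel (i := 2)
    rw [e, e'] at h
    linear_combination h
  refine ⟨![-b, a, -c], fun i => ?_, fun i => ?_⟩
  · fin_cases i
    · exact Submodule.neg_mem _ hb
    · exact ha
    · exact Submodule.neg_mem _ hc
  · fin_cases i
    · change D 2 = X 1 * -b - X 0 * a
      rw [e₂]
      ring
    · change D 0 = X 2 * a - X 1 * -c
      rw [e₀, e]
      ring
    · change D 1 = X 0 * -c - X 2 * -b
      rw [e₁, e']
      ring

/-- The map `killCompl` sets the variable 0 to zero and lowers the other indices, so it is
restriction to the hyperplane of the base triangle. -/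
theorem eval_killCompl_succ {n : ℕ} (p : MvPolynomial (Fin (n + 1)) ℝ) (x : Fin (n + 1) → ℝ)
    (hx : x 0 = 0) : eval (fun i : Fin n => x i.succ) (killCompl (Fin.succ_injective n) p)
      = eval x p := by
  suffices (aeval fun i : Fin n => x i.succ).comp (killCompl (Fin.succ_injective n))
      = (aeval x : MvPolynomial (Fin (n + 1)) ℝ →ₐ[ℝ] ℝ) from DFunLike.congr_fun this p
  ext i
  refine Fin.cases ?_ (fun i => ?_) i
  · rw [AlgHom.comp_apply, killCompl, aeval_X, dif_neg, map_zero, aeval_X, hx]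
    rintro ⟨j, hj⟩
    exact Fin.succ_ne_zero j hj
  · have h := killCompl_rename_app (Fin.succ_injective n) (X i : MvPolynomial (Fin n) ℝ)
    rw [rename_X] at h
    rw [AlgHom.comp_apply, h, aeval_X, aeval_X]

theorem eval_rename' {f : σ → τ} (x : τ → ℝ) (p : MvPolynomial σ ℝ) :
    eval x (rename f p) = eval (fun i => x (f i)) p := eval_rename f x p

/-- The operator `X_i ∂_i` preserves degrees. -/
theorem X_mul_pderiv_mem_hom (i : σ) {p : MvPolynomial σ ℝ} (hp : p ∈ hom σ r j) :
    X i * pderiv i p ∈ hom σ r j := by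
  classical
  rw [X_mul_mem_hom_iff, mem_hom]
  rw [mem_hom] at hp
  intro d hd
  rw [coeff_pderiv] at hd
  have h1 := hp _ (left_ne_zero_of_mul hd)
  rw [map_add, Finsupp.degree_single] at h1
  omega

theorem isHomogeneous_of_mem_hom {p : MvPolynomial σ ℝ} (hp : p ∈ hom σ r 0) :
    p.IsHomogeneous r := by
  intro d hd
  have h4 : d.degree = Finsupp.weight 1 d := by rw [Finsupp.degree_eq_weight_one]; rfl
  rw [← h4]
  exact mem_hom.1 hp d hd

theorem totalDegree_le_of_mem_hom {p : MvPolynomial σ ℝ} (hp : p ∈ hom σ r j) (h0 : p ≠ 0) :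
    p.totalDegree + j ≤ r := by
  obtain ⟨d, hd⟩ := ne_zero_iff.1 h0
  have h1 := mem_hom.1 hp d hd
  have h2 : p.totalDegree ≤ r - j := by
    refine Finset.sup_le fun e he => ?_
    have h3 := mem_hom.1 hp e (mem_support_iff.1 he)
    change e.degree ≤ r - j
    omega
  omega

end Polynomials

/-! ### Polynomial forms as sums of standard generators. -/

section Forms

variable {n k : ℕ}

/-- Evaluation of forms. -/
def evalForm (x : facePoints n Finset.univ) (v : Fin k → tangent n Finset.univ) :
    Form n k Finset.univ →ₗ[ℝ] ℝ where
  toFun ω := ω x v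
  map_add' _ _ := rfl
  map_smul' _ _ := rfl

theorem sum_form_apply {ι : Type*} (s : Finset ι) (ω : ι → Form n k Finset.univ)
    (x : facePoints n Finset.univ) (v : Fin k → tangent n Finset.univ) :
    (∑ i ∈ s, ω i) x v = ∑ i ∈ s, ω i x v := map_sum (evalForm x v) ω s

/-- The form `dλ_{I 0} ∧ ⋯ ∧ dλ_{I (k-1)}`. -/
def dl (I : Fin k → Fin (n + 1)) : (Fin (n + 1) → ℝ) [⋀^Fin k]→ₗ[ℝ] ℝ :=
  Matrix.detRowAlternating.compLinearMap (LinearMap.funLeft ℝ ℝ I)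

theorem dl_apply (I : Fin k → Fin (n + 1)) (v : Fin k → Fin (n + 1) → ℝ) :
    dl I v = Matrix.det (Matrix.of fun a b => v a (I b)) := rfl

/-- The form `p dλ_{I 0} ∧ ⋯ ∧ dλ_{I (k-1)}` on `T^n`. -/
def mono (I : Fin k → Fin (n + 1)) :
    MvPolynomial (Fin (n + 1)) ℝ →ₗ[ℝ] Form n k Finset.univ where
  toFun p x := eval x.1 p • (dl I).compLinearMap (tangent n Finset.univ).subtype
  map_add' p q := by
    funext x
    simp [add_smul]
  map_smul' c p := by
    funext x
    simp [mul_smul]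

/-- The form `p i_X (dλ_{J 0} ∧ ⋯ ∧ dλ_{J k})` on `T^n`. -/
def monoX (J : Fin (k + 1) → Fin (n + 1)) :
    MvPolynomial (Fin (n + 1)) ℝ →ₗ[ℝ] Form n k Finset.univ where
  toFun p x := eval x.1 p • ((dl J).curryLeft x.1).compLinearMap (tangent n Finset.univ).subtype
  map_add' p q := by
    funext x
    simp [add_smul]
  map_smul' c p := by
    funext x
    simp [mul_smul]

theorem mono_apply (I : Fin k → Fin (n + 1)) (p : MvPolynomial (Fin (n + 1)) ℝ)
    (x : facePoints n Finset.univ) (v : Fin k → tangent n Finset.univ) :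
    mono I p x v = eval x.1 p * dl I (fun a => (v a).1) := rfl

theorem monoX_apply (J : Fin (k + 1) → Fin (n + 1)) (p : MvPolynomial (Fin (n + 1)) ℝ)
    (x : facePoints n Finset.univ) (v : Fin k → tangent n Finset.univ) :
    monoX J p x v = eval x.1 p * dl J (Matrix.vecCons x.1 fun a => (v a).1) := rfl

theorem dl_comp_perm (I : Fin k → Fin (n + 1)) (π : Equiv.Perm (Fin (n + 1)))
    (v : Fin k → Fin (n + 1) → ℝ) : dl I (fun a => v a ∘ π) = dl (π ∘ I) v := rfl

theorem permRep_mono (π : Equiv.Perm (Fin (n + 1))) (I : Fin k → Fin (n + 1))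
    (p : MvPolynomial (Fin (n + 1)) ℝ) :
    permRep n k π (mono I p) = mono (π ∘ I) (rename π p) := by
  funext x
  ext v
  rw [mono_apply, eval_rename]
  rfl

theorem permRep_monoX (π : Equiv.Perm (Fin (n + 1))) (J : Fin (k + 1) → Fin (n + 1))
    (p : MvPolynomial (Fin (n + 1)) ℝ) :
    permRep n k π (monoX J p) = monoX (π ∘ J) (rename π p) := by
  funext x
  ext v
  rw [monoX_apply, eval_rename, ← dl_comp_perm]
  have h : (fun a => (Matrix.vecCons x.1 fun a => (v a).1 : Fin (k + 1) → Fin (n + 1) → ℝ) a ∘ π)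
      = Matrix.vecCons (x.1 ∘ π) fun a => (v a).1 ∘ π := by
    funext a
    refine Fin.cases ?_ (fun a => ?_) a <;> rfl
  rw [h]
  rfl

/-- The expansion of an alternating form. -/
theorem sum_mul_dl (β : (Fin (n + 1) → ℝ) [⋀^Fin k]→ₗ[ℝ] ℝ) (v : Fin k → Fin (n + 1) → ℝ) :
    ∑ I : Fin k → Fin (n + 1), β (fun j => Pi.single (I j) 1) * dl I v = k.factorial * β v := by
  have h1 : ∀ w : Fin k → Fin (n + 1) → ℝ,
      β w = ∑ I : Fin k → Fin (n + 1), (∏ a, w a (I a)) * β (fun j => Pi.single (I j) 1) := by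
    intro w
    have e : w = fun a => ∑ i, w a i • (Pi.single i 1 : Fin (n + 1) → ℝ) := by
      funext a
      conv_lhs => rw [pi_eq_sum_univ' (w a)]
    conv_lhs => rw [e]
    have h2 := β.toMultilinearMap.map_sum (fun a i => w a i • (Pi.single i 1 : Fin (n + 1) → ℝ))
    have h3 := fun I : Fin k → Fin (n + 1) => β.toMultilinearMap.map_smul_univ
      (fun a => w a (I a)) (fun a => (Pi.single (I a) 1 : Fin (n + 1) → ℝ))
    simp only [h3, smul_eq_mul] at h2
    exact h2
  have h2 : ∀ I : Fin k → Fin (n + 1), β (fun j => Pi.single (I j) 1) * dl I v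
      = ∑ σ : Equiv.Perm (Fin k), (Equiv.Perm.sign σ : ℝ) *
        ((∏ a, v (σ a) (I a)) * β (fun j => Pi.single (I j) 1)) := by
    intro I
    rw [dl_apply, Matrix.det_apply', Finset.mul_sum]
    refine Finset.sum_congr rfl fun σ _ => ?_
    simp only [Matrix.of_apply]
    ring
  simp only [h2]
  rw [Finset.sum_comm]
  -- The sign from the determinant cancels the one from permuting the arguments of `β`, so each of
  -- the `k!` permutations contributes `β v`.
  have h3 : ∀ σ : Equiv.Perm (Fin k), ∑ I : Fin k → Fin (n + 1), (Equiv.Perm.sign σ : ℝ) *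
        ((∏ a, v (σ a) (I a)) * β (fun j => Pi.single (I j) 1)) = β v := by
    intro σ
    rw [← Finset.mul_sum, ← h1 (fun a => v (σ a))]
    have h4 := β.map_perm v σ
    have h5 : (fun a => v (σ a)) = v ∘ σ := rfl
    rw [h5, h4, Units.smul_def, zsmul_eq_mul, ← mul_assoc, ← Int.cast_mul]
    rw [show ((Equiv.Perm.sign σ : ℤˣ) : ℤ) * (Equiv.Perm.sign σ : ℤˣ) = 1 from
      Int.units_coe_mul_self _, Int.cast_one, one_mul]
  simp only [h3]
  rw [Finset.sum_const, Finset.card_univ, Fintype.card_perm, Fintype.card_fin, nsmul_eq_mul]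

theorem sum_mono_eq (α : AmbientForm n k) (q : (Fin k → Fin (n + 1)) → MvPolynomial _ ℝ)
    (hq : ∀ I, ∀ x, ∑ i, x i = 1 → eval x (q I) = α x (fun j => Pi.single (I j) 1)) :
    restrict n k α = (k.factorial : ℝ)⁻¹ • ∑ I, mono I (q I) := by
  rw [eq_inv_smul_iff₀ (by exact_mod_cast k.factorial_ne_zero)]
  funext x
  ext v
  have h := sum_mul_dl (α x.1) (fun a => (v a).1)
  rw [sum_form_apply]
  simp only [mono_apply, hq _ x.1 x.2.2.1, h]
  rfl

theorem sum_monoX_eq (α : AmbientForm n (k + 1))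
    (q : (Fin (k + 1) → Fin (n + 1)) → MvPolynomial _ ℝ)
    (hq : ∀ I, ∀ x, ∑ i, x i = 1 → eval x (q I) = α x (fun j => Pi.single (I j) 1)) :
    restrict n k (contractX n k α) = ((k + 1).factorial : ℝ)⁻¹ • ∑ I, monoX I (q I) := by
  rw [eq_inv_smul_iff₀ (by exact_mod_cast (k + 1).factorial_ne_zero)]
  funext x
  ext v
  have h := sum_mul_dl (α x.1) (Matrix.vecCons x.1 fun a => (v a).1)
  rw [sum_form_apply]
  simp only [monoX_apply, hq _ x.1 x.2.2.1, h]
  rfl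

theorem eval_smul_dl_mem_ambientPoly {r : ℕ} {s : ℤ} {j : ℕ} (hs : s + j = r)
    (I : Fin k → Fin (n + 1)) {p : MvPolynomial (Fin (n + 1)) ℝ} (hp : p ∈ hom _ r j) :
    (fun x => eval x p • dl I) ∈ ambientPoly n s k := by
  intro J
  refine ⟨dl I (fun j => Pi.single (J j) 1) • p, fun h => ?_, fun x => ?_⟩
  · have h1 := totalDegree_le_of_mem_hom (Submodule.smul_mem _ _ hp) h
    omega
  · rw [AlternatingMap.smul_apply, MvPolynomial.smul_eval, smul_eq_mul, mul_comm]

/-- On the simplex each coefficient of degree at most `r` can be replaced by a homogeneous one of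
degree exactly `r`. Summing over all index tuples instead of increasing ones costs the invertible
factor `k!`. -/
theorem polyForms_eq_iSup (n r k : ℕ) : polyForms n r k
    = ⨆ I : Fin k → Fin (n + 1), (hom (Fin (n + 1)) r 0).map (mono I) := by
  apply le_antisymm
  · rintro _ ⟨α, hα, rfl⟩
    have h : ∀ I : Fin k → Fin (n + 1), ∃ q ∈ hom (Fin (n + 1)) r 0, ∀ x, ∑ i, x i = 1 →
        eval x q = α x (fun j => Pi.single (I j) 1) := by
      intro I
      obtain ⟨p, hp, hp'⟩ := hα I
      obtain ⟨q, hq, hq'⟩ := exists_mem_hom_eval_eq (r := r) (j := 0)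
        (fun h => by have := hp h; omega)
      exact ⟨q, hq, fun x hx => by rw [hq' x hx, hp']⟩
    choose q hq hq' using h
    rw [sum_mono_eq α q hq']
    exact Submodule.smul_mem _ _ (Submodule.sum_mem _ fun I _ =>
      Submodule.mem_iSup_of_mem I (Submodule.mem_map_of_mem (hq I)))
  · refine iSup_le fun I => ?_
    rintro _ ⟨p, hp, rfl⟩
    exact ⟨_, eval_smul_dl_mem_ambientPoly (by simp) I hp, rfl⟩

theorem polyMinusForms_eq_iSup (n r k : ℕ) : polyMinusForms n r k
    = ⨆ J : Fin (k + 1) → Fin (n + 1), (hom (Fin (n + 1)) r 1).map (monoX J) := by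
  apply le_antisymm
  · rintro _ ⟨_, ⟨α, hα, rfl⟩, rfl⟩
    have h : ∀ I : Fin (k + 1) → Fin (n + 1), ∃ q ∈ hom (Fin (n + 1)) r 1, ∀ x, ∑ i, x i = 1 →
        eval x q = α x (fun j => Pi.single (I j) 1) := by
      intro I
      obtain ⟨p, hp, hp'⟩ := hα I
      obtain ⟨q, hq, hq'⟩ := exists_mem_hom_eval_eq (r := r) (j := 1)
        (fun h => by have := hp h; omega)
      exact ⟨q, hq, fun x hx => by rw [hq' x hx, hp']⟩
    choose q hq hq' using h
    rw [sum_monoX_eq α q hq']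
    exact Submodule.smul_mem _ _ (Submodule.sum_mem _ fun I _ =>
      Submodule.mem_iSup_of_mem I (Submodule.mem_map_of_mem (hq I)))
  · refine iSup_le fun I => ?_
    rintro _ ⟨p, hp, rfl⟩
    exact ⟨_, ⟨_, eval_smul_dl_mem_ambientPoly (by simp) I hp, rfl⟩, rfl⟩

variable {r : ℕ}

theorem mono_mem_polyForms (I : Fin k → Fin (n + 1)) {p : MvPolynomial (Fin (n + 1)) ℝ}
    (hp : p ∈ hom _ r 0) : mono I p ∈ polyForms n r k := by
  rw [polyForms_eq_iSup]
  exact Submodule.mem_iSup_of_mem I (Submodule.mem_map_of_mem hp)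

theorem monoX_mem_polyMinusForms (J : Fin (k + 1) → Fin (n + 1))
    {p : MvPolynomial (Fin (n + 1)) ℝ} (hp : p ∈ hom _ r 1) :
    monoX J p ∈ polyMinusForms n r k := by
  rw [polyMinusForms_eq_iSup]
  exact Submodule.mem_iSup_of_mem J (Submodule.mem_map_of_mem hp)

theorem polyForms_le {N : Submodule ℝ (Form n k Finset.univ)}
    (h : ∀ I, ∀ p ∈ hom (Fin (n + 1)) r 0, mono I p ∈ N) : polyForms n r k ≤ N := by
  rw [polyForms_eq_iSup]
  refine iSup_le fun I => ?_
  rintro _ ⟨p, hp, rfl⟩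
  exact h I p hp

theorem polyMinusForms_le {N : Submodule ℝ (Form n k Finset.univ)}
    (h : ∀ J, ∀ p ∈ hom (Fin (n + 1)) r 1, monoX J p ∈ N) : polyMinusForms n r k ≤ N := by
  rw [polyMinusForms_eq_iSup]
  refine iSup_le fun I => ?_
  rintro _ ⟨p, hp, rfl⟩
  exact h I p hp

theorem permInvariant_polyForms : PermInvariant (polyForms n r k) := by
  intro π ω hω
  have h : polyForms n r k ≤ (polyForms n r k).comap (permRep n k π) := polyForms_le
    fun I p hp => by
      rw [Submodule.mem_comap, permRep_mono]
      exact mono_mem_polyForms _ (rename_mem_hom _ hp)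
  exact h hω

theorem permInvariant_polyMinusForms : PermInvariant (polyMinusForms n r k) := by
  intro π ω hω
  have h : polyMinusForms n r k ≤ (polyMinusForms n r k).comap (permRep n k π) :=
    polyMinusForms_le fun I p hp => by
      rw [Submodule.mem_comap, permRep_monoX]
      exact monoX_mem_polyMinusForms _ (rename_mem_hom _ hp)
  exact h hω

instance finiteDimensional_polyForms : FiniteDimensional ℝ (polyForms n r k) := by
  rw [polyForms_eq_iSup]
  infer_instance

instance finiteDimensional_polyMinusForms :
    FiniteDimensional ℝ (polyMinusForms n r k) := by
  rw [polyMinusForms_eq_iSup]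
  infer_instance

end Forms

/-! ### Forms of low degree in dimension three -/

section Formulas

variable {n : ℕ}

theorem mono_one_apply (i : Fin (n + 1)) (p : MvPolynomial (Fin (n + 1)) ℝ)
    (x : facePoints n Finset.univ) (v : Fin 1 → tangent n Finset.univ) :
    mono ![i] p x v = eval x.1 p * (v 0).1 i := by
  rw [mono_apply, dl_apply, Matrix.det_fin_one]
  rfl

theorem mono_two_apply (i j : Fin (n + 1)) (p : MvPolynomial (Fin (n + 1)) ℝ)
    (x : facePoints n Finset.univ) (v : Fin 2 → tangent n Finset.univ) :
    mono ![i, j] p x v = eval x.1 p * ((v 0).1 i * (v 1).1 j - (v 0).1 j * (v 1).1 i) := by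
  rw [mono_apply, dl_apply, Matrix.det_fin_two]
  rfl

theorem monoX_one_apply (i j : Fin (n + 1)) (p : MvPolynomial (Fin (n + 1)) ℝ)
    (x : facePoints n Finset.univ) (v : Fin 1 → tangent n Finset.univ) :
    monoX ![i, j] p x v = eval x.1 p * (x.1 i * (v 0).1 j - x.1 j * (v 0).1 i) := by
  rw [monoX_apply, dl_apply, Matrix.det_fin_two]
  rfl

theorem monoX_two_apply (i j l : Fin (n + 1)) (p : MvPolynomial (Fin (n + 1)) ℝ)
    (x : facePoints n Finset.univ) (v : Fin 2 → tangent n Finset.univ) :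
    monoX ![i, j, l] p x v = eval x.1 p *
      (x.1 i * ((v 0).1 j * (v 1).1 l - (v 0).1 l * (v 1).1 j)
        + x.1 j * ((v 0).1 l * (v 1).1 i - (v 0).1 i * (v 1).1 l)
        + x.1 l * ((v 0).1 i * (v 1).1 j - (v 0).1 j * (v 1).1 i)) := by
  rw [monoX_apply, dl_apply, Matrix.det_fin_three]
  congr 1
  simp only [Matrix.of_apply, Matrix.cons_val]
  ring

theorem trace_eq_zero_iff' {k : ℕ} {F : Finset (Fin (n + 1))} {ω : Form n k Finset.univ} :
    trace k (Finset.subset_univ F) ω = 0 ↔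
      ∀ x : facePoints n Finset.univ, (∀ i ∉ F, x.1 i = 0) →
        ∀ v : Fin k → tangent n Finset.univ, (∀ j, ∀ i ∉ F, (v j).1 i = 0) → ω x v = 0 := by
  rw [trace_eq_zero_iff]
  exact ⟨fun h x hx v hv => h x.1 ⟨x.2.1, x.2.2.1, hx⟩ (fun j => (v j).1)
      (fun j => ⟨(v j).2.1, hv j⟩),
    fun h x hx v hv => h ⟨x, _⟩ hx.2.2 (fun j => ⟨v j, _⟩) (fun j => (hv j).2)⟩

theorem trace_erase_eq_zero_iff {k : ℕ} {i : Fin (n + 1)} {ω : Form n k Finset.univ} :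
    trace k (Finset.subset_univ (Finset.univ.erase i)) ω = 0 ↔
      ∀ x : facePoints n Finset.univ, x.1 i = 0 →
        ∀ v : Fin k → tangent n Finset.univ, (∀ j, (v j).1 i = 0) → ω x v = 0 := by
  rw [trace_eq_zero_iff']
  simp

theorem baseFace_val : baseFace.1 = Finset.univ.erase 0 := by decide

theorem trace_baseFace_eq_zero_iff {k : ℕ} {ω : Form 3 k Finset.univ} :
    trace k (Finset.subset_univ baseFace.1) ω = 0 ↔
      ∀ x : facePoints 3 Finset.univ, x.1 0 = 0 →
        ∀ v : Fin k → tangent 3 Finset.univ, (∀ j, (v j).1 0 = 0) → ω x v = 0 := by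
  rw [trace_eq_zero_iff']
  simp [baseFace_val]

/-- Vanishing of the traces on the edges of the triangle. -/
theorem apply_eq_zero_of_trace_edges {k : ℕ} {ω : Form 3 k Finset.univ}
    (h : ∀ G ⊆ baseFace.1, G.card + 1 = baseFace.1.card → trace k (Finset.subset_univ G) ω = 0)
    (i : Fin 3) (x : facePoints 3 Finset.univ) (hx₀ : x.1 0 = 0) (hx : x.1 i.succ = 0)
    (v : Fin k → tangent 3 Finset.univ) (hv₀ : ∀ j, (v j).1 0 = 0)
    (hv : ∀ j, (v j).1 i.succ = 0) : ω x v = 0 := by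
  have h1 := h (baseFace.1.erase i.succ) (Finset.erase_subset _ _)
    (Finset.card_erase_add_one (by rw [baseFace_val]; simp [Fin.succ_ne_zero]))
  rw [trace_eq_zero_iff'] at h1
  have key : ∀ l ∉ baseFace.1.erase i.succ, l = 0 ∨ l = i.succ := by
    intro l hl
    by_contra! hl'
    exact hl (Finset.mem_erase.2 ⟨hl'.2, by rw [baseFace_val]; simp [hl'.1]⟩)
  refine h1 x (fun l hl => ?_) v (fun j l hl => ?_)
  · rcases key l hl with rfl | rfl
    · exact hx₀
    · exact hx
  · rcases key l hl with rfl | rfl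
    · exact hv₀ j
    · exact hv j

/-- A point of the triangle. -/
def basePoint (y : Fin 3 → ℝ) (hy : ∀ i, 0 ≤ y i) (hs : ∑ i, y i = 1) :
    facePoints 3 Finset.univ :=
  ⟨Fin.cons 0 y, fun i => by refine Fin.cases ?_ (fun i => ?_) i <;> simp [hy],
    by rw [Fin.sum_univ_succ]; simpa using hs, by simp⟩

theorem basePoint_zero {y : Fin 3 → ℝ} (hy : ∀ i, 0 ≤ y i) (hs : ∑ i, y i = 1) :
    (basePoint y hy hs).1 0 = 0 := rfl

theorem basePoint_succ {y : Fin 3 → ℝ} (hy : ∀ i, 0 ≤ y i) (hs : ∑ i, y i = 1) (i : Fin 3) :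
    (basePoint y hy hs).1 i.succ = y i := rfl

theorem eval_basePoint {y : Fin 3 → ℝ} (hy : ∀ i, 0 ≤ y i) (hs : ∑ i, y i = 1)
    (p : MvPolynomial (Fin 4) ℝ) :
    eval (basePoint y hy hs).1 p = eval y (killCompl (Fin.succ_injective 3) p) :=
  (eval_killCompl_succ p _ (basePoint_zero hy hs)).symm

theorem eval_basePoint_rename {y : Fin 3 → ℝ} (hy : ∀ i, 0 ≤ y i) (hs : ∑ i, y i = 1)
    (p : MvPolynomial (Fin 3) ℝ) :
    eval (basePoint y hy hs).1 (rename Fin.succ p) = eval y p :=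
  eval_rename _ _ _

/-- The tangent vector `e_i - e_j`. -/
def edgeVector (i j : Fin (n + 1)) : tangent n Finset.univ :=
  ⟨Pi.single i 1 - Pi.single j 1, by
    simp [Finset.sum_sub_distrib], by simp⟩

theorem edgeVector_apply (i j l : Fin (n + 1)) : (edgeVector i j).1 l
    = (if l = i then 1 else 0) - (if l = j then 1 else 0) := by
  simp [edgeVector, Pi.single_apply]

/-- The tangent vector `e_i - x`. -/
def radialVector (x : facePoints n Finset.univ) (i : Fin (n + 1)) : tangent n Finset.univ :=
  ⟨Pi.single i 1 - x.1, by
    simp [Finset.sum_sub_distrib, x.2.2.1], by simp⟩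

theorem radialVector_apply (x : facePoints n Finset.univ) (i l : Fin (n + 1)) :
    (radialVector x i).1 l = (if l = i then 1 else 0) - x.1 l := by
  simp [radialVector, Pi.single_apply]

theorem tangent_zero (v : tangent 3 Finset.univ) : v.1 0 = -(v.1 1 + v.1 2 + v.1 3) := by
  have h := v.2.1
  rw [Fin.sum_univ_four] at h
  linarith

theorem cyc_succ (i : Fin 3) : cyc i.succ = (i + 1).succ := by
  revert i
  decide

theorem rename_cyc_rename_succ (p : MvPolynomial (Fin 3) ℝ) :
    rename cyc (rename Fin.succ p) = rename Fin.succ (rename (fun i => i + 1) p) := by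
  rw [rename_rename, rename_rename]
  congr 2
  funext i
  exact cyc_succ i

variable {k r j : ℕ}

/-- Equivariance under the three-cycle is checked separately on the index tuples and on the
coefficients. -/
theorem tripleSum_mono_shift {Q : Type*} [AddCommGroup Q] [Module ℝ Q] {R : End ℝ Q}
    {K : Fin 3 → Fin k → Fin 4} (hK : ∀ i, cyc ∘ K i = K (i + 1))
    {m : Fin 3 → Q →ₗ[ℝ] MvPolynomial (Fin 4) ℝ}
    (hm : ∀ i q, rename cyc (m i q) = m (i + 1) (R q)) (A : Fin 3 → Q) :
    tripleSum (fun i => (mono (K i)).comp (m i)) (shift R A)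
      = permRep 3 k cyc (tripleSum (fun i => (mono (K i)).comp (m i)) A) :=
  tripleSum_shift _ _ _ (fun i q => by
    rw [LinearMap.comp_apply, permRep_mono, hK, hm, LinearMap.comp_apply]) A

theorem tripleSum_monoX_shift {Q : Type*} [AddCommGroup Q] [Module ℝ Q] {R : End ℝ Q}
    {K : Fin 3 → Fin (k + 1) → Fin 4} (hK : ∀ i, cyc ∘ K i = K (i + 1))
    {m : Fin 3 → Q →ₗ[ℝ] MvPolynomial (Fin 4) ℝ}
    (hm : ∀ i q, rename cyc (m i q) = m (i + 1) (R q)) (A : Fin 3 → Q) :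
    tripleSum (fun i => (monoX (K i)).comp (m i)) (shift R A)
      = permRep 3 k cyc (tripleSum (fun i => (monoX (K i)).comp (m i)) A) :=
  tripleSum_shift _ _ _ (fun i q => by
    rw [LinearMap.comp_apply, permRep_monoX, hK, hm, LinearMap.comp_apply]) A

/-- Multiplication by a polynomial on `hom (Fin 4) r j`. -/
def mulHom (r j : ℕ) (f : MvPolynomial (Fin 4) ℝ) :
    hom (Fin 4) r j →ₗ[ℝ] MvPolynomial (Fin 4) ℝ :=
  (LinearMap.mulLeft ℝ f).comp (hom (Fin 4) r j).subtype

theorem mulHom_apply (f : MvPolynomial (Fin 4) ℝ) (q : hom (Fin 4) r j) :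
    mulHom r j f q = f * q.1 := rfl

/-- Inclusion of `hom (Fin 3) r j` into polynomials of four variables, followed by multiplication
by a polynomial. -/
def mulBase (r j : ℕ) (f : MvPolynomial (Fin 4) ℝ) :
    hom (Fin 3) r j →ₗ[ℝ] MvPolynomial (Fin 4) ℝ :=
  (LinearMap.mulLeft ℝ f).comp ((rename Fin.succ).toLinearMap.comp (hom (Fin 3) r j).subtype)

theorem mulBase_apply (f : MvPolynomial (Fin 4) ℝ) (q : hom (Fin 3) r j) :
    mulBase r j f q = f * rename Fin.succ q.1 := rfl

theorem rename_mulHom {f g : MvPolynomial (Fin 4) ℝ} (h : rename cyc f = g) (q : hom (Fin 4) r j) :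
    rename cyc (mulHom r j f q) = mulHom r j g (homRename r j cyc q) := by
  rw [mulHom_apply, map_mul, h]
  rfl

theorem rename_mulBase {f g : MvPolynomial (Fin 4) ℝ} (h : rename cyc f = g)
    (q : hom (Fin 3) r j) :
    rename cyc (mulBase r j f q) = mulBase r j g (homRename r j (fun i : Fin 3 => i + 1) q) := by
  rw [mulBase_apply, map_mul, h, rename_cyc_rename_succ]
  rfl

/-- Multiplication of `hom (Fin 3) r (j + 1)` by the variables. -/
def mulX (r j : ℕ) : hom (Fin 3) r (j + 1) →ₗ[ℝ] Fin 3 → hom (Fin 3) r j :=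
  LinearMap.pi fun i => ((LinearMap.mulLeft ℝ (X i)).restrict fun _ h => X_mul_mem_hom i h)

theorem mulX_apply (s : hom (Fin 3) r (j + 1)) (i : Fin 3) :
    (mulX r j s i : MvPolynomial (Fin 3) ℝ) = X i * s.1 := rfl

theorem mulX_injective : Function.Injective (mulX r j) := by
  intro s t h
  have h1 := congrArg Subtype.val (congrFun h 0)
  rw [mulX_apply, mulX_apply] at h1
  exact Subtype.ext (X_mul_left_cancel h1)

theorem mulX_homRename (s : hom (Fin 3) r (j + 1)) :
    mulX r j (homRename r (j + 1) (fun i : Fin 3 => i + 1) s)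
      = shift (homRename r j (fun i : Fin 3 => i + 1)) (mulX r j s) := by
  funext i
  apply Subtype.ext
  rw [mulX_apply, shift_apply, homRename_coe, homRename_coe, mulX_apply, map_mul, rename_X,
    sub_add_cancel]

theorem trace_eq_of_equiv {X M : Type*} [AddCommGroup X] [Module ℝ X] [AddCommGroup M]
    [Module ℝ M] (e : X ≃ₗ[ℝ] M) {u : End ℝ X} {g : End ℝ M} (h : ∀ x, e (u x) = g (e x)) :
    LinearMap.trace ℝ M g = LinearMap.trace ℝ X u := by
  rw [← LinearMap.trace_conj' u e]
  congr 1
  refine LinearMap.ext fun y => ?_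
  obtain ⟨x, rfl⟩ := e.surjective y
  rw [LinearEquiv.conj_apply_apply, LinearEquiv.symm_apply_apply, h]

/-- The trace of a permutation of an invariant space from an equivariant parametrization. -/
theorem trace_subRep_eq {X : Type*} [AddCommGroup X] [Module ℝ X]
    {V : Submodule ℝ (Form n k Finset.univ)} (hV : PermInvariant V)
    (π : Equiv.Perm (Fin (n + 1))) (E : X →ₗ[ℝ] Form n k Finset.univ) (u : End ℝ X)
    (hu : ∀ x, E (u x) = permRep n k π (E x)) (hE : LinearMap.range E = V)
    (hE' : ∀ x, E x = 0 → x = 0) :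
    LinearMap.trace ℝ V (subRep hV π) = LinearMap.trace ℝ X u := by
  let e : X ≃ₗ[ℝ] V := (LinearEquiv.ofInjective E
    (LinearMap.ker_eq_bot.1 ((LinearMap.ker_eq_bot').2 hE'))).trans (LinearEquiv.ofEq _ _ hE)
  exact trace_eq_of_equiv (M := V) e (fun x => Subtype.ext (hu x))

end Formulas

/-! ### The spaces `P_r Λ^1(T^3)` -/

section PolyOne

variable {r : ℕ}

/-- One-forms from their coefficients. -/
def oneForm (r : ℕ) : (Fin 3 → hom (Fin 4) r 0) →ₗ[ℝ] Form 3 1 Finset.univ :=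
  tripleSum fun i => (mono ![i.succ]).comp (mulHom r 0 1)

theorem oneForm_apply (A : Fin 3 → hom (Fin 4) r 0) (x : facePoints 3 Finset.univ)
    (v : Fin 1 → tangent 3 Finset.univ) :
    oneForm r A x v = ∑ i, eval x.1 (A i : MvPolynomial (Fin 4) ℝ) * (v 0).1 i.succ := by
  rw [oneForm, tripleSum_apply, sum_form_apply]
  refine Finset.sum_congr rfl fun i _ => ?_
  rw [LinearMap.comp_apply, mono_one_apply, mulHom_apply, one_mul]

theorem oneForm_cyc (A : Fin 3 → hom (Fin 4) r 0) :
    oneForm r (shift (homRename r 0 cyc) A) = permRep 3 1 cyc (oneForm r A) :=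
  tripleSum_mono_shift (fun i => by rw [← cyc_succ]; funext a; fin_cases a; rfl)
    (fun i q => rename_mulHom (map_one _) q) A

/-- On `T^3` one has `dλ₀ = -(dλ₁ + dλ₂ + dλ₃)`, so three coefficients suffice. -/
theorem range_oneForm : LinearMap.range (oneForm r) = polyForms 3 r 1 := by
  apply le_antisymm
  · rintro _ ⟨A, rfl⟩
    rw [oneForm, tripleSum_apply]
    refine Submodule.sum_mem _ fun i _ => mono_mem_polyForms _ ?_
    rw [mulHom_apply, one_mul]
    exact (A i).2
  · refine polyForms_le fun I p hp => ?_
    obtain ⟨i, rfl⟩ : ∃ i, I = ![i] := ⟨I 0, by funext a; fin_cases a; rfl⟩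
    refine Fin.cases ?_ (fun i => ?_) i
    · refine ⟨fun _ => -⟨p, hp⟩, ?_⟩
      funext x
      ext v
      rw [oneForm_apply, mono_one_apply, tangent_zero, Fin.sum_univ_three]
      simp only [Submodule.coe_neg, map_neg]
      change -eval x.1 p * (v 0).1 1 + -eval x.1 p * (v 0).1 2 + -eval x.1 p * (v 0).1 3 = _
      ring
    · refine ⟨Pi.single i ⟨p, hp⟩, ?_⟩
      rw [oneForm, tripleSum_apply, Finset.sum_eq_single i]
      · rw [Pi.single_eq_same, LinearMap.comp_apply, mulHom_apply, one_mul]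
      · intro l _ hl
        rw [Pi.single_eq_of_ne hl, map_zero]
      · simp

/-- The vectors `e_i - e_0` are dual to `dλ₁, dλ₂, dλ₃` and read off the coefficients. -/
theorem eq_zero_of_oneForm_eq_zero {A : Fin 3 → hom (Fin 4) r 0} (h : oneForm r A = 0) :
    A = 0 := by
  funext i
  apply Subtype.ext
  refine eq_zero_of_eval (A i).2 fun x hx hs => ?_
  have h1 : oneForm r A ⟨x, fun i => (hx i).le, hs, by simp⟩ ![edgeVector i.succ 0] = 0 := by
    rw [h]
    rfl
  rw [oneForm_apply, Finset.sum_eq_single i] at h1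
  · simpa [edgeVector_apply] using h1
  · intro l _ hl
    simp [edgeVector_apply, hl]
  · simp

/-- The forms with vanishing traces on the other triangles. -/
def oneFormBase (r : ℕ) : (Fin 3 → hom (Fin 3) r 2) →ₗ[ℝ] Form 3 1 Finset.univ :=
  tripleSum fun i => (mono ![i.succ]).comp
    (mulBase r 2 (X (i + 1).succ * X (i + 2).succ))

theorem oneFormBase_apply (A : Fin 3 → hom (Fin 3) r 2) (x : facePoints 3 Finset.univ)
    (v : Fin 1 → tangent 3 Finset.univ) :
    oneFormBase r A x v = ∑ i : Fin 3, x.1 (i + 1).succ * x.1 (i + 2).succ *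
      eval (fun i : Fin 3 => x.1 i.succ) (A i : MvPolynomial (Fin 3) ℝ) * (v 0).1 i.succ := by
  rw [oneFormBase, tripleSum_apply, sum_form_apply]
  refine Finset.sum_congr rfl fun i _ => ?_
  rw [LinearMap.comp_apply, mono_one_apply, mulBase_apply, map_mul, map_mul, eval_X, eval_X,
    eval_rename']

theorem oneFormBase_cyc (A : Fin 3 → hom (Fin 3) r 2) :
    oneFormBase r (shift (homRename r 2 (fun i : Fin 3 => i + 1)) A)
      = permRep 3 1 cyc (oneFormBase r A) :=
  tripleSum_mono_shift (fun i => by rw [← cyc_succ]; funext a; fin_cases a; rfl)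
    (fun i q => rename_mulBase (by
      rw [map_mul, rename_X, rename_X, cyc_succ, cyc_succ, add_right_comm i 2 1]) q) A

theorem oneFormBase_mem (A : Fin 3 → hom (Fin 3) r 2) : oneFormBase r A ∈ polyForms 3 r 1 := by
  rw [oneFormBase, tripleSum_apply]
  refine Submodule.sum_mem _ fun i _ => mono_mem_polyForms _ ?_
  rw [mulBase_apply, mul_assoc]
  exact X_mul_mem_hom _ (X_mul_mem_hom _ (rename_mem_hom _ (A i).2))

theorem trace_oneFormBase (A : Fin 3 → hom (Fin 3) r 2) (i : Fin 3) :
    trace 1 (Finset.subset_univ (Finset.univ.erase i.succ)) (oneFormBase r A) = 0 := by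
  rw [trace_erase_eq_zero_iff]
  intro x hx v hv
  rw [oneFormBase_apply]
  refine Finset.sum_eq_zero fun l _ => ?_
  have hl : ∀ i l : Fin 3, i = l ∨ i = l + 1 ∨ i = l + 2 := by decide
  rcases hl i l with rfl | rfl | rfl
  · rw [hv 0, mul_zero]
  · rw [hx]
    ring
  · rw [hx]
    ring

/-- Let `P_i` be the coefficients on the triangle. Vanishing on the edge `λ_i = 0` makes `P_{i+1} -
P_{i+2}` a multiple `λ_i D_i`. These differences sum to zero, so Koszul exactness gives `A` for
which the three polynomials `P_i - λ_{i+1} λ_{i+2} A_i` coincide. What remains is a multiple of `dλ₁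
+ dλ₂ + dλ₃`, which is zero on the triangle. -/
theorem exists_trace_oneFormBase_eq {ω : Form 3 1 Finset.univ} (hω : ω ∈ polyForms 3 r 1)
    (h : ∀ G ⊆ baseFace.1, G.card + 1 = baseFace.1.card →
      trace 1 (Finset.subset_univ G) ω = 0) :
    ∃ A, trace 1 (Finset.subset_univ baseFace.1) (oneFormBase r A)
      = trace 1 (Finset.subset_univ baseFace.1) ω := by
  rw [← range_oneForm] at hω
  obtain ⟨b, rfl⟩ := hω
  set P : Fin 3 → MvPolynomial (Fin 3) ℝ :=
    fun i => killCompl (Fin.succ_injective 3) (b i).1 with hP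
  have hPmem : ∀ i, P i ∈ hom (Fin 3) r 0 := fun i => killCompl_mem_hom _ (b i).2
  have hD : ∀ i, ∃ D ∈ hom (Fin 3) r 1, P (i + 1) - P (i + 2) = X i * D := by
    intro i
    refine exists_eq_X_mul i (Submodule.sub_mem _ (hPmem _) (hPmem _)) fun y h0 hy hs => ?_
    have hy' : ∀ l, 0 ≤ y l := fun l => by
      by_cases hl : l = i
      · rw [hl, h0]
      · exact (hy l hl).le
    have h1 := apply_eq_zero_of_trace_edges h i (basePoint y hy' hs) rfl h0
      ![edgeVector (i + 1).succ (i + 2).succ]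
      (fun j => by
        fin_cases j
        simp [edgeVector_apply, (Fin.succ_ne_zero _).symm])
      (fun j => by
        fin_cases j
        revert i
        simp [edgeVector_apply])
    rw [oneForm_apply] at h1
    simp only [eval_basePoint] at h1
    rw [map_sub]
    have h2 : ∀ l : Fin 3, ((![edgeVector (i + 1).succ (i + 2).succ] :
        Fin 1 → tangent 3 Finset.univ) 0).1 l.succ
          = (if l = i + 1 then 1 else 0) - (if l = i + 2 then 1 else 0) := by
      intro l
      simp [edgeVector_apply]
    simp only [h2, mul_sub, mul_ite, mul_one, mul_zero, Finset.sum_sub_distrib,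
      Finset.sum_ite_eq', Finset.mem_univ, if_true] at h1
    exact h1
  choose D hD hD' using hD
  have hD0 : P 1 - P 2 = X 0 * D 0 := hD' 0
  have hD1 : P 2 - P 0 = X 1 * D 1 := hD' 1
  have hD2 : P 0 - P 1 = X 2 * D 2 := hD' 2
  obtain ⟨A, hA, hDA⟩ := exists_eq_sub_of_sum_X_mul_eq_zero hD (by
    rw [Fin.sum_univ_three, ← hD0, ← hD1, ← hD2]
    ring)
  have hA2 : D 2 = X 1 * A 0 - X 0 * A 1 := hDA 0
  have hA0 : D 0 = X 2 * A 1 - X 1 * A 2 := hDA 1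
  refine ⟨fun i => ⟨A i, hA i⟩, ?_⟩
  rw [← sub_eq_zero, ← map_sub, trace_baseFace_eq_zero_iff]
  intro x hx v hv
  change oneFormBase r _ x v - oneForm r b x v = 0
  rw [oneFormBase_apply, oneForm_apply]
  have hb : ∀ i, eval x.1 (b i : MvPolynomial (Fin 4) ℝ)
      = eval (fun i : Fin 3 => x.1 i.succ) (P i) := fun i => (eval_killCompl_succ _ _ hx).symm
  simp only [hb]
  rw [Fin.sum_univ_three, Fin.sum_univ_three]
  have hv0 := tangent_zero (v 0)
  rw [hv 0] at hv0
  rw [hA2] at hD2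
  rw [hA0] at hD0
  have e0 := congrArg (eval fun i : Fin 3 => x.1 i.succ) hD0
  have e2 := congrArg (eval fun i : Fin 3 => x.1 i.succ) hD2
  simp only [map_sub, map_mul, eval_X] at e0 e2
  generalize eval (fun i : Fin 3 => x.1 i.succ) (P 0) = p0 at *
  generalize eval (fun i : Fin 3 => x.1 i.succ) (P 1) = p1 at *
  generalize eval (fun i : Fin 3 => x.1 i.succ) (P 2) = p2 at *
  generalize eval (fun i : Fin 3 => x.1 i.succ) (A 0) = a0 at *
  generalize eval (fun i : Fin 3 => x.1 i.succ) (A 1) = a1 at *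
  generalize eval (fun i : Fin 3 => x.1 i.succ) (A 2) = a2 at *
  change p1 - p2 = x.1 1 * (x.1 3 * a1 - x.1 2 * a2) at e0
  change p0 - p1 = x.1 3 * (x.1 2 * a0 - x.1 1 * a1) at e2
  change x.1 2 * x.1 3 * a0 * (v 0).1 1 + x.1 3 * x.1 1 * a1 * (v 0).1 2 +
    x.1 1 * x.1 2 * a2 * (v 0).1 3 -
      (p0 * (v 0).1 1 + p1 * (v 0).1 2 + p2 * (v 0).1 3) = 0
  have hv3 : (v 0).1 3 = -(v 0).1 1 - (v 0).1 2 := by linarith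
  rw [hv3]
  linear_combination (-(v 0).1 1 - (v 0).1 2) * e0 - (v 0).1 1 * e2

/-- The trace vanishes exactly when the three products `λ_{i+1} λ_{i+2} A_i` agree, which means that
`A` is proportional to the triple of variables. -/
theorem trace_oneFormBase_eq_zero_iff (A : Fin 3 → hom (Fin 3) r 2) :
    trace 1 (Finset.subset_univ baseFace.1) (oneFormBase r A) = 0 ↔
      A ∈ LinearMap.range (mulX r 2) := by
  rw [trace_baseFace_eq_zero_iff]
  constructor
  · intro h
    obtain ⟨s, hs, hA⟩ := exists_eq_X_mul_of_proportional (A := fun i => (A i).1)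
      (fun i => (A i).2) (fun i => by
        rw [← sub_eq_zero]
        refine eq_zero_of_eval (r := r) (j := 1) (Submodule.sub_mem _ (X_mul_mem_hom _ (A _).2)
          (X_mul_mem_hom _ (A _).2)) fun y hy hs => ?_
        have h1 := h (basePoint y (fun i => (hy i).le) hs) rfl
          ![edgeVector i.succ (i + 1).succ] (fun j => by
            fin_cases j
            simp [edgeVector_apply, (Fin.succ_ne_zero _).symm])
        rw [oneFormBase_apply] at h1
        have h2 : ∀ l : Fin 3, ((![edgeVector i.succ (i + 1).succ] :
            Fin 1 → tangent 3 Finset.univ) 0).1 l.succ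
              = (if l = i then 1 else 0) - (if l = i + 1 then 1 else 0) := by
          intro l
          simp [edgeVector_apply]
        simp only [h2, mul_sub, mul_ite, mul_one, mul_zero, Finset.sum_sub_distrib,
          Finset.sum_ite_eq', Finset.mem_univ, if_true, basePoint_succ] at h1
        have e1 : i + 1 + 1 = i + 2 := (by decide : ∀ i : Fin 3, i + 1 + 1 = i + 2) i
        have e2 : i + 1 + 2 = i := (by decide : ∀ i : Fin 3, i + 1 + 2 = i) i
        rw [e1, e2] at h1
        simp only [map_sub, map_mul, eval_X]
        apply mul_left_cancel₀ (hy (i + 2)).ne'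
        linear_combination h1)
    exact ⟨⟨s, hs⟩, funext fun i => Subtype.ext (hA i).symm⟩
  · rintro ⟨s, rfl⟩ x hx v hv
    rw [oneFormBase_apply]
    simp only [mulX_apply, map_mul, eval_X]
    rw [Fin.sum_univ_three]
    have hv0 := tangent_zero (v 0)
    rw [hv 0] at hv0
    generalize eval (fun i : Fin 3 => x.1 i.succ) s.1 = c
    change x.1 2 * x.1 3 * (x.1 1 * c) * (v 0).1 1 + x.1 3 * x.1 1 * (x.1 2 * c) * (v 0).1 2 +
      x.1 1 * x.1 2 * (x.1 3 * c) * (v 0).1 3 = 0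
    linear_combination (x.1 1 * x.1 2 * x.1 3 * c) * hv0

-- The shifted triples have trace 0 and the kernel of the parametrization consists of polynomials of
-- degree `r - 3`, whose trace is subtracted.
open scoped Classical in
theorem Complements.baseTrace_polyForms_one {C : Complements (polyForms 3 r 1)}
    (hC : C.IsInvariant) : C.baseTrace le_rfl hC permInvariant_polyForms
      = -(if ∃ m : ℕ, r = 3 * m + 3 then 1 else 0) := by
  have h := C.trace_eq_baseTrace_add le_rfl hC permInvariant_polyForms (oneFormBase r)
    (shift (homRename r 2 fun i : Fin 3 => i + 1)) oneFormBase_cyc oneFormBase_mem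
    trace_oneFormBase (fun ω => exists_trace_oneFormBase_eq) (mulX r 2) mulX_injective
    (homRename r 3 fun i : Fin 3 => i + 1) mulX_homRename trace_oneFormBase_eq_zero_iff
  rw [trace_shift, trace_homRename] at h
  linarith

theorem trace_cyc_polyForms_one :
    LinearMap.trace ℝ (polyForms 3 r 1) (subRep permInvariant_polyForms cyc) = 0 := by
  rw [trace_subRep_eq permInvariant_polyForms cyc (oneForm r) _ oneForm_cyc range_oneForm
    fun A => eq_zero_of_oneForm_eq_zero, trace_shift]

/-- Forms with prescribed trace on an edge and vanishing traces on the other edges. -/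
theorem exists_trace_edge_polyForms_one (hr : 1 ≤ r) (F : Face 3) (hF : F.1.card = 2)
    (ω : Form 3 1 Finset.univ) (hω : ω ∈ polyForms 3 r 1) :
    ∃ η ∈ polyForms 3 r 1,
      trace 1 (Finset.subset_univ F.1) η = trace 1 (Finset.subset_univ F.1) ω ∧
        ∀ G : Face 3, G.1.card = 2 → G ≠ F → trace 1 (Finset.subset_univ G.1) η = 0 := by
  obtain ⟨a, b, hab, hFab⟩ := Finset.card_eq_two.1 hF
  rw [← range_oneForm] at hω
  obtain ⟨A, rfl⟩ := hω
  -- With `c_0 = 0` all four differentials can be treated alike. On the edge, `dλ_b = -dλ_a`, so the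
  -- form becomes `(c_a - c_b) dλ_a`.
  set c : Fin 4 → MvPolynomial (Fin 4) ℝ := Fin.cons 0 fun i => (A i).1 with hc
  have hcmem : ∀ i, c i ∈ hom (Fin 4) r 0 := fun i => by
    refine Fin.cases ?_ (fun i => ?_) i
    · exact Submodule.zero_mem _
    · exact (A i).2
  obtain ⟨q, hq, s, hs, hqs, hs'⟩ := exists_eq_X_mul_add a (Submodule.sub_mem _ (hcmem a) (hcmem b))
  -- On the edge, the remainder `s` depends on `λ_b` only and is its value at the vertex `b` times
  -- `λ_b^r`. As `r ≥ 1`, one factor `λ_b` can be split off, leaving `t`.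
  set t := monomial (Finsupp.single b (r - 1)) (eval (Pi.single b 1) s) with ht
  have htmem : t ∈ hom (Fin 4) r 1 := by
    refine (monomial_mem_restrictSupport ℝ).2 (Or.inl ?_)
    change (Finsupp.single b (r - 1)).degree + 1 = r
    rw [Finsupp.degree_single]
    omega
  have hmem : ∀ i, i ∉ F.1 ↔ i ≠ a ∧ i ≠ b := fun i => by simp [hFab]
  -- The witness is `λ_b t dλ_a - λ_a q dλ_b`. Each term has one endpoint in the coefficient and the
  -- other in the differential, so it vanishes on every other edge.
  refine ⟨mono ![a] (X b * t) - mono ![b] (X a * q), Submodule.sub_mem _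
    (mono_mem_polyForms _ (X_mul_mem_hom b htmem)) (mono_mem_polyForms _ (X_mul_mem_hom a hq)),
    ?_, fun G hG hGF => ?_⟩
  · rw [← sub_eq_zero, ← map_sub, trace_eq_zero_iff']
    intro x hx v hv
    change mono ![a] _ x v - mono ![b] _ x v - oneForm r A x v = 0
    have hsum : ∀ f : Fin 4 → ℝ, (∀ i, i ∉ F.1 → f i = 0) → ∑ i, f i = f a + f b := by
      intro f hf
      rw [← Finset.sum_subset (Finset.subset_univ F.1) fun i _ hi => hf i hi, hFab,
        Finset.sum_pair hab]
    have h1 : oneForm r A x v = eval x.1 (c a) * (v 0).1 a + eval x.1 (c b) * (v 0).1 b := by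
      have h0 : ∑ i, eval x.1 (c i) * (v 0).1 i = oneForm r A x v := by
        rw [Fin.sum_univ_succ, oneForm_apply, show c 0 = 0 from rfl, map_zero, zero_mul, zero_add]
        rfl
      rw [← h0, hsum (fun i => eval x.1 (c i) * (v 0).1 i) fun i hi => by
        rw [hv 0 i hi, mul_zero]]
    have h2 : (v 0).1 b = -(v 0).1 a := by
      have := hsum (v 0).1 (hv 0)
      rw [(v 0).2.1] at this
      linarith
    have h3 : eval x.1 s = x.1 b ^ r * eval (Pi.single b 1) s := by
      have h4 := eval_smul_of_mem_hom hs (x.1 b) (Pi.single b 1)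
      rw [Nat.sub_zero] at h4
      rw [← h4, ← hs' x.1 0]
      congr 2
      funext i
      by_cases hia : i = a
      · subst hia
        simp [hab]
      · rw [Function.update_of_ne hia]
        by_cases hib : i = b
        · subst hib
          simp
        · rw [hx i ((hmem i).2 ⟨hia, hib⟩)]
          simp [hib]
    have h5 := congrArg (eval x.1) hqs
    have h6 : x.1 b ^ r = x.1 b * x.1 b ^ (r - 1) := by
      rw [← pow_succ', Nat.sub_add_cancel hr]
    have h7 : eval x.1 t = eval (Pi.single b 1) s * x.1 b ^ (r - 1) := by
      rw [ht, eval_monomial, Finsupp.prod_single_index]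
      exact pow_zero _
    rw [mono_one_apply, mono_one_apply, h1, h2, map_mul, map_mul, eval_X, eval_X, h7]
    rw [map_sub, map_add, map_mul, eval_X, h3, h6] at h5
    linear_combination -(v 0).1 a * h5
  · rw [trace_eq_zero_iff']
    intro x hx v hv
    change mono ![a] _ x v - mono ![b] _ x v = 0
    rw [mono_one_apply, mono_one_apply, map_mul, map_mul, eval_X, eval_X]
    have h1 : a ∉ G.1 ∨ b ∉ G.1 := by
      by_contra! h1
      refine hGF (Subtype.ext (Finset.eq_of_subset_of_card_le ?_ (by rw [hG, hF])).symm)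
      rw [hFab]
      intro i hi
      rcases Finset.mem_insert.1 hi with rfl | hi
      · exact h1.1
      · rw [Finset.mem_singleton.1 hi]
        exact h1.2
    rcases h1 with h1 | h1
    · rw [hx _ h1, hv 0 _ h1]
      ring
    · rw [hx _ h1, hv 0 _ h1]
      ring

theorem tracesExtend_polyForms_one (hr : 1 ≤ r) : TracesExtend (polyForms 3 r 1) :=
  tracesExtend_of_edges_of_base le_rfl permInvariant_polyForms
    (exists_trace_edge_polyForms_one hr) fun ω hω h => by
      obtain ⟨A, hA⟩ := exists_trace_oneFormBase_eq hω h
      exact ⟨_, oneFormBase_mem A, hA, trace_oneFormBase A⟩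

theorem polyForms_one_iff (hr : 1 ≤ r) :
    ((∃ C : Complements (polyForms 3 r 1), HasDecomposableInvariantBasis C) ↔
        ¬ ∃ m : ℕ, r = 3 * m + 3) ∧
      ∀ C : Complements (polyForms 3 r 1), C.IsInvariant →
        (HasDecomposableInvariantBasis C ↔ ¬ ∃ m : ℕ, r = 3 * m + 3) := by
  classical
  refine exists_iff_and_forall_iff le_rfl permInvariant_polyForms (tracesExtend_polyForms_one hr)
    _ fun C hC => ?_
  -- The total trace is 0, so the trace on the tetrahedron is the negative of that on the triangle,
  -- and both are nonnegative only if both vanish.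
  have h1 := trace_subRep_cyc le_rfl hC permInvariant_polyForms (tracesExtend_polyForms_one hr)
  rw [trace_cyc_polyForms_one] at h1
  have h2 := C.baseTrace_polyForms_one hC
  split_ifs at h2 with h
  · simp only [h, not_true_eq_false, iff_false, not_and, not_le]
    intro h3
    linarith
  · simp only [h, not_false_eq_true, iff_true]
    constructor <;> linarith

end PolyOne

/-! ### The spaces `P_r^- Λ^1(T^3)` -/

section PolyMinusOne

variable {r : ℕ}

/-- The coefficients of the forms in `P_r^- Λ^1`. -/
theorem exists_coeff_polyMinusForms_one {ω : Form 3 1 Finset.univ}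
    (hω : ω ∈ polyMinusForms 3 r 1) :
    ∃ a : Fin 4 → MvPolynomial (Fin 4) ℝ, (∀ i, a i ∈ hom (Fin 4) r 0) ∧ ∑ i, X i * a i = 0 ∧
      ∀ x v, ω x v = ∑ i, eval x.1 (a i) * (v 0).1 i := by
  let N : Submodule ℝ (Form 3 1 Finset.univ) :=
    { carrier := {ω | ∃ a : Fin 4 → MvPolynomial (Fin 4) ℝ, (∀ i, a i ∈ hom (Fin 4) r 0) ∧
        ∑ i, X i * a i = 0 ∧ ∀ x v, ω x v = ∑ i, eval x.1 (a i) * (v 0).1 i}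
      add_mem' := by
        rintro ω η ⟨a, ha, ha', hω⟩ ⟨b, hb, hb', hη⟩
        refine ⟨a + b, fun i => Submodule.add_mem _ (ha i) (hb i), ?_, fun x v => ?_⟩
        · simp only [Pi.add_apply, mul_add, Finset.sum_add_distrib, ha', hb', add_zero]
        · change ω x v + η x v = _
          simp only [hω, hη, Pi.add_apply, map_add, add_mul, Finset.sum_add_distrib]
      zero_mem' := ⟨0, fun _ => Submodule.zero_mem _, by simp, fun x v => by simp⟩
      smul_mem' := by
        rintro c ω ⟨a, ha, ha', hω⟩
        refine ⟨c • a, fun i => Submodule.smul_mem _ _ (ha i), ?_, fun x v => ?_⟩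
        · simp only [Pi.smul_apply, mul_smul_comm, ← Finset.smul_sum, ha', smul_zero]
        · change c * ω x v = _
          simp only [hω, Pi.smul_apply, MvPolynomial.smul_eval, Finset.mul_sum, mul_assoc] }
  have h : polyMinusForms 3 r 1 ≤ N := polyMinusForms_le fun J p hp => by
    obtain ⟨i, j, rfl⟩ : ∃ i j, J = ![i, j] :=
      ⟨J 0, J 1, by funext a; fin_cases a <;> rfl⟩
    refine ⟨Pi.single j (X i * p) - Pi.single i (X j * p), fun l => Submodule.sub_mem _ ?_ ?_,
      ?_, fun x v => ?_⟩
    · by_cases hl : l = j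
      · rw [hl, Pi.single_eq_same]
        exact X_mul_mem_hom _ hp
      · rw [Pi.single_eq_of_ne hl]
        exact Submodule.zero_mem _
    · by_cases hl : l = i
      · rw [hl, Pi.single_eq_same]
        exact X_mul_mem_hom _ hp
      · rw [Pi.single_eq_of_ne hl]
        exact Submodule.zero_mem _
    · simp only [Pi.sub_apply, Pi.single_apply, mul_sub, mul_ite, mul_zero, Finset.sum_sub_distrib,
        Finset.sum_ite_eq', Finset.mem_univ, if_true]
      ring
    · rw [monoX_one_apply]
      have e : ∀ l, eval x.1 ((Pi.single j (X i * p) - Pi.single i (X j * p) :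
          Fin 4 → MvPolynomial (Fin 4) ℝ) l) = (if l = j then eval x.1 (X i * p) else 0)
            - (if l = i then eval x.1 (X j * p) else 0) := by
        intro l
        rw [Pi.sub_apply, map_sub, Pi.single_apply, Pi.single_apply, apply_ite (eval x.1),
          apply_ite (eval x.1), map_zero]
      simp only [e, sub_mul, ite_mul, zero_mul, Finset.sum_sub_distrib,
        Finset.sum_ite_eq', Finset.mem_univ, if_true, map_mul, eval_X]
      ring
  exact h hω

/-- The forms with vanishing traces on the other triangles. -/
def oneFormMinusBase (r : ℕ) : (Fin 3 → hom (Fin 3) r 2) →ₗ[ℝ] Form 3 1 Finset.univ :=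
  tripleSum fun i => (monoX ![(i + 1).succ, (i + 2).succ]).comp (mulBase r 2 (X i.succ))

theorem oneFormMinusBase_apply (A : Fin 3 → hom (Fin 3) r 2) (x : facePoints 3 Finset.univ)
    (v : Fin 1 → tangent 3 Finset.univ) :
    oneFormMinusBase r A x v = ∑ i : Fin 3, x.1 i.succ *
      eval (fun i : Fin 3 => x.1 i.succ) (A i : MvPolynomial (Fin 3) ℝ) *
        (x.1 (i + 1).succ * (v 0).1 (i + 2).succ - x.1 (i + 2).succ * (v 0).1 (i + 1).succ) := by
  rw [oneFormMinusBase, tripleSum_apply, sum_form_apply]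
  refine Finset.sum_congr rfl fun i _ => ?_
  rw [LinearMap.comp_apply, monoX_one_apply, mulBase_apply, map_mul, eval_X, eval_rename']

theorem oneFormMinusBase_cyc (A : Fin 3 → hom (Fin 3) r 2) :
    oneFormMinusBase r (shift (homRename r 2 (fun i : Fin 3 => i + 1)) A)
      = permRep 3 1 cyc (oneFormMinusBase r A) :=
  tripleSum_monoX_shift (by decide)
    (fun i q => rename_mulBase (by rw [rename_X, cyc_succ]) q) A

theorem oneFormMinusBase_mem (A : Fin 3 → hom (Fin 3) r 2) :
    oneFormMinusBase r A ∈ polyMinusForms 3 r 1 := by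
  rw [oneFormMinusBase, tripleSum_apply]
  refine Submodule.sum_mem _ fun i _ => monoX_mem_polyMinusForms _ ?_
  rw [mulBase_apply]
  exact X_mul_mem_hom _ (rename_mem_hom _ (A i).2)

theorem trace_oneFormMinusBase (A : Fin 3 → hom (Fin 3) r 2) (i : Fin 3) :
    trace 1 (Finset.subset_univ (Finset.univ.erase i.succ)) (oneFormMinusBase r A) = 0 := by
  rw [trace_erase_eq_zero_iff]
  intro x hx v hv
  rw [oneFormMinusBase_apply]
  refine Finset.sum_eq_zero fun l _ => ?_
  have hl : ∀ i l : Fin 3, i = l ∨ i = l + 1 ∨ i = l + 2 := by decide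
  rcases hl i l with rfl | rfl | rfl
  · rw [hx]
    ring
  · rw [hx, hv 0]
    ring
  · rw [hx, hv 0]
    ring

/-- The relation `∑ λ_i a_i = 0` means that evaluation at `e_l - x` returns the coefficient `a_l`.
On an edge `λ_i = 0` this kills the coefficients with `l ≠ i`, so on the triangle the coefficients
are `λ_{i+1} λ_{i+2} B_i`, and the relation becomes `B_0 + B_1 + B_2 = 0`. -/
theorem exists_trace_oneFormMinusBase_eq {ω : Form 3 1 Finset.univ}
    (hω : ω ∈ polyMinusForms 3 r 1)
    (h : ∀ G ⊆ baseFace.1, G.card + 1 = baseFace.1.card →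
      trace 1 (Finset.subset_univ G) ω = 0) :
    ∃ A, trace 1 (Finset.subset_univ baseFace.1) (oneFormMinusBase r A)
      = trace 1 (Finset.subset_univ baseFace.1) ω := by
  obtain ⟨a, ha, ha', hωa⟩ := exists_coeff_polyMinusForms_one hω
  set P : Fin 3 → MvPolynomial (Fin 3) ℝ :=
    fun i => killCompl (Fin.succ_injective 3) (a i.succ) with hP
  have hPmem : ∀ i, P i ∈ hom (Fin 3) r 0 := fun i => killCompl_mem_hom _ (ha _)
  have hsum : ∀ x : Fin 4 → ℝ, x 0 = 0 →
      ∑ i : Fin 3, x i.succ * eval (fun i : Fin 3 => x i.succ) (P i) = 0 := by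
    intro x hx
    have h1 := congrArg (eval x) ha'
    rw [map_sum, Fin.sum_univ_succ, map_mul, eval_X, hx, zero_mul, zero_add, map_zero] at h1
    rw [← h1]
    refine Finset.sum_congr rfl fun i _ => ?_
    rw [map_mul, eval_X, eval_killCompl_succ _ _ hx]
  have hvan : ∀ i : Fin 3, ∀ y : Fin 3 → ℝ, y i = 0 → (∀ l, l ≠ i → 0 < y l) → ∑ i, y i = 1 →
      ∀ l, l ≠ i → eval y (P l) = 0 := by
    intro i y h0 hy hs l hl
    have hy' : ∀ l, 0 ≤ y l := fun l => by
      by_cases hl : l = i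
      · rw [hl, h0]
      · exact (hy l hl).le
    have hl0 : (0 : Fin 4) ≠ l.succ := (Fin.succ_ne_zero _).symm
    have h1 := apply_eq_zero_of_trace_edges h i (basePoint y hy' hs) rfl h0
      ![radialVector (basePoint y hy' hs) l.succ]
      (fun j => by
        fin_cases j
        simp [radialVector_apply, hl0, basePoint_zero])
      (fun j => by
        fin_cases j
        simp [radialVector_apply, basePoint_succ, h0, hl.symm])
    have h2 := hsum (basePoint y hy' hs).1 rfl
    rw [hωa, Fin.sum_univ_succ] at h1
    simp only [eval_basePoint, Matrix.cons_val_zero, radialVector_apply, if_neg hl0,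
      basePoint_zero, basePoint_succ, sub_self, mul_zero, zero_add, mul_sub, mul_ite, mul_one,
      Fin.succ_inj, Finset.sum_sub_distrib, Finset.sum_ite_eq', Finset.mem_univ, if_true] at h1 h2
    have h3 : ∑ x : Fin 3, eval y (killCompl (Fin.succ_injective 3) (a x.succ)) * y x = 0 := by
      rw [← h2]
      exact Finset.sum_congr rfl fun i _ => mul_comm _ _
    rw [h3, sub_zero] at h1
    exact h1
  have hB : ∀ i : Fin 3, ∃ B ∈ hom (Fin 3) r 2, P i = X (i + 1) * X (i + 2) * B := by
    intro i
    have hne : i + 1 ≠ i + 2 := (by decide : ∀ i : Fin 3, i + 1 ≠ i + 2) i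
    have hne' : i ≠ i + 1 ∧ i ≠ i + 2 := (by decide : ∀ i : Fin 3, i ≠ i + 1 ∧ i ≠ i + 2) i
    obtain ⟨B, hB, hPB⟩ := exists_eq_prod_X_mul {i + 1, i + 2} (hPmem i)
      fun l hl y h0 hy hs => hvan l y h0 hy hs i (by
        rcases Finset.mem_insert.1 hl with rfl | hl
        · exact hne'.1
        · rw [Finset.mem_singleton.1 hl]
          exact hne'.2)
    rw [Finset.card_pair hne] at hB
    rw [Finset.prod_pair hne] at hPB
    exact ⟨B, hB, hPB⟩
  choose B hB hPB using hB
  have hB0 : B 0 + B 1 + B 2 = 0 := by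
    refine eq_zero_of_eval_pos fun y hy => ?_
    have h1 := hsum (Fin.cons 0 y) rfl
    simp only [Fin.cons_succ, hPB, map_mul, eval_X] at h1
    rw [Fin.sum_univ_three] at h1
    change y 0 * (y 1 * y 2 * eval y (B 0)) + y 1 * (y 2 * y 0 * eval y (B 1))
      + y 2 * (y 0 * y 1 * eval y (B 2)) = 0 at h1
    apply mul_left_cancel₀ (mul_pos (mul_pos (hy 0) (hy 1)) (hy 2)).ne'
    rw [map_add, map_add]
    linear_combination h1
  -- The parametrization has `B_i = A_{i+1} - A_{i+2}`; this is the solution normalized by `A_0 =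
  -- 0`.
  refine ⟨![0, -⟨B 2, hB 2⟩, ⟨B 1, hB 1⟩], ?_⟩
  rw [← sub_eq_zero, ← map_sub, trace_baseFace_eq_zero_iff]
  intro x hx v hv
  change oneFormMinusBase r _ x v - ω x v = 0
  have hb : ∀ i : Fin 3, eval x.1 (a i.succ)
      = eval (fun i : Fin 3 => x.1 i.succ) (P i) := fun i => (eval_killCompl_succ _ _ hx).symm
  rw [oneFormMinusBase_apply, hωa, Fin.sum_univ_succ (n := 3), hv 0]
  simp only [hb, hPB, map_mul, eval_X]
  have e := congrArg (eval fun i : Fin 3 => x.1 i.succ) hB0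
  rw [Fin.sum_univ_three, Fin.sum_univ_three]
  simp only [map_add, map_zero] at e
  simp only [Matrix.cons_val, Submodule.coe_neg, Submodule.coe_zero, map_neg, map_zero]
  generalize eval (fun i : Fin 3 => x.1 i.succ) (B 0) = b0 at *
  generalize eval (fun i : Fin 3 => x.1 i.succ) (B 1) = b1 at *
  generalize eval (fun i : Fin 3 => x.1 i.succ) (B 2) = b2 at *
  change x.1 1 * 0 * (x.1 2 * (v 0).1 3 - x.1 3 * (v 0).1 2)
    + x.1 2 * -b2 * (x.1 3 * (v 0).1 1 - x.1 1 * (v 0).1 3)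
    + x.1 3 * b1 * (x.1 1 * (v 0).1 2 - x.1 2 * (v 0).1 1)
    - (_ * 0 + (x.1 2 * x.1 3 * b0 * (v 0).1 1 + x.1 3 * x.1 1 * b1 * (v 0).1 2
      + x.1 1 * x.1 2 * b2 * (v 0).1 3)) = 0
  linear_combination (-(x.1 2 * x.1 3 * (v 0).1 1)) * e

theorem sum_fin_three (i : Fin 3) (f : Fin 3 → ℝ) :
    ∑ l, f l = f i + f (i + 1) + f (i + 2) := by
  rw [Fin.sum_univ_three]
  fin_cases i
  · rfl
  · change f 0 + f 1 + f 2 = f 1 + f 2 + f 0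
    ring
  · change f 0 + f 1 + f 2 = f 2 + f 0 + f 1
    ring

/-- Constant triples. -/
def constTriple (Q : Type*) [AddCommGroup Q] [Module ℝ Q] : Q →ₗ[ℝ] Fin 3 → Q :=
  LinearMap.pi fun _ => LinearMap.id

/-- Only the differences of the three polynomials enter the trace on the triangle, and the vectors
`e_i - x` recover them. -/
theorem trace_oneFormMinusBase_eq_zero_iff (A : Fin 3 → hom (Fin 3) r 2) :
    trace 1 (Finset.subset_univ baseFace.1) (oneFormMinusBase r A) = 0 ↔
      A ∈ LinearMap.range (constTriple (hom (Fin 3) r 2)) := by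
  rw [trace_baseFace_eq_zero_iff]
  constructor
  · intro h
    have key : ∀ i, A (i + 1) = A (i + 2) := by
      intro i
      apply Subtype.ext
      rw [← sub_eq_zero]
      refine eq_zero_of_eval (Submodule.sub_mem _ (A _).2 (A _).2) fun y hy hs => ?_
      have hl0 : (0 : Fin 4) ≠ i.succ := (Fin.succ_ne_zero _).symm
      have h1 := h (basePoint y (fun i => (hy i).le) hs) rfl
        ![radialVector (basePoint y (fun i => (hy i).le) hs) i.succ] (fun j => by
          fin_cases j
          simp [radialVector_apply, hl0, basePoint_zero])
      rw [oneFormMinusBase_apply] at h1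
      simp only [Matrix.cons_val_zero, radialVector_apply, Fin.succ_inj, basePoint_succ] at h1
      rw [map_sub]
      apply mul_left_cancel₀ (mul_pos (hy (i + 1)) (hy (i + 2))).ne'
      have key : ∀ i : Fin 3, i + 1 + 1 = i + 2 ∧ i + 1 + 2 = i ∧ i + 2 + 1 = i ∧
        i + 2 + 2 = i + 1 ∧ i + 1 ≠ i ∧ i + 2 ≠ i := by decide
      obtain ⟨e1, e2, e3, e4, e5, e6⟩ := key i
      rw [sum_fin_three i, e1, e2, e3, e4, if_neg e5, if_neg e6, if_pos rfl] at h1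
      linear_combination h1
    refine ⟨A 0, funext fun i => ?_⟩
    have h1 : A 1 = A 2 := key 0
    have h2 : A 2 = A 0 := key 1
    fin_cases i
    · rfl
    · exact (h1.trans h2).symm
    · exact h2.symm
  · rintro ⟨s, rfl⟩ x hx v hv
    rw [oneFormMinusBase_apply, Fin.sum_univ_three]
    change x.1 1 * eval _ s.1 * (x.1 2 * (v 0).1 3 - x.1 3 * (v 0).1 2)
      + x.1 2 * eval _ s.1 * (x.1 3 * (v 0).1 1 - x.1 1 * (v 0).1 3)
      + x.1 3 * eval _ s.1 * (x.1 1 * (v 0).1 2 - x.1 2 * (v 0).1 1) = 0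
    ring

-- Here the kernel consists of constant triples of polynomials of degree `r - 2`, so the cyclic
-- shift acts on it by renaming only.
open scoped Classical in
theorem Complements.baseTrace_polyMinusForms_one {C : Complements (polyMinusForms 3 r 1)}
    (hC : C.IsInvariant) : C.baseTrace le_rfl hC permInvariant_polyMinusForms
      = -(if ∃ m : ℕ, r = 3 * m + 2 then 1 else 0) := by
  have h := C.trace_eq_baseTrace_add le_rfl hC permInvariant_polyMinusForms (oneFormMinusBase r)
    (shift (homRename r 2 fun i : Fin 3 => i + 1)) oneFormMinusBase_cyc oneFormMinusBase_mem
    trace_oneFormMinusBase (fun ω => exists_trace_oneFormMinusBase_eq)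
    (constTriple (hom (Fin 3) r 2)) (fun s t h => congrFun h 0)
    (homRename r 2 fun i : Fin 3 => i + 1) (fun _ => rfl) trace_oneFormMinusBase_eq_zero_iff
  rw [trace_shift, trace_homRename] at h
  linarith

/-- The forms with vanishing traces on all triangles. -/
def oneFormMinusTop (r : ℕ) : (Fin 3 → hom (Fin 4) r 3) →ₗ[ℝ] Form 3 1 Finset.univ :=
  tripleSum fun i => (monoX ![0, i.succ]).comp
    (mulHom r 3 (X (i + 1).succ * X (i + 2).succ))

theorem oneFormMinusTop_apply (A : Fin 3 → hom (Fin 4) r 3) (x : facePoints 3 Finset.univ)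
    (v : Fin 1 → tangent 3 Finset.univ) :
    oneFormMinusTop r A x v = ∑ i : Fin 3, x.1 (i + 1).succ * x.1 (i + 2).succ *
      eval x.1 (A i : MvPolynomial (Fin 4) ℝ) *
        (x.1 0 * (v 0).1 i.succ - x.1 i.succ * (v 0).1 0) := by
  rw [oneFormMinusTop, tripleSum_apply, sum_form_apply]
  refine Finset.sum_congr rfl fun i _ => ?_
  rw [LinearMap.comp_apply, monoX_one_apply, mulHom_apply, map_mul, map_mul, eval_X, eval_X]

theorem oneFormMinusTop_cyc (A : Fin 3 → hom (Fin 4) r 3) :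
    oneFormMinusTop r (shift (homRename r 3 cyc) A) = permRep 3 1 cyc (oneFormMinusTop r A) :=
  tripleSum_monoX_shift (fun i => by
      rw [← cyc_succ]
      funext a
      fin_cases a <;> rfl)
    (fun i q => rename_mulHom (by
      rw [map_mul, rename_X, rename_X, cyc_succ, cyc_succ, add_right_comm i 2 1]) q) A

theorem oneFormMinusTop_mem (A : Fin 3 → hom (Fin 4) r 3) :
    oneFormMinusTop r A ∈ filtration (polyMinusForms 3 r 1) 3 := by
  rw [mem_filtration_three]
  refine ⟨?_, ?_, fun i => ?_⟩
  · rw [oneFormMinusTop, tripleSum_apply]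
    refine Submodule.sum_mem _ fun i _ => monoX_mem_polyMinusForms _ ?_
    rw [mulHom_apply, mul_assoc]
    exact X_mul_mem_hom _ (X_mul_mem_hom _ (A i).2)
  · rw [trace_baseFace_eq_zero_iff]
    intro x hx v hv
    rw [oneFormMinusTop_apply]
    refine Finset.sum_eq_zero fun l _ => ?_
    rw [hx, hv 0]
    ring
  · rw [trace_erase_eq_zero_iff]
    intro x hx v hv
    rw [oneFormMinusTop_apply]
    refine Finset.sum_eq_zero fun l _ => ?_
    have hl : ∀ i l : Fin 3, i = l ∨ i = l + 1 ∨ i = l + 2 := by decide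
    rcases hl i l with rfl | rfl | rfl
    · rw [hx, hv 0]
      ring
    · rw [hx]
      ring
    · rw [hx]
      ring

/-- Evaluation at `e_i - x` shows that each coefficient `a_i` vanishes on the facets `λ_l = 0` with
`l ≠ i`, hence is divisible by the product of those three variables. The quotients for `i ≠ 0` are
free, and `a_0` is determined by `∑ λ_i a_i = 0`. -/
theorem exists_oneFormMinusTop_eq {ω : Form 3 1 Finset.univ}
    (hω : ω ∈ filtration (polyMinusForms 3 r 1) 3) : ∃ A, oneFormMinusTop r A = ω := by
  rw [mem_filtration] at hω
  obtain ⟨a, ha, ha', hωa⟩ := exists_coeff_polyMinusForms_one hω.1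
  have hA : ∀ i : Fin 3, ∃ A ∈ hom (Fin 4) r 3,
      a i.succ = X 0 * (X (i + 1).succ * X (i + 2).succ * A) := by
    intro i
    have key : ∀ i : Fin 3, ({0, (i + 1).succ, (i + 2).succ} : Finset (Fin 4)).card = 3 ∧
      i.succ ∉ ({0, (i + 1).succ, (i + 2).succ} : Finset (Fin 4)) ∧
      (i + 1).succ ≠ (i + 2).succ ∧ (0 : Fin 4) ∉ ({(i + 1).succ, (i + 2).succ} : Finset (Fin 4)) :=
        by decide
    obtain ⟨h3, hi, hne, hne'⟩ := key i
    obtain ⟨A, hA, hAa⟩ := exists_eq_prod_X_mul {0, (i + 1).succ, (i + 2).succ} (ha i.succ)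
      fun l hl x h0 hx hs => by
        have hx' : ∀ l, 0 ≤ x l := fun j => by
          by_cases hj : j = l
          · rw [hj, h0]
          · exact (hx j hj).le
        have hil : l ≠ i.succ := by
          rintro rfl
          exact hi hl
        have h1 := trace_erase_eq_zero_iff.1 (hω.2 (Finset.univ.erase l) (by simp))
          ⟨x, hx', hs, by simp⟩ h0 ![radialVector ⟨x, hx', hs, by simp⟩ i.succ] (fun j => by
            fin_cases j
            simp [radialVector_apply, h0, hil])
        have h2 := congrArg (eval x) ha'
        rw [hωa] at h1
        simp only [Matrix.cons_val_zero, radialVector_apply, mul_sub, mul_ite, mul_one, mul_zero,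
          Finset.sum_sub_distrib, Finset.sum_ite_eq', Finset.mem_univ, if_true] at h1
        simp only [map_sum, map_mul, eval_X, map_zero] at h2
        have h4 : ∑ j, eval x (a j) * x j = 0 := by
          rw [← h2]
          exact Finset.sum_congr rfl fun i _ => mul_comm _ _
        rw [h4, sub_zero] at h1
        exact h1
    rw [h3] at hA
    rw [Finset.prod_insert hne', Finset.prod_pair hne, mul_assoc] at hAa
    exact ⟨A, hA, hAa⟩
  choose A hA hAa using hA
  have h0 : a 0 = -∑ i : Fin 3, X i.succ * (X (i + 1).succ * X (i + 2).succ * A i) := by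
    apply X_mul_left_cancel (i := 0)
    rw [Fin.sum_univ_succ] at ha'
    rw [eq_neg_of_add_eq_zero_left ha', mul_neg, Finset.mul_sum]
    congr 1
    refine Finset.sum_congr rfl fun i _ => ?_
    rw [hAa]
    ring
  refine ⟨fun i => ⟨A i, hA i⟩, ?_⟩
  funext x
  ext v
  rw [oneFormMinusTop_apply, hωa, Fin.sum_univ_succ (n := 3)]
  simp only [h0, hAa, map_neg, map_sum, map_mul, eval_X]
  rw [neg_mul, Finset.sum_mul, neg_add_eq_sub, ← Finset.sum_sub_distrib]
  refine Finset.sum_congr rfl fun i _ => ?_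
  ring

theorem eq_zero_of_oneFormMinusTop_eq_zero {A : Fin 3 → hom (Fin 4) r 3}
    (h : oneFormMinusTop r A = 0) : A = 0 := by
  funext i
  apply Subtype.ext
  refine eq_zero_of_eval (A i).2 fun x hx hs => ?_
  let x' : facePoints 3 Finset.univ := ⟨x, fun i => (hx i).le, hs, by simp⟩
  have h1 : oneFormMinusTop r A x' ![radialVector x' i.succ] = 0 := by
    rw [h]
    rfl
  have hl0 : (0 : Fin 4) ≠ i.succ := (Fin.succ_ne_zero _).symm
  rw [oneFormMinusTop_apply, Finset.sum_eq_single i] at h1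
  · rw [Matrix.cons_val_zero, radialVector_apply, radialVector_apply, if_pos rfl, if_neg hl0] at h1
    apply mul_left_cancel₀ (mul_pos (mul_pos (hx (i + 1).succ) (hx (i + 2).succ)) (hx 0)).ne'
    change x (i + 1).succ * x (i + 2).succ * eval x (A i).1 *
      (x 0 * (1 - x i.succ) - x i.succ * (0 - x 0)) = 0 at h1
    rw [mul_zero]
    linear_combination h1
  · intro l _ hl
    rw [Matrix.cons_val_zero, radialVector_apply, radialVector_apply, if_neg hl0,
      if_neg (fun h => hl (Fin.succ_injective _ h))]
    ring
  · simp

theorem Complements.topTrace_polyMinusForms_one {C : Complements (polyMinusForms 3 r 1)}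
    (hC : C.IsInvariant) : C.topTrace le_rfl hC permInvariant_polyMinusForms = 0 := by
  rw [← C.trace_eq_topTrace le_rfl hC permInvariant_polyMinusForms (oneFormMinusTop r) _
    oneFormMinusTop_cyc oneFormMinusTop_mem (fun ω => exists_oneFormMinusTop_eq)
    fun A => eq_zero_of_oneFormMinusTop_eq_zero, trace_shift]

theorem trace_monoX_one_eq_zero {G : Finset (Fin 4)} {i j : Fin 4} (h : i = j ∨ i ∉ G ∨ j ∉ G)
    (p : MvPolynomial (Fin 4) ℝ) :
    trace 1 (Finset.subset_univ G) (monoX ![i, j] p : Form 3 1 Finset.univ) = 0 := by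
  rw [trace_eq_zero_iff']
  intro x hx v hv
  rw [monoX_one_apply]
  rcases h with rfl | h | h
  · ring
  · rw [hx i h, hv 0 i h]
    ring
  · rw [hx j h, hv 0 j h]
    ring

/-- Forms with prescribed trace on an edge and vanishing traces on the other edges. -/
theorem exists_trace_edge_polyMinusForms_one (F : Face 3) (hF : F.1.card = 2)
    (ω : Form 3 1 Finset.univ) (hω : ω ∈ polyMinusForms 3 r 1) :
    ∃ η ∈ polyMinusForms 3 r 1,
      trace 1 (Finset.subset_univ F.1) η = trace 1 (Finset.subset_univ F.1) ω ∧
        ∀ G : Face 3, G.1.card = 2 → G ≠ F → trace 1 (Finset.subset_univ G.1) η = 0 := by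
  let N : Submodule ℝ (Form 3 1 Finset.univ) :=
    { carrier := {ω | ∃ η ∈ polyMinusForms 3 r 1,
        trace 1 (Finset.subset_univ F.1) η = trace 1 (Finset.subset_univ F.1) ω ∧
          ∀ G : Face 3, G.1.card = 2 → G ≠ F → trace 1 (Finset.subset_univ G.1) η = 0}
      add_mem' := by
        rintro ω ω' ⟨η, h1, h2, h3⟩ ⟨η', h1', h2', h3'⟩
        exact ⟨η + η', Submodule.add_mem _ h1 h1', by rw [map_add, map_add, h2, h2'],
          fun G hG hGF => by rw [map_add, h3 G hG hGF, h3' G hG hGF, add_zero]⟩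
      zero_mem' := ⟨0, Submodule.zero_mem _, rfl, fun _ _ _ => map_zero _⟩
      smul_mem' := by
        rintro c ω ⟨η, h1, h2, h3⟩
        exact ⟨c • η, Submodule.smul_mem _ _ h1, by rw [map_smul, map_smul, h2],
          fun G hG hGF => by rw [map_smul, h3 G hG hGF, smul_zero]⟩ }
  -- It is enough to treat generators: `p i_X(dλ_i ∧ dλ_j)` vanishes on every edge except the one
  -- joining `i` and `j`.
  have h : polyMinusForms 3 r 1 ≤ N := polyMinusForms_le fun J p hp => by
    obtain ⟨i, j, rfl⟩ : ∃ i j, J = ![i, j] :=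
      ⟨J 0, J 1, by funext a; fin_cases a <;> rfl⟩
    by_cases h : i = j ∨ i ∉ F.1 ∨ j ∉ F.1
    · exact ⟨0, Submodule.zero_mem _, by rw [map_zero, trace_monoX_one_eq_zero h],
        fun _ _ _ => map_zero _⟩
    · refine ⟨_, monoX_mem_polyMinusForms _ hp, rfl, fun G hG hGF => ?_⟩
      apply trace_monoX_one_eq_zero
      push Not at h
      by_contra! h'
      have key : ∀ F : Finset (Fin 4), F.card = 2 → i ∈ F → j ∈ F → ({i, j} : Finset _) = F :=
        fun F hF hi hj => Finset.eq_of_subset_of_card_le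
          (Finset.insert_subset hi (Finset.singleton_subset_iff.2 hj))
          (by rw [hF, Finset.card_pair h.1])
      exact hGF (Subtype.ext ((key G.1 hG h'.2.1 h'.2.2).symm.trans (key F.1 hF h.2.1 h.2.2)))
  exact h hω

theorem tracesExtend_polyMinusForms_one : TracesExtend (polyMinusForms 3 r 1) :=
  tracesExtend_of_edges_of_base le_rfl permInvariant_polyMinusForms
    exists_trace_edge_polyMinusForms_one fun ω hω h => by
      obtain ⟨A, hA⟩ := exists_trace_oneFormMinusBase_eq hω h
      exact ⟨_, oneFormMinusBase_mem A, hA, trace_oneFormMinusBase A⟩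

theorem polyMinusForms_one_iff :
    ((∃ C : Complements (polyMinusForms 3 r 1), HasDecomposableInvariantBasis C) ↔
        ¬ ∃ m : ℕ, r = 3 * m + 2) ∧
      ∀ C : Complements (polyMinusForms 3 r 1), C.IsInvariant →
        (HasDecomposableInvariantBasis C ↔ ¬ ∃ m : ℕ, r = 3 * m + 2) := by
  classical
  refine exists_iff_and_forall_iff le_rfl permInvariant_polyMinusForms
    tracesExtend_polyMinusForms_one _ fun C hC => ?_
  rw [C.topTrace_polyMinusForms_one hC, C.baseTrace_polyMinusForms_one hC]
  split_ifs with h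
  · simp [h]
  · simp [h]

end PolyMinusOne

/-! ### The spaces `P_r Λ^2(T^3)` -/

section PolyTwo

variable {r : ℕ}

/-- Any two tangent vectors of an edge are linearly dependent. -/
theorem trace_two_eq_zero_of_card_eq_two {F : Finset (Fin 4)} (hF : F.card = 2)
    (ω : Form 3 2 Finset.univ) : trace 2 (Finset.subset_univ F) ω = 0 := by
  obtain ⟨a, b, hab, rfl⟩ := Finset.card_eq_two.1 hF
  rw [trace_eq_zero_iff']
  intro x _ v hv
  refine AlternatingMap.map_linearDependent _ _ fun hli => ?_
  rw [linearIndependent_fin2] at hli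
  have hb : ∀ j, (v j).1 b = -(v j).1 a := by
    intro j
    have h := (v j).2.1
    rw [← Finset.sum_subset (Finset.subset_univ {a, b}) fun i _ hi => hv j i hi,
      Finset.sum_pair hab] at h
    linarith
  have hext : ∀ u w : tangent 3 Finset.univ, u.1 a = w.1 a → u.1 b = w.1 b →
      (∀ i ∉ ({a, b} : Finset (Fin 4)), u.1 i = w.1 i) → u = w := by
    intro u w h1 h2 h3
    apply Subtype.ext
    funext i
    by_cases hi : i ∈ ({a, b} : Finset (Fin 4))
    · rcases Finset.mem_insert.1 hi with rfl | hi
      · exact h1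
      · rw [Finset.mem_singleton.1 hi]
        exact h2
    · exact h3 i hi
  have h1a : (v 1).1 a ≠ 0 := fun h => hli.1 (hext _ _ h (by rw [hb, h]; exact neg_zero)
    fun i hi => hv 1 i hi)
  refine hli.2 ((v 0).1 a / (v 1).1 a) (hext _ _ ?_ ?_ fun i hi => ?_)
  · change (v 0).1 a / (v 1).1 a * (v 1).1 a = _
    field_simp
  · change (v 0).1 a / (v 1).1 a * (v 1).1 b = _
    rw [hb, hb]
    field_simp
  · change (v 0).1 a / (v 1).1 a * (v 1).1 i = _
    rw [hv 0 i hi, hv 1 i hi, mul_zero]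

/-- For two-forms, traces extend if they do so from one triangle. -/
theorem tracesExtend_two {V : Submodule ℝ (Form 3 2 Finset.univ)} (hV : PermInvariant V)
    (h : ∀ ω ∈ V, ∃ η ∈ V, trace 2 (Finset.subset_univ baseFace.1) η
          = trace 2 (Finset.subset_univ baseFace.1) ω ∧
        ∀ i : Fin 3, trace 2 (Finset.subset_univ (Finset.univ.erase i.succ)) η = 0) :
    TracesExtend V :=
  tracesExtend_of_edges_of_base one_le_two hV
    (fun F hF ω _ => ⟨0, V.zero_mem, by rw [map_zero, trace_two_eq_zero_of_card_eq_two hF],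
      fun _ _ _ => map_zero _⟩) fun ω hω _ => h ω hω

/-- The trace on the forms associated with the triangle, from a faithful parametrization. -/
theorem Complements.trace_eq_baseTrace {k : ℕ} {V : Submodule ℝ (Form 3 k Finset.univ)}
    [FiniteDimensional ℝ V] {X : Type*} [AddCommGroup X] [Module ℝ X] [FiniteDimensional ℝ X]
    {C : Complements V} (hk : 1 ≤ k) (hC : C.IsInvariant) (hV : PermInvariant V)
    (E : X →ₗ[ℝ] Form 3 k Finset.univ) (u : End ℝ X)
    (hu : ∀ x, E (u x) = permRep 3 k cyc (E x)) (hE₀ : ∀ x, E x ∈ V)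
    (hE₁ : ∀ x, ∀ i : Fin 3, trace k (Finset.subset_univ (Finset.univ.erase i.succ)) (E x) = 0)
    (hE₂ : ∀ ω ∈ V, ∃ x, trace k (Finset.subset_univ baseFace.1) (E x)
        = trace k (Finset.subset_univ baseFace.1) ω)
    (hE₃ : ∀ x, trace k (Finset.subset_univ baseFace.1) (E x) = 0 → x = 0) :
    LinearMap.trace ℝ X u = C.baseTrace hk hC hV := by
  rw [C.trace_eq_baseTrace_add (L := PUnit.{1}) hk hC hV E u hu hE₀ hE₁ (fun ω hω _ => hE₂ ω hω)
    0 (fun _ _ _ => rfl) 0 (fun _ => by simp) fun x => ?_, map_zero, add_zero]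
  constructor
  · intro h
    rw [hE₃ x h]
    exact Submodule.zero_mem _
  · rintro ⟨y, rfl⟩
    simp

/-- Two-forms from their coefficients. -/
def twoForm (r : ℕ) : (Fin 3 → hom (Fin 4) r 0) →ₗ[ℝ] Form 3 2 Finset.univ :=
  tripleSum fun i => (mono ![(i + 1).succ, (i + 2).succ]).comp (mulHom r 0 1)

theorem twoForm_apply (A : Fin 3 → hom (Fin 4) r 0) (x : facePoints 3 Finset.univ)
    (v : Fin 2 → tangent 3 Finset.univ) :
    twoForm r A x v = ∑ i : Fin 3, eval x.1 (A i : MvPolynomial (Fin 4) ℝ) *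
      ((v 0).1 (i + 1).succ * (v 1).1 (i + 2).succ
        - (v 0).1 (i + 2).succ * (v 1).1 (i + 1).succ) := by
  rw [twoForm, tripleSum_apply, sum_form_apply]
  refine Finset.sum_congr rfl fun i _ => ?_
  rw [LinearMap.comp_apply, mono_two_apply, mulHom_apply, one_mul]

theorem twoForm_cyc (A : Fin 3 → hom (Fin 4) r 0) :
    twoForm r (shift (homRename r 0 cyc) A) = permRep 3 2 cyc (twoForm r A) :=
  tripleSum_mono_shift (by decide) (fun i q => rename_mulHom (map_one _) q) A

theorem range_twoForm : LinearMap.range (twoForm r) = polyForms 3 r 2 := by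
  apply le_antisymm
  · rintro _ ⟨A, rfl⟩
    rw [twoForm, tripleSum_apply]
    refine Submodule.sum_mem _ fun i _ => mono_mem_polyForms _ ?_
    rw [mulHom_apply, one_mul]
    exact (A i).2
  · refine polyForms_le fun I p hp => ?_
    obtain ⟨a, b, rfl⟩ : ∃ a b, I = ![a, b] := ⟨I 0, I 1, by funext a; fin_cases a <;> rfl⟩
    -- These are the coordinates of `dλ_a` with respect to `dλ₁, dλ₂, dλ₃`; the coefficients of
    -- `dλ_a ∧ dλ_b` are their minors.
    let d : Fin 4 → Fin 3 → ℝ := fun a i =>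
      (if a = i.succ then 1 else 0) - (if a = 0 then 1 else 0)
    have hd : ∀ (w : tangent 3 Finset.univ) a,
        w.1 a = d a 0 * w.1 1 + d a 1 * w.1 2 + d a 2 * w.1 3 := by
      intro w a
      have h0 := tangent_zero w
      fin_cases a
      · simp [d, h0]
        ring
      · simp [d]
      · simp [d]
      · simp [d]
    refine ⟨fun i => (d a (i + 1) * d b (i + 2) - d b (i + 1) * d a (i + 2)) • ⟨p, hp⟩, ?_⟩
    funext x
    ext v
    rw [twoForm_apply, mono_two_apply, hd (v 0) a, hd (v 0) b, hd (v 1) a, hd (v 1) b,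
      Fin.sum_univ_three]
    simp only [Submodule.coe_smul, MvPolynomial.smul_eval]
    change (d a 1 * d b 2 - d b 1 * d a 2) * eval x.1 p *
        ((v 0).1 2 * (v 1).1 3 - (v 0).1 3 * (v 1).1 2)
      + (d a 2 * d b 0 - d b 2 * d a 0) * eval x.1 p *
        ((v 0).1 3 * (v 1).1 1 - (v 0).1 1 * (v 1).1 3)
      + (d a 0 * d b 1 - d b 0 * d a 1) * eval x.1 p *
        ((v 0).1 1 * (v 1).1 2 - (v 0).1 2 * (v 1).1 1) = _
    ring

theorem eq_zero_of_twoForm_eq_zero {A : Fin 3 → hom (Fin 4) r 0} (h : twoForm r A = 0) :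
    A = 0 := by
  funext i
  apply Subtype.ext
  refine eq_zero_of_eval (A i).2 fun x hx hs => ?_
  have h1 : twoForm r A ⟨x, fun i => (hx i).le, hs, by simp⟩
      ![edgeVector (i + 1).succ 0, edgeVector (i + 2).succ 0] = 0 := by
    rw [h]
    rfl
  have key : ∀ i l : Fin 3, (i + 1 ≠ i + 2) ∧ (l ≠ i →
      ¬(l + 1 = i + 1 ∧ l + 2 = i + 2) ∧ ¬(l + 2 = i + 1 ∧ l + 1 = i + 2)) := by decide
  rw [twoForm_apply, Finset.sum_eq_single i] at h1
  · simpa [edgeVector_apply, (key i i).1, (key i i).1.symm] using h1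
  · intro l _ hl
    obtain ⟨h2, h3⟩ := (key i l).2 hl
    by_cases h4 : l + 1 = i + 1 <;> by_cases h5 : l + 2 = i + 2 <;>
      by_cases h6 : l + 2 = i + 1 <;> by_cases h7 : l + 1 = i + 2 <;>
      simp_all [edgeVector_apply]
  · simp

/-- The summands in Euler's formula. -/
def eulerBase (r : ℕ) (i : Fin 3) : hom (Fin 3) r 0 →ₗ[ℝ] MvPolynomial (Fin 4) ℝ :=
  (rename Fin.succ).toLinearMap.comp ((LinearMap.mulLeft ℝ (X i)).comp
    ((pderiv i).toLinearMap.comp (hom (Fin 3) r 0).subtype))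

theorem eulerBase_apply (i : Fin 3) (p : hom (Fin 3) r 0) :
    eulerBase r i p = rename Fin.succ (X i * pderiv i p.1) := rfl

theorem rename_eulerBase (i : Fin 3) (p : hom (Fin 3) r 0) :
    rename cyc (eulerBase r i p)
      = eulerBase r (i + 1) (homRename r 0 (fun i : Fin 3 => i + 1) p) := by
  rw [eulerBase_apply, eulerBase_apply, rename_cyc_rename_succ, map_mul, rename_X, homRename_coe,
    pderiv_rename (add_left_injective (1 : Fin 3))]

/-- The forms with vanishing traces on the other triangles. -/
def twoFormBase (r : ℕ) : hom (Fin 3) r 0 →ₗ[ℝ] Form 3 2 Finset.univ :=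
  (r : ℝ)⁻¹ • (tripleSum fun i => (mono ![(i + 1).succ, (i + 2).succ]).comp (eulerBase r i)).comp
    (constTriple (hom (Fin 3) r 0))

theorem twoFormBase_apply (p : hom (Fin 3) r 0) (x : facePoints 3 Finset.univ)
    (v : Fin 2 → tangent 3 Finset.univ) :
    twoFormBase r p x v = (r : ℝ)⁻¹ * ∑ i : Fin 3,
      x.1 i.succ * eval (fun i : Fin 3 => x.1 i.succ) (pderiv i p.1) *
      ((v 0).1 (i + 1).succ * (v 1).1 (i + 2).succ
        - (v 0).1 (i + 2).succ * (v 1).1 (i + 1).succ) := by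
  have h : twoFormBase r p x v = (r : ℝ)⁻¹ * (tripleSum (fun i : Fin 3 =>
      (mono ![(i + 1).succ, (i + 2).succ]).comp (eulerBase r i))
        (constTriple (hom (Fin 3) r 0) p) : Form 3 2 Finset.univ) x v := rfl
  rw [h, tripleSum_apply, sum_form_apply]
  congr 1
  refine Finset.sum_congr rfl fun i _ => ?_
  rw [LinearMap.comp_apply, mono_two_apply, eulerBase_apply, eval_rename', map_mul, eval_X]
  rfl

theorem twoFormBase_cyc (p : hom (Fin 3) r 0) :
    twoFormBase r (homRename r 0 (fun i : Fin 3 => i + 1) p)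
      = permRep 3 2 cyc (twoFormBase r p) := by
  rw [twoFormBase, LinearMap.smul_apply, LinearMap.smul_apply, map_smul, LinearMap.comp_apply,
    LinearMap.comp_apply]
  congr 1
  exact tripleSum_mono_shift (by decide) rename_eulerBase (constTriple _ p)

theorem twoFormBase_mem (p : hom (Fin 3) r 0) : twoFormBase r p ∈ polyForms 3 r 2 := by
  rw [twoFormBase, LinearMap.smul_apply, LinearMap.comp_apply, tripleSum_apply]
  refine Submodule.smul_mem _ _ (Submodule.sum_mem _ fun i _ => mono_mem_polyForms _ ?_)
  exact rename_mem_hom _ (X_mul_pderiv_mem_hom i p.2)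

theorem trace_twoFormBase (p : hom (Fin 3) r 0) (i : Fin 3) :
    trace 2 (Finset.subset_univ (Finset.univ.erase i.succ)) (twoFormBase r p) = 0 := by
  rw [trace_erase_eq_zero_iff]
  intro x hx v hv
  rw [twoFormBase_apply]
  rw [Finset.sum_eq_zero fun l _ => ?_, mul_zero]
  have hl : ∀ i l : Fin 3, i = l ∨ i = l + 1 ∨ i = l + 2 := by decide
  rcases hl i l with rfl | rfl | rfl
  · rw [hx]
    ring
  · rw [hv 0, hv 1]
    ring
  · rw [hv 0, hv 1]
    ring

/-- On the triangle, all the standard two-forms agree. -/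
theorem area_eq (v : Fin 2 → tangent 3 Finset.univ) (hv : ∀ j, (v j).1 0 = 0) (i : Fin 3) :
    (v 0).1 (i + 1).succ * (v 1).1 (i + 2).succ - (v 0).1 (i + 2).succ * (v 1).1 (i + 1).succ
      = (v 0).1 2 * (v 1).1 3 - (v 0).1 3 * (v 1).1 2 := by
  have h0 := tangent_zero (v 0)
  have h1 := tangent_zero (v 1)
  rw [hv] at h0 h1
  have h0' : (v 0).1 1 = -(v 0).1 2 - (v 0).1 3 := by linarith
  have h1' : (v 1).1 1 = -(v 1).1 2 - (v 1).1 3 := by linarith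
  fin_cases i
  · rfl
  · change (v 0).1 3 * (v 1).1 1 - (v 0).1 1 * (v 1).1 3 = _
    rw [h0', h1']
    ring
  · change (v 0).1 1 * (v 1).1 2 - (v 0).1 2 * (v 1).1 1 = _
    rw [h0', h1']
    ring

/-- On the triangle the three standard two-forms agree, so Euler's formula `∑ λ_i ∂_i p = r p` turns
the sum into `p` times the area form. Distributing `p` in this way is equivariant and puts the
factor `λ_i` on the only summand that need not vanish where `λ_i = 0`. -/
theorem twoFormBase_apply_base (hr : 1 ≤ r) (p : hom (Fin 3) r 0) (x : facePoints 3 Finset.univ)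
    (v : Fin 2 → tangent 3 Finset.univ) (hv : ∀ j, (v j).1 0 = 0) :
    twoFormBase r p x v = eval (fun i : Fin 3 => x.1 i.succ) p.1 *
      ((v 0).1 2 * (v 1).1 3 - (v 0).1 3 * (v 1).1 2) := by
  rw [twoFormBase_apply]
  simp only [area_eq v hv]
  have h := congrArg (eval fun i : Fin 3 => x.1 i.succ)
    (isHomogeneous_of_mem_hom p.2).sum_X_mul_pderiv
  simp only [map_sum, map_mul, eval_X, nsmul_eq_mul, map_natCast] at h
  have hr' : (r : ℝ) ≠ 0 := by positivity
  rw [← Finset.sum_mul, h]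
  field_simp

theorem exists_trace_twoFormBase_eq (hr : 1 ≤ r) {ω : Form 3 2 Finset.univ}
    (hω : ω ∈ polyForms 3 r 2) :
    ∃ p, trace 2 (Finset.subset_univ baseFace.1) (twoFormBase r p)
      = trace 2 (Finset.subset_univ baseFace.1) ω := by
  rw [← range_twoForm] at hω
  obtain ⟨b, rfl⟩ := hω
  refine ⟨⟨∑ i, killCompl (Fin.succ_injective 3) (b i).1,
    Submodule.sum_mem _ fun i _ => killCompl_mem_hom _ (b i).2⟩, ?_⟩
  rw [← sub_eq_zero, ← map_sub, trace_baseFace_eq_zero_iff]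
  intro x hx v hv
  change twoFormBase r _ x v - twoForm r b x v = 0
  rw [twoFormBase_apply_base hr _ x v hv, twoForm_apply]
  simp only [area_eq v hv]
  rw [← Finset.sum_mul, map_sum]
  simp only [eval_killCompl_succ _ _ hx, sub_self]

theorem eq_zero_of_trace_twoFormBase (hr : 1 ≤ r) (p : hom (Fin 3) r 0)
    (h : trace 2 (Finset.subset_univ baseFace.1) (twoFormBase r p) = 0) : p = 0 := by
  rw [trace_baseFace_eq_zero_iff] at h
  apply Subtype.ext
  refine eq_zero_of_eval p.2 fun y hy hs => ?_
  have hv : ∀ j, ((![edgeVector 2 1, edgeVector 3 1] : Fin 2 → tangent 3 Finset.univ) j).1 0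
      = 0 := by
    intro j
    fin_cases j <;> simp [edgeVector_apply]
  have h1 := h (basePoint y (fun i => (hy i).le) hs) rfl ![edgeVector 2 1, edgeVector 3 1] hv
  rw [twoFormBase_apply_base hr _ _ _ hv] at h1
  simpa [edgeVector_apply, basePoint_succ] using h1

-- The traces on the triangle are arbitrary homogeneous polynomials of degree `r` times the area
-- form, which the three-cycle preserves.
open scoped Classical in
theorem Complements.baseTrace_polyForms_two (hr : 1 ≤ r) {C : Complements (polyForms 3 r 2)}
    (hC : C.IsInvariant) : C.baseTrace one_le_two hC permInvariant_polyForms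
      = if ∃ m : ℕ, r = 3 * m + 0 then 1 else 0 := by
  rw [← trace_homRename]
  exact (C.trace_eq_baseTrace one_le_two hC permInvariant_polyForms (twoFormBase r) _
    twoFormBase_cyc twoFormBase_mem trace_twoFormBase
    (fun ω => exists_trace_twoFormBase_eq hr) (eq_zero_of_trace_twoFormBase hr)).symm

theorem trace_cyc_polyForms_two :
    LinearMap.trace ℝ (polyForms 3 r 2) (subRep permInvariant_polyForms cyc) = 0 := by
  rw [trace_subRep_eq permInvariant_polyForms cyc (twoForm r) _ twoForm_cyc range_twoForm
    fun A => eq_zero_of_twoForm_eq_zero, trace_shift]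

theorem polyForms_two_iff (hr : 1 ≤ r) :
    ((∃ C : Complements (polyForms 3 r 2), HasDecomposableInvariantBasis C) ↔
        ¬ ∃ m : ℕ, r = 3 * m + 3) ∧
      ∀ C : Complements (polyForms 3 r 2), C.IsInvariant →
        (HasDecomposableInvariantBasis C ↔ ¬ ∃ m : ℕ, r = 3 * m + 3) := by
  classical
  have hE : TracesExtend (polyForms 3 r 2) := tracesExtend_two permInvariant_polyForms
    fun ω hω => by
      obtain ⟨p, hp⟩ := exists_trace_twoFormBase_eq hr hω
      exact ⟨_, twoFormBase_mem p, hp, trace_twoFormBase p⟩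
  refine exists_iff_and_forall_iff one_le_two permInvariant_polyForms hE _ fun C hC => ?_
  have h1 := trace_subRep_cyc one_le_two hC permInvariant_polyForms hE
  rw [trace_cyc_polyForms_two] at h1
  have h2 := C.baseTrace_polyForms_two hr hC
  -- The two conditions differ only at `r = 0`, which is excluded.
  have h3 : (∃ m : ℕ, r = 3 * m + 0) ↔ ∃ m : ℕ, r = 3 * m + 3 :=
    ⟨fun ⟨m, hm⟩ => ⟨m - 1, by omega⟩, fun ⟨m, hm⟩ => ⟨m + 1, by omega⟩⟩
  simp only [h3] at h2
  split_ifs at h2 with h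
  · simp only [h, not_true_eq_false, iff_false, not_and, not_le]
    intro _
    linarith
  · simp only [h, not_false_eq_true, iff_true]
    constructor <;> linarith

end PolyTwo

/-! ### The spaces `P_r^- Λ^2(T^3)` -/

section PolyMinusTwo

variable {r : ℕ}

theorem monoX_comp_perm {n k : ℕ} (J : Fin (k + 1) → Fin (n + 1)) (τ : Equiv.Perm (Fin (k + 1)))
    (p : MvPolynomial (Fin (n + 1)) ℝ) :
    (monoX (J ∘ τ) p : Form n k Finset.univ) = (Equiv.Perm.sign τ : ℝ) • monoX J p := by
  funext x
  ext v
  change monoX (J ∘ τ) p x v = (Equiv.Perm.sign τ : ℝ) * monoX J p x v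
  rw [monoX_apply, monoX_apply, dl_apply, dl_apply, mul_left_comm, ← Matrix.det_permute']
  rfl

theorem monoX_two_eq_zero {a b c : Fin 4} (h : a = b ∨ b = c ∨ a = c)
    (p : MvPolynomial (Fin 4) ℝ) : (monoX ![a, b, c] p : Form 3 2 Finset.univ) = 0 := by
  funext x
  ext v
  rw [monoX_two_apply]
  change _ = 0
  rcases h with rfl | rfl | rfl <;> ring

/-- The forms that involve the vertex `0`. -/
def twoFormMinus (r : ℕ) : (Fin 3 → hom (Fin 4) r 1) →ₗ[ℝ] Form 3 2 Finset.univ :=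
  tripleSum fun i => (monoX ![0, (i + 1).succ, (i + 2).succ]).comp (mulHom r 1 1)

theorem twoFormMinus_apply (A : Fin 3 → hom (Fin 4) r 1) (x : facePoints 3 Finset.univ)
    (v : Fin 2 → tangent 3 Finset.univ) :
    twoFormMinus r A x v
      = ∑ i : Fin 3, monoX ![0, (i + 1).succ, (i + 2).succ] (A i).1 x v := by
  rw [twoFormMinus, tripleSum_apply, sum_form_apply]
  refine Finset.sum_congr rfl fun i _ => ?_
  rw [LinearMap.comp_apply, mulHom_apply, one_mul]

theorem exists_coeff_polyMinusForms_two {ω : Form 3 2 Finset.univ}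
    (hω : ω ∈ polyMinusForms 3 r 2) :
    ∃ q ∈ hom (Fin 4) r 1, ∃ A, ω = monoX ![1, 2, 3] q + twoFormMinus r A := by
  have h : polyMinusForms 3 r 2 ≤ (hom (Fin 4) r 1).map (monoX ![1, 2, 3])
      ⊔ LinearMap.range (twoFormMinus r) := polyMinusForms_le fun J p hp => by
    obtain ⟨a, b, c, rfl⟩ : ∃ a b c, J = ![a, b, c] :=
      ⟨J 0, J 1, J 2, by funext a; fin_cases a <;> rfl⟩
    -- Up to order, three distinct vertices are either those of the base triangle or 0 and two
    -- others; reordering costs a sign.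
    have key : ∀ a b c : Fin 4, (a = b ∨ b = c ∨ a = c) ∨ ∃ τ : Equiv.Perm (Fin 3),
        ![a, b, c] = ![1, 2, 3] ∘ τ ∨
          ∃ i : Fin 3, ![a, b, c] = ![0, (i + 1).succ, (i + 2).succ] ∘ τ := by
      set_option maxRecDepth 4000 in
      decide
    rcases key a b c with h | ⟨τ, h | ⟨i, h⟩⟩
    · rw [monoX_two_eq_zero h]
      exact Submodule.zero_mem _
    · rw [h, monoX_comp_perm]
      exact Submodule.smul_mem _ _ (Submodule.mem_sup_left (Submodule.mem_map_of_mem hp))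
    · rw [h, monoX_comp_perm]
      refine Submodule.smul_mem _ _ (Submodule.mem_sup_right ⟨Pi.single i ⟨p, hp⟩, ?_⟩)
      rw [twoFormMinus, tripleSum_apply, Finset.sum_eq_single i]
      · rw [Pi.single_eq_same, LinearMap.comp_apply, mulHom_apply, one_mul]
      · intro l _ hl
        rw [Pi.single_eq_of_ne hl, map_zero]
      · simp
  obtain ⟨_, ⟨q, hq, rfl⟩, _, ⟨A, rfl⟩, h⟩ := Submodule.mem_sup.1 (h hω)
  exact ⟨q, hq, A, h.symm⟩

/-- The forms with vanishing traces on the other triangles. -/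
def twoFormMinusBase (r : ℕ) : hom (Fin 3) r 1 →ₗ[ℝ] Form 3 2 Finset.univ :=
  (monoX ![1, 2, 3]).comp (mulBase r 1 1)

theorem twoFormMinusBase_eq (p : hom (Fin 3) r 1) :
    twoFormMinusBase r p = monoX ![1, 2, 3] (rename Fin.succ p.1) := by
  rw [twoFormMinusBase, LinearMap.comp_apply, mulBase_apply, one_mul]

theorem twoFormMinusBase_cyc (p : hom (Fin 3) r 1) :
    twoFormMinusBase r (homRename r 1 (fun i : Fin 3 => i + 1) p)
      = permRep 3 2 cyc (twoFormMinusBase r p) := by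
  rw [twoFormMinusBase_eq, twoFormMinusBase_eq, permRep_monoX, rename_cyc_rename_succ,
    show cyc ∘ ![1, 2, 3] = ![2, 3, 1] by decide]
  funext x
  ext v
  rw [monoX_two_apply, monoX_two_apply, homRename_coe]
  ring

theorem twoFormMinusBase_mem (p : hom (Fin 3) r 1) :
    twoFormMinusBase r p ∈ polyMinusForms 3 r 2 := by
  rw [twoFormMinusBase_eq]
  exact monoX_mem_polyMinusForms _ (rename_mem_hom _ p.2)

theorem monoX_two_apply_eq_zero {a b c i : Fin 4} (h : i = a ∨ i = b ∨ i = c)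
    (p : MvPolynomial (Fin 4) ℝ) {x : facePoints 3 Finset.univ} (hx : x.1 i = 0)
    {v : Fin 2 → tangent 3 Finset.univ} (hv : ∀ j, (v j).1 i = 0) :
    monoX ![a, b, c] p x v = 0 := by
  rw [monoX_two_apply]
  rcases h with rfl | rfl | rfl <;> rw [hx, hv 0, hv 1] <;> ring

theorem trace_twoFormMinusBase (p : hom (Fin 3) r 1) (i : Fin 3) :
    trace 2 (Finset.subset_univ (Finset.univ.erase i.succ)) (twoFormMinusBase r p) = 0 := by
  rw [trace_erase_eq_zero_iff, twoFormMinusBase_eq]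
  intro x hx v hv
  exact monoX_two_apply_eq_zero
    ((by decide : ∀ i : Fin 3, i.succ = 1 ∨ i.succ = 2 ∨ i.succ = 3) i) _ hx hv

theorem exists_trace_twoFormMinusBase_eq {ω : Form 3 2 Finset.univ}
    (hω : ω ∈ polyMinusForms 3 r 2) :
    ∃ p, trace 2 (Finset.subset_univ baseFace.1) (twoFormMinusBase r p)
      = trace 2 (Finset.subset_univ baseFace.1) ω := by
  obtain ⟨q, hq, A, rfl⟩ := exists_coeff_polyMinusForms_two hω
  refine ⟨⟨killCompl (Fin.succ_injective 3) q, killCompl_mem_hom _ hq⟩, ?_⟩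
  rw [← sub_eq_zero, ← map_sub, trace_baseFace_eq_zero_iff, twoFormMinusBase_eq]
  intro x hx v hv
  change monoX ![1, 2, 3] _ x v - (monoX ![1, 2, 3] q x v + twoFormMinus r A x v) = 0
  rw [twoFormMinus_apply, Finset.sum_eq_zero fun i _ =>
    monoX_two_apply_eq_zero (Or.inl rfl) _ hx hv, monoX_apply, monoX_apply, eval_rename',
    eval_killCompl_succ _ _ hx, add_zero, sub_self]

/-- The vectors `e_a - x` and `e_b - x` are tangent to the facet `λ_l = 0` when `x` lies on it and
`l` is neither `a` nor `b`, so they can serve to test traces there. -/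
theorem radialVector_pair_eq_zero {x : facePoints 3 Finset.univ} {a b l : Fin 4}
    (hx : x.1 l = 0) (ha : l ≠ a) (hb : l ≠ b) (j : Fin 2) :
    ((![radialVector x a, radialVector x b] : Fin 2 → tangent 3 Finset.univ) j).1 l = 0 := by
  fin_cases j <;> simp [radialVector_apply, hx, ha, hb]

theorem monoX_radialVector_base (q : MvPolynomial (Fin 4) ℝ) (x : facePoints 3 Finset.univ) :
    monoX ![1, 2, 3] q x ![radialVector x 2, radialVector x 3] = eval x.1 q * x.1 1 := by
  rw [monoX_two_apply]
  congr 1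
  simp [radialVector_apply]
  ring

theorem eq_zero_of_trace_twoFormMinusBase (p : hom (Fin 3) r 1)
    (h : trace 2 (Finset.subset_univ baseFace.1) (twoFormMinusBase r p) = 0) : p = 0 := by
  rw [trace_baseFace_eq_zero_iff, twoFormMinusBase_eq] at h
  apply Subtype.ext
  refine eq_zero_of_eval p.2 fun y hy hs => ?_
  let x := basePoint y (fun i => (hy i).le) hs
  have h1 := h x rfl ![radialVector x 2, radialVector x 3]
    (radialVector_pair_eq_zero rfl (by decide) (by decide))
  rw [monoX_radialVector_base, eval_basePoint_rename] at h1
  exact (mul_eq_zero.1 h1).resolve_right (hy 0).ne'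

open scoped Classical in
theorem Complements.baseTrace_polyMinusForms_two {C : Complements (polyMinusForms 3 r 2)}
    (hC : C.IsInvariant) : C.baseTrace one_le_two hC permInvariant_polyMinusForms
      = if ∃ m : ℕ, r = 3 * m + 1 then 1 else 0 := by
  rw [← trace_homRename]
  exact (C.trace_eq_baseTrace one_le_two hC permInvariant_polyMinusForms (twoFormMinusBase r) _
    twoFormMinusBase_cyc twoFormMinusBase_mem trace_twoFormMinusBase
    (fun ω => exists_trace_twoFormMinusBase_eq) eq_zero_of_trace_twoFormMinusBase).symm

/-- The forms with vanishing traces on all triangles. -/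
def twoFormMinusTop (r : ℕ) : (Fin 3 → hom (Fin 4) r 2) →ₗ[ℝ] Form 3 2 Finset.univ :=
  tripleSum fun i => (monoX ![0, (i + 1).succ, (i + 2).succ]).comp (mulHom r 2 (X i.succ))

theorem twoFormMinusTop_apply (A : Fin 3 → hom (Fin 4) r 2) (x : facePoints 3 Finset.univ)
    (v : Fin 2 → tangent 3 Finset.univ) :
    twoFormMinusTop r A x v
      = ∑ i : Fin 3, monoX ![0, (i + 1).succ, (i + 2).succ] (X i.succ * (A i).1) x v := by
  rw [twoFormMinusTop, tripleSum_apply, sum_form_apply]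
  rfl

theorem twoFormMinusTop_cyc (A : Fin 3 → hom (Fin 4) r 2) :
    twoFormMinusTop r (shift (homRename r 2 cyc) A) = permRep 3 2 cyc (twoFormMinusTop r A) :=
  tripleSum_monoX_shift (by decide)
    (fun i q => rename_mulHom (by rw [rename_X, cyc_succ]) q) A

theorem twoFormMinusTop_mem (A : Fin 3 → hom (Fin 4) r 2) :
    twoFormMinusTop r A ∈ filtration (polyMinusForms 3 r 2) 3 := by
  rw [mem_filtration_three]
  refine ⟨?_, ?_, fun i => ?_⟩
  · rw [twoFormMinusTop, tripleSum_apply]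
    exact Submodule.sum_mem _ fun i _ =>
      monoX_mem_polyMinusForms _ (X_mul_mem_hom _ (A i).2)
  · rw [trace_baseFace_eq_zero_iff]
    intro x hx v hv
    rw [twoFormMinusTop_apply]
    exact Finset.sum_eq_zero fun l _ => monoX_two_apply_eq_zero (Or.inl rfl) _ hx hv
  · rw [trace_erase_eq_zero_iff]
    intro x hx v hv
    rw [twoFormMinusTop_apply]
    refine Finset.sum_eq_zero fun l _ => ?_
    have hl : ∀ i l : Fin 3, i = l ∨ i = l + 1 ∨ i = l + 2 := by decide
    rcases hl i l with rfl | rfl | rfl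
    · rw [monoX_apply, map_mul, eval_X, hx, zero_mul, zero_mul]
    · exact monoX_two_apply_eq_zero (Or.inr (Or.inl rfl)) _ hx hv
    · exact monoX_two_apply_eq_zero (Or.inr (Or.inr rfl)) _ hx hv

/-- Contraction with `X` makes subtracting `x` immaterial, so this evaluation isolates one of the
three coefficients. -/
theorem monoX_radialVector (q : MvPolynomial (Fin 4) ℝ) (x : facePoints 3 Finset.univ)
    (i l : Fin 3) : monoX ![0, (l + 1).succ, (l + 2).succ] q x
      ![radialVector x (i + 1).succ, radialVector x (i + 2).succ]
        = if l = i then eval x.1 q * x.1 0 else 0 := by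
  have h : (if l = i then eval x.1 q * x.1 0 else 0)
      = eval x.1 q * if l = i then x.1 0 else 0 := by rw [mul_ite, mul_zero]
  rw [monoX_two_apply, h]
  congr 1
  simp only [Matrix.cons_val, radialVector_apply]
  fin_cases i <;> fin_cases l <;> simp <;> ring

/-- The relation between the forms `i_X (dλ_i ∧ dλ_j ∧ dλ_k)`. -/
theorem monoX_X_zero_mul (q : MvPolynomial (Fin 4) ℝ) (x : facePoints 3 Finset.univ)
    (v : Fin 2 → tangent 3 Finset.univ) : monoX ![1, 2, 3] (X 0 * q) x v
      = ∑ i : Fin 3, monoX ![0, (i + 1).succ, (i + 2).succ] (X i.succ * q) x v := by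
  rw [Fin.sum_univ_three]
  simp only [monoX_two_apply, map_mul, eval_X]
  change x.1 0 * _ * (x.1 1 * ((v 0).1 2 * (v 1).1 3 - (v 0).1 3 * (v 1).1 2)
      + x.1 2 * ((v 0).1 3 * (v 1).1 1 - (v 0).1 1 * (v 1).1 3)
      + x.1 3 * ((v 0).1 1 * (v 1).1 2 - (v 0).1 2 * (v 1).1 1)) =
    x.1 1 * _ * (x.1 0 * ((v 0).1 2 * (v 1).1 3 - (v 0).1 3 * (v 1).1 2)
      + x.1 2 * ((v 0).1 3 * (v 1).1 0 - (v 0).1 0 * (v 1).1 3)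
      + x.1 3 * ((v 0).1 0 * (v 1).1 2 - (v 0).1 2 * (v 1).1 0))
    + x.1 2 * _ * (x.1 0 * ((v 0).1 3 * (v 1).1 1 - (v 0).1 1 * (v 1).1 3)
      + x.1 3 * ((v 0).1 1 * (v 1).1 0 - (v 0).1 0 * (v 1).1 1)
      + x.1 1 * ((v 0).1 0 * (v 1).1 3 - (v 0).1 3 * (v 1).1 0))
    + x.1 3 * _ * (x.1 0 * ((v 0).1 1 * (v 1).1 2 - (v 0).1 2 * (v 1).1 1)
      + x.1 1 * ((v 0).1 2 * (v 1).1 0 - (v 0).1 0 * (v 1).1 2)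
      + x.1 2 * ((v 0).1 0 * (v 1).1 1 - (v 0).1 1 * (v 1).1 0))
  ring

/-- Vanishing on the base triangle makes the coefficient of `i_X(dλ₁ ∧ dλ₂ ∧ dλ₃)` divisible by
`λ₀`, so the relation coming from `i_X i_X = 0` moves this term into those involving the vertex 0.
Vanishing on the facet `λ_i = 0` then makes the `i`-th of their coefficients divisible by `λ_i`. -/
theorem exists_twoFormMinusTop_eq {ω : Form 3 2 Finset.univ}
    (hω : ω ∈ filtration (polyMinusForms 3 r 2) 3) : ∃ A, twoFormMinusTop r A = ω := by
  rw [mem_filtration_three] at hω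
  obtain ⟨hω, h0, hi⟩ := hω
  obtain ⟨q, hq, B, rfl⟩ := exists_coeff_polyMinusForms_two hω
  have hnn : ∀ (i : Fin 4) (x : Fin 4 → ℝ), x i = 0 → (∀ l, l ≠ i → 0 < x l) → ∀ l, 0 ≤ x l :=
    fun i x h0 hx l => by
      by_cases hl : l = i
      · rw [hl, h0]
      · exact (hx l hl).le
  obtain ⟨s, hs, rfl⟩ := exists_eq_X_mul 0 hq fun x hx0 hx hs => by
    let x' : facePoints 3 Finset.univ := ⟨x, hnn 0 x hx0 hx, hs, by simp⟩
    have hv := radialVector_pair_eq_zero (x := x') (a := 2) (b := 3) hx0 (by decide) (by decide)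
    have h1 := trace_baseFace_eq_zero_iff.1 h0 x' hx0 _ hv
    change monoX ![1, 2, 3] q _ _ + twoFormMinus r B _ _ = 0 at h1
    rw [twoFormMinus_apply, Finset.sum_eq_zero fun i _ =>
      monoX_two_apply_eq_zero (Or.inl rfl) _ hx0 hv, add_zero,
      monoX_radialVector_base] at h1
    exact (mul_eq_zero.1 h1).resolve_right (hx 1 (by decide)).ne'
  have hω' : monoX ![1, 2, 3] (X 0 * s) + twoFormMinus r B
      = twoFormMinus r (fun i => ⟨X i.succ * s + (B i).1,
          Submodule.add_mem _ (X_mul_mem_hom _ hs) (B i).2⟩) := by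
    funext x
    ext v
    change monoX ![1, 2, 3] (X 0 * s) x v + twoFormMinus r B x v = _
    rw [monoX_X_zero_mul, twoFormMinus_apply, twoFormMinus_apply, ← Finset.sum_add_distrib]
    refine Finset.sum_congr rfl fun i _ => ?_
    rw [map_add]
    rfl
  rw [hω'] at hi ⊢
  set D : Fin 3 → hom (Fin 4) r 1 := fun i => ⟨X i.succ * s + (B i).1,
    Submodule.add_mem _ (X_mul_mem_hom _ hs) (B i).2⟩ with hD
  have hA : ∀ i : Fin 3, ∃ A ∈ hom (Fin 4) r 2, (D i).1 = X i.succ * A := by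
    intro i
    refine exists_eq_X_mul i.succ (D i).2 fun x hx0 hx hs => ?_
    have key : ∀ i : Fin 3, i.succ ≠ (i + 1).succ ∧ i.succ ≠ (i + 2).succ := by decide
    let x' : facePoints 3 Finset.univ := ⟨x, hnn _ x hx0 hx, hs, by simp⟩
    have h1 := trace_erase_eq_zero_iff.1 (hi i) x' hx0
      ![radialVector x' (i + 1).succ, radialVector x' (i + 2).succ]
      (radialVector_pair_eq_zero hx0 (key i).1 (key i).2)
    rw [twoFormMinus_apply] at h1
    simp only [monoX_radialVector, Finset.sum_ite_eq', Finset.mem_univ, if_true] at h1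
    exact (mul_eq_zero.1 h1).resolve_right (hx 0 (Fin.succ_ne_zero i).symm).ne'
  choose A hA hDA using hA
  refine ⟨fun i => ⟨A i, hA i⟩, ?_⟩
  funext x
  ext v
  rw [twoFormMinusTop_apply, twoFormMinus_apply]
  simp only [hDA]

theorem eq_zero_of_twoFormMinusTop_eq_zero {A : Fin 3 → hom (Fin 4) r 2}
    (h : twoFormMinusTop r A = 0) : A = 0 := by
  funext i
  apply Subtype.ext
  refine eq_zero_of_eval (A i).2 fun x hx hs => ?_
  let x' : facePoints 3 Finset.univ := ⟨x, fun i => (hx i).le, hs, by simp⟩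
  have h1 : twoFormMinusTop r A x'
      ![radialVector x' (i + 1).succ, radialVector x' (i + 2).succ] = 0 := by
    rw [h]
    rfl
  rw [twoFormMinusTop_apply] at h1
  simp only [monoX_radialVector, Finset.sum_ite_eq', Finset.mem_univ, if_true, map_mul,
    eval_X] at h1
  exact (mul_eq_zero.1 ((mul_eq_zero.1 h1).resolve_right (hx 0).ne')).resolve_left (hx _).ne'

theorem Complements.topTrace_polyMinusForms_two {C : Complements (polyMinusForms 3 r 2)}
    (hC : C.IsInvariant) : C.topTrace one_le_two hC permInvariant_polyMinusForms = 0 := by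
  rw [← C.trace_eq_topTrace one_le_two hC permInvariant_polyMinusForms (twoFormMinusTop r) _
    twoFormMinusTop_cyc twoFormMinusTop_mem (fun ω => exists_twoFormMinusTop_eq)
    fun A => eq_zero_of_twoFormMinusTop_eq_zero, trace_shift]

/-- The trace on the triangle is 0 or 1 and that on the tetrahedron is 0, so the criterion always
holds. -/
theorem polyMinusForms_two :
    (∃ C : Complements (polyMinusForms 3 r 2), HasDecomposableInvariantBasis C) ∧
      ∀ C : Complements (polyMinusForms 3 r 2), C.IsInvariant →
        HasDecomposableInvariantBasis C := by
  classical
  have hE : TracesExtend (polyMinusForms 3 r 2) := tracesExtend_two permInvariant_polyMinusForms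
    fun ω hω => by
      obtain ⟨p, hp⟩ := exists_trace_twoFormMinusBase_eq hω
      exact ⟨_, twoFormMinusBase_mem p, hp, trace_twoFormMinusBase p⟩
  have h := exists_iff_and_forall_iff one_le_two permInvariant_polyMinusForms hE True
    fun C hC => by
      rw [C.topTrace_polyMinusForms_two hC, C.baseTrace_polyMinusForms_two hC, iff_true]
      refine ⟨?_, le_rfl⟩
      split_ifs <;> norm_num
  exact ⟨h.1.2 trivial, fun C hC => (h.2 C hC).2 trivial⟩

end PolyMinusTwo

end FEEC

end

theorem mainTheorem3 (r : ℕ) (hr : 1 ≤ r) :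
    -- `P_r Λ^1(T^3)`
    (((∃ C : FEEC.Complements (FEEC.polyForms 3 r 1), FEEC.HasDecomposableInvariantBasis C) ↔
        ¬ ∃ m : ℕ, r = 3 * m + 3) ∧
      ∀ C : FEEC.Complements (FEEC.polyForms 3 r 1), C.IsInvariant →
        (FEEC.HasDecomposableInvariantBasis C ↔ ¬ ∃ m : ℕ, r = 3 * m + 3)) ∧
    -- `P_r^- Λ^1(T^3)`
    (((∃ C : FEEC.Complements (FEEC.polyMinusForms 3 r 1), FEEC.HasDecomposableInvariantBasis C) ↔
        ¬ ∃ m : ℕ, r = 3 * m + 2) ∧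
      ∀ C : FEEC.Complements (FEEC.polyMinusForms 3 r 1), C.IsInvariant →
        (FEEC.HasDecomposableInvariantBasis C ↔ ¬ ∃ m : ℕ, r = 3 * m + 2)) ∧
    -- `P_r Λ^2(T^3)`
    (((∃ C : FEEC.Complements (FEEC.polyForms 3 r 2), FEEC.HasDecomposableInvariantBasis C) ↔
        ¬ ∃ m : ℕ, r = 3 * m + 3) ∧
      ∀ C : FEEC.Complements (FEEC.polyForms 3 r 2), C.IsInvariant →
        (FEEC.HasDecomposableInvariantBasis C ↔ ¬ ∃ m : ℕ, r = 3 * m + 3)) ∧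
    -- `P_r^- Λ^2(T^3)`
    ((∃ C : FEEC.Complements (FEEC.polyMinusForms 3 r 2), FEEC.HasDecomposableInvariantBasis C) ∧
      ∀ C : FEEC.Complements (FEEC.polyMinusForms 3 r 2), C.IsInvariant →
        FEEC.HasDecomposableInvariantBasis C) := by
  exact ⟨FEEC.polyForms_one_iff hr, FEEC.polyMinusForms_one_iff, FEEC.polyForms_two_iff hr,
    FEEC.polyMinusForms_two⟩
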